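/- \textbf{Setup.} The Magnus commutator $\mu_k(Y_1,\dots,Y_k)$ is the part of $\log(\exp Y_1\cdots\exp Y_k)$ (free noncommutative variables, real coefficients) in which every variable has multiplicity one. It is the commutator evaluation of a Lie polynomial $\mu_k^{\mathrm{Lie}}$. Let \[\Theta_k^{\mathrm{Lie}}=\frac1{k!}\inf\Bigl\{\sum_M|\theta_M| : \mu_k^{\mathrm{Lie}}=\sum_M\theta_M M\Bigr\},\] where $M$ ranges over the Lie monomials of $Y_1,\dots,Y_k$ in which every variable occurs exactly once, and let $\mathrm C^{\mathrm{Lie}}_\infty\in[0,\infty]$ be the convergence radius of $\sum_{k\ge1}\Theta_k^{\mathrm{Lie}}x^k$. For $n\ge1$ identify $f\in L^1([0,1]^n)$ with the noncommutative integral $\int f(t)\,Z(t_1)\cdots Z(t_n)$, where $Z$ is the tautological (totally noncommutative) measure of mass one on $[0,1]$. Put $|f|_{\ell^1}=\int_{[0,1]^n}|f|$, and let $\|f\|_{\ell^1}$ be the infimum of $\sum_j\int_{[0,1]^n}|g_j|$ over all finite presentations \[\int f(t)\,Z(t_1)\cdots Z(t_n)=\sum_j\int g_j(s)\,Q_j\bigl(Z(s_1),\dots,Z(s_n)\bigr),\qquad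 g_j\in L^1([0,1]^n),\] where each $Q_j(Y_1,\dots,Y_n)$ is a product of commutator monomials in which every variable occurs exactly once in total. For a finite real sequence let $\mathrm{asc}$ and $\mathrm{des}$ be its numbers of ascents and descents. For $\lambda,t_0,t'\in[0,1]$ let $f(t_1,\dots,t_n)=\lambda^{\mathrm{asc}(t_0,t_1,\dots,t_n,t')}(\lambda-1)^{\mathrm{des}(t_0,t_1,\dots,t_n,t')}$ and put \[K_n^{(\lambda)}(t_0,t')=|f|_{\ell^1},\qquad K_n^{(\lambda),\mathrm{Lie}}(t_0,t')=\|f\|_{\ell^1}.\] Let $w(\lambda)=\dfrac{1-2\lambda}{\log\frac{1-\lambda}{\lambda}}$ for $\lambda\in(0,1)\setminus\{\frac12\}$, $w(\frac12)=\frac12$, $w(0)=w(1)=0$. \textbf{Theorem.} Let $p\ge2$ be an integer and $n=p-1$. (1) For $\lambda\in[0,1]$, both kernels depend only on $t=t'-t_0\in[-1,1]$; write them $K_n^{(\lambda)}(t)$ and $K_n^{(\lambda),\mathrm{Lie}}(t)$. (2) For $\lambda\in(0,1)$ one has $K_n^{(\lambda)}(t)>0$ for all $t\in[-1,1]$, the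 maximum \[S_n(\lambda)=\max_{t\in[-1,1]}\frac{K_n^{(\lambda),\mathrm{Lie}}(t)}{K_n^{(\lambda)}(t)}\] exists, and $S_n(\lambda)<1$ if $n\ge2$. Put $S_n(0)=S_n(1)=1$. (3) The maximum $m_n=\max_{\lambda\in[0,1]}w(\lambda)\,S_n(\lambda)^{1/p}$ exists, is positive, and \[\mathrm C^{\mathrm{Lie}}_\infty\ \ge\ \frac1{m_n}.\] If $n\ge2$, then $1/m_n>2$; moreover $1/m_2>2.183$, $1/m_3>2.247$ and $1/m_4>2.333$. In particular $\mathrm C^{\mathrm{Lie}}_\infty>2$, $>2.183$, $>2.247$ and $>2.333$. -/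

import Mathlib

open MeasureTheory Set

namespace MagnusLie

noncomputable section

/-! ### Noncommutative polynomials, Lie monomials, Magnus commutators -/

/-- Real noncommutative polynomials in the variables `Y_0, …, Y_{n-1}`. -/
abbrev NCPoly (n : ℕ) : Type := MonoidAlgebra ℝ (FreeMonoid (Fin n))

/-- The variable `Y_i`. -/
def gen {n : ℕ} (i : Fin n) : NCPoly n := MonoidAlgebra.single (FreeMonoid.of i) 1

/-- The multilinear word `Y_{σ(0)} Y_{σ(1)} ⋯ Y_{σ(n-1)}`. -/
def permWord {n : ℕ} (σ : Equiv.Perm (Fin n)) : FreeMonoid (Fin n) :=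
  FreeMonoid.ofList (List.ofFn fun i => σ i)

/-! The Lie bracket of an associative algebra is the commutator. -/

attribute [local instance 100] LieRing.ofAssociativeRing

/-- The commutator evaluation of Lie polynomials: the Lie algebra homomorphism from the free Lie
algebra to the free associative algebra which fixes the generators. -/
def toAssoc (n : ℕ) : FreeLieAlgebra ℝ (Fin n) →ₗ⁅ℝ⁆ NCPoly n :=
  FreeLieAlgebra.lift ℝ (gen : Fin n → NCPoly n)

theorem toAssoc_of {n : ℕ} (i : Fin n) : toAssoc n (FreeLieAlgebra.of ℝ i) = gen i :=
  FreeLieAlgebra.lift_of_apply _ i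

theorem toAssoc_bracket {n : ℕ} (M N : FreeLieAlgebra ℝ (Fin n)) :
    toAssoc n ⁅M, N⁆ = toAssoc n M * toAssoc n N - toAssoc n N * toAssoc n M := by
  rw [LieHom.map_lie, LieRing.of_associative_ring_bracket]

/-- `IsLieMonomial s M`: `M` is an iterated bracket in which each of the variables with index
in `s` occurs exactly once, and no other variable occurs. -/
inductive IsLieMonomial {n : ℕ} : Finset (Fin n) → FreeLieAlgebra ℝ (Fin n) → Prop
  | of (i : Fin n) : IsLieMonomial {i} (FreeLieAlgebra.of ℝ i)
  | bracket {s t : Finset (Fin n)} {M N : FreeLieAlgebra ℝ (Fin n)} :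
      IsLieMonomial s M → IsLieMonomial t N → Disjoint s t → IsLieMonomial (s ∪ t) ⁅M, N⁆

/-- `IsCommProduct s Q`: `Q` is an associative product `M_1 ⋯ M_r` of commutator monomials in
which each of the variables with index in `s` occurs exactly once, and no other variable. -/
inductive IsCommProduct {n : ℕ} : Finset (Fin n) → NCPoly n → Prop
  | one : IsCommProduct ∅ 1
  | mul {s t : Finset (Fin n)} {M : FreeLieAlgebra ℝ (Fin n)} {Q : NCPoly n} :
      IsLieMonomial s M → IsCommProduct t Q → Disjoint s t →
        IsCommProduct (s ∪ t) (toAssoc n M * Q)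

/-- The exponential series, truncated after degree `k`. -/
def expTrunc {n : ℕ} (k : ℕ) (x : NCPoly n) : NCPoly n :=
  ∑ j ∈ Finset.range (k + 1), (1 / (j.factorial : ℝ)) • x ^ j

/-- The logarithm series `log y = ∑_{j ≥ 1} (-1)^(j-1) (y - 1)^j / j`, truncated after `j = k`. -/
def logTrunc {n : ℕ} (k : ℕ) (y : NCPoly n) : NCPoly n :=
  ∑ j ∈ Finset.range k, ((-1 : ℝ) ^ j / ((j : ℝ) + 1)) • (y - 1) ^ (j + 1)

/-- `log (exp Y_0 ⋯ exp Y_{k-1})`. The truncations do not affect the coefficients of words of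
length at most `k`. -/
def logProdExp (k : ℕ) : NCPoly k :=
  logTrunc k (List.ofFn fun i : Fin k => expTrunc k (gen i)).prod

/-- The Magnus commutator `μ_k(Y_0, …, Y_{k-1})`: the part of `log (exp Y_0 ⋯ exp Y_{k-1})` in
which each of the variables has multiplicity one. -/
def magnus (k : ℕ) : NCPoly k :=
  ∑ σ : Equiv.Perm (Fin k),
    MonoidAlgebra.single (permWord σ) ((logProdExp k).coeff (permWord σ))

/-- `Θ_k^Lie`: `1/k!` times the least sum of absolute values of the coefficients in a
presentation, by Lie monomials with each variable of multiplicity one, of the Lie polynomial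
whose commutator evaluation is `μ_k`. -/
def thetaLie (k : ℕ) : ℝ :=
  (1 / (k.factorial : ℝ)) *
    sInf {c : ℝ | ∃ θ : FreeLieAlgebra ℝ (Fin k) →₀ ℝ,
      (∀ M ∈ θ.support, IsLieMonomial Finset.univ M) ∧
      toAssoc k (θ.sum fun M r => r • M) = magnus k ∧
      c = θ.sum fun _ r => |r|}

/-- `C_∞^Lie`: the convergence radius of the power series `∑_k Θ_k^Lie x^k`. -/
def convRadiusLie : ENNReal := (FormalMultilinearSeries.ofScalars ℝ thetaLie).radius

/-! ### The totally noncommutative mass on `[0,1]` and the kernels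

The degree `n` component of the totally noncommutative Banach algebra over `[0,1]` is
`L¹([0,1]^n)`: the function `f` stands for the element `∫ f(t) Z(t_1) ⋯ Z(t_n)`, with `Z` the
tautological measure of total variation one. -/

/-- The cube `[0,1]^n`. -/
def cube (n : ℕ) : Set (Fin n → ℝ) := Icc 0 1

/-- The number of ascents of a finite sequence of reals. -/
def asc {m : ℕ} (v : Fin (m + 1) → ℝ) : ℕ :=
  (Finset.univ.filter fun i : Fin m => v i.castSucc < v i.succ).card

/-- The number of descents of a finite sequence of reals. -/
def des {m : ℕ} (v : Fin (m + 1) → ℝ) : ℕ :=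
  (Finset.univ.filter fun i : Fin m => v i.succ < v i.castSucc).card

/-- The element `∫ g(s) Q(Z(s_1), …, Z(s_n))`, for multilinear `Q`, as a function of the
variables `t_i = s_{σ(i)}` in `Z(t_1) ⋯ Z(t_n)`. -/
def substitute {n : ℕ} (Q : NCPoly n) (g : (Fin n → ℝ) → ℝ) (t : Fin n → ℝ) : ℝ :=
  ∑ σ : Equiv.Perm (Fin n), Q.coeff (permWord σ) * g fun i => t (σ.symm i)

/-- The associative norm `|f|_{ℓ¹}` of `∫ f(t) Z(t_1) ⋯ Z(t_n)`. -/
def assocNorm {n : ℕ} (f : (Fin n → ℝ) → ℝ) : ℝ := ∫ t in cube n, |f t|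

/-- The Lie norm `‖f‖_{ℓ¹}` of `∫ f(t) Z(t_1) ⋯ Z(t_n)`, extended to the associative algebra:
the infimum of the total mass of the presentations
`∑_j ∫ g_j(s) Q_j(Z(s_1), …, Z(s_n))` with products of commutator monomials `Q_j`. -/
def lieNorm {n : ℕ} (f : (Fin n → ℝ) → ℝ) : ℝ :=
  sInf {c : ℝ | ∃ (N : ℕ) (Q : Fin N → NCPoly n) (g : Fin N → (Fin n → ℝ) → ℝ),
    (∀ j, IsCommProduct Finset.univ (Q j)) ∧
    (∀ j, IntegrableOn (g j) (cube n)) ∧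
    (∀ᵐ t ∂(volume.restrict (cube n)), f t = ∑ j, substitute (Q j) (g j) t) ∧
    c = ∑ j, ∫ s in cube n, |g j s|}

/-- `λ^{asc(t_0,t,t')} (λ-1)^{des(t_0,t,t')}`. -/
def resolventWeight (n : ℕ) (lam t₀ t' : ℝ) (t : Fin n → ℝ) : ℝ :=
  let v : Fin (n + 1 + 1) → ℝ := Fin.cons t₀ (Fin.snoc (α := fun _ => ℝ) t t')
  lam ^ asc v * (lam - 1) ^ des v

/-- The associative kernel `K_n^{(λ)}(t_0, t')`. -/
def kernel₂ (n : ℕ) (lam t₀ t' : ℝ) : ℝ := assocNorm (resolventWeight n lam t₀ t')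

/-- The Lie kernel `K_n^{(λ),Lie}(t_0, t')`. -/
def kernelLie₂ (n : ℕ) (lam t₀ t' : ℝ) : ℝ := lieNorm (resolventWeight n lam t₀ t')

/-- `K_n^{(λ)}(t)` for `t ∈ [-1,1]`: the common value of `K_n^{(λ)}(t_0, t')` for `t' - t_0 = t`. -/
def kernel (n : ℕ) (lam t : ℝ) : ℝ := kernel₂ n lam (max 0 (-t)) (max 0 t)

/-- `K_n^{(λ),Lie}(t)` for `t ∈ [-1,1]`: the common value of `K_n^{(λ),Lie}(t_0, t')` for
`t' - t_0 = t`. -/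
def kernelLie (n : ℕ) (lam t : ℝ) : ℝ := kernelLie₂ n lam (max 0 (-t)) (max 0 t)

open Classical in
/-- `S_n(λ)`: the maximum over `t ∈ [-1,1]` of the ratio of the kernels if `0 < λ < 1`, and `1`
if `λ ∈ {0, 1}`. -/
def ratioS (n : ℕ) (lam : ℝ) : ℝ :=
  if 0 < lam ∧ lam < 1 then
    sSup ((fun t => kernelLie n lam t / kernel n lam t) '' Icc (-1) 1)
  else 1

open Classical in
/-- The weight `w(λ) = (1 - 2λ) / log((1 - λ)/λ)` on `(0,1)`, continuously extended by
`w(1/2) = 1/2`, and `w(0) = w(1) = 0`. -/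
def weight (lam : ℝ) : ℝ :=
  if 0 < lam ∧ lam < 1 then
    if lam = 1 / 2 then 1 / 2 else (1 - 2 * lam) / Real.log ((1 - lam) / lam)
  else 0

/-- `w(λ) S_n(λ)^{1/(n+1)}`. -/
def resolventRate (n : ℕ) (lam : ℝ) : ℝ :=
  weight lam * ratioS n lam ^ (1 / ((n : ℝ) + 1))

end

end MagnusLie

/-!
# Lower bounds for the convergence radius of the Magnus expansion in the Lie norm

**Kernels as averages.** For a sequence `b` of `n` points, the values of a function `f` along the
orbit of `b` under the symmetric group are the coefficients of a multilinear noncommutative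
polynomial. Its least cost as a combination of products of commutator monomials is a norm on a
finite-dimensional space (`symNorm`), and `lieNorm f` is `1/n!` times the average of this norm over
the cube (`lieNorm_eq_lieAvg`). Hence the two kernels are averages of the norms `symNorm` and
`l1Norm` of one vector of weights `λ^asc (λ-1)^des`.

**Dependence on the difference.** If the unit interval, seen as a circle, is rotated, the number of
ascents and the number of descents change only by boundary terms at `t₀` and `t'`. This makes the
kernels functions of `t' - t₀`, and it makes their ratio periodic in `t' - t₀` with period `1`
(`orbitAvg_sub`, `orbitAvg_periodic`). Continuity in `(λ, t)` gives the maxima, and the ratio is less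
than `1` because transposing two neighbouring letters whose weights have opposite signs is cheaper
by a commutator (`symNorm_lt_l1Norm`). The weight tends to `0` at the ends of `[0,1]`, so that the
maximum over `λ` is a maximum over a compact interval.

**The convergence radius.** The coefficients of the Magnus commutator are
`∫ λ^asc (λ-1)^des dλ` over `[0,1]` (`wordCoeff_logProdExp` computes them from the logarithm in the
quotient by words with a repeated letter), and it lies in the span of the Lie monomials
(`magnus_mem_span`: the part of `log g` linear in the last variable is read off from the powers of
`g`). Rewriting words which end with the last letter as right-nested brackets maps products of
commutator monomials to Lie monomials, to their negatives or to zero, and fixes the Lie elements;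
so `Θ_k` is at most `1/k!` times the `symNorm` of the coefficients (`thetaLie_le_of_symNorm_le`).
For each fixed `λ`, a sequence of weights is cut into blocks of `n` letters separated by single
letters (`startNorm_block_le`). This bounds the norm by iterated integrals of the Lie kernel. By
definition of `S_n(λ)`, the Lie kernel is at most `S_n(λ)` times the associative kernel, which is the
kernel of the power `n + 1` of the transfer operator `h ↦ (1-λ) ∫_0^s h + λ ∫_s^1 h`. The exponential with
exponent `c = log((1-λ)/λ)` is an eigenfunction of this operator with eigenvalue `w(λ)`. If `|c|` is
too large for uniform bounds, a flatter exponential function is used, which is still a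
supersolution with a sufficient factor. Thus the norms in degree `k` are `O(k! m^k)`, uniformly in
`λ` (`le_convRadiusLie`).

**The numerical bounds.** By reflection, it suffices to consider `λ ≤ 1/2`, `t₀ = 0` and
`t' = t ∈ [0,1]`. Then the vector of weights depends only on the number `m` of points below `t`, and
the kernels are binomial averages over `m` (`orbitAvg_eq_sum`). Explicit presentations bound the Lie
norms from above, and partial sums of the series of the inverse hyperbolic tangent bound `1/w(λ)`
from below. The result is the positivity of a polynomial in `t` of degree `n`, whose coefficients
are polynomials in `λ`. In `t` it follows from tangent inequalities for `t³` and `t⁴` and from the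
discriminant of the remaining quadratic polynomial. In `λ`, an interval is mapped to the half-line
`y ≥ 0` by a fractional linear map, and the coefficients with respect to `y` are nonnegative. The
check is a computation with lists of integers (`isCertificate`, `orbitAvg_lt_of_isCertificate`).
-/

open MeasureTheory Set

namespace MagnusLie

noncomputable section

attribute [local instance 100] LieRing.ofAssociativeRing

/-! ### Presentations and their cost -/

/-- `Pres S x c`: the vector `x` is a finite linear combination of elements of `S` in which the sum
of the absolute values of the coefficients is at most `c`. -/
inductive Pres {A : Type*} [AddCommGroup A] [Module ℝ A] (S : Set A) : A → ℝ → Prop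
  | zero {c : ℝ} : 0 ≤ c → Pres S 0 c
  | step {x Q : A} {c : ℝ} (r : ℝ) : Pres S x c → Q ∈ S → Pres S (x + r • Q) (c + |r|)

namespace Pres

variable {A B : Type*} [AddCommGroup A] [Module ℝ A] [AddCommGroup B] [Module ℝ B]
  {S T : Set A} {x y : A} {c d : ℝ}

lemma nonneg (h : Pres S x c) : 0 ≤ c := by
  induction h with
  | zero h => exact h
  | step r _ _ ih => positivity

lemma mono (h : Pres S x c) (hcd : c ≤ d) : Pres S x d := by
  induction h generalizing d with
  | zero h => exact zero (h.trans hcd)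
  | step r _ hQ ih =>
    rename_i c _
    have := step r (ih (d := d - |r|) (by linarith)) hQ
    rwa [sub_add_cancel] at this

lemma add (h : Pres S x c) (h' : Pres S y d) : Pres S (x + y) (c + d) := by
  induction h' with
  | zero h0 => simpa using h.mono (by linarith)
  | step r _ hQ ih =>
    rw [← add_assoc, ← add_assoc]
    exact step r ih hQ

lemma smul_mem (r : ℝ) (hx : x ∈ S) : Pres S (r • x) |r| := by
  simpa using step r (zero (S := S) le_rfl) hx

lemma of_mem (hx : x ∈ S) : Pres S x 1 := by
  simpa using smul_mem 1 hx

/-- Linear maps act on presentations; each generator may be replaced by a presentation of its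
image. -/
lemma bind {T : Set B} (f : A →ₗ[ℝ] B) {K : ℝ} (hf : ∀ a ∈ S, Pres T (f a) K)
    (h : Pres S x c) (hK : 0 ≤ K) : Pres T (f x) (K * c) := by
  have hsm : ∀ (r : ℝ) (b : B) (e : ℝ), Pres T b e → Pres T (r • b) (|r| * e) := by
    intro r b e hb
    induction hb with
    | zero h0 => simpa using zero (S := T) (mul_nonneg (abs_nonneg r) h0)
    | step s _ hQ ih =>
      rw [smul_add, mul_add, smul_smul, ← abs_mul]
      exact step _ ih hQ
  induction h with
  | zero h0 => simpa using zero (S := T) (mul_nonneg hK h0)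
  | step r _ hQ ih =>
    rw [map_add, map_smul, mul_add, mul_comm K |r|]
    exact ih.add (hsm r _ _ (hf _ hQ))

lemma smul (r : ℝ) (h : Pres S x c) : Pres S (r • x) (|r| * c) := by
  have := h.bind (T := S) (LinearMap.lsmul ℝ A r) (K := |r|) (fun a ha => by
    simpa using smul_mem r ha) (abs_nonneg r)
  simpa using this

lemma sum {ι : Type*} (s : Finset ι) {f : ι → A} {g : ι → ℝ} (h : ∀ i ∈ s, Pres S (f i) (g i)) :
    Pres S (∑ i ∈ s, f i) (∑ i ∈ s, g i) := by
  classical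
  induction s using Finset.induction_on with
  | empty => simpa using zero (S := S) le_rfl
  | insert a s ha ih =>
    rw [Finset.sum_insert ha, Finset.sum_insert ha]
    exact (h a (Finset.mem_insert_self _ _)).add
      (ih fun i hi => h i (Finset.mem_insert_of_mem hi))

lemma mul {R : Type*} [Ring R] [Algebra ℝ R] {S T U : Set R} {x y : R}
    (hU : ∀ a ∈ S, ∀ b ∈ T, a * b ∈ U) (hx : Pres S x c) (hy : Pres T y d) :
    Pres U (x * y) (c * d) := by
  have h1 : ∀ a ∈ S, Pres U (a * y) d := fun a ha => by
    simpa using hy.bind (T := U) (LinearMap.mulLeft ℝ a) (K := 1)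
      (fun b hb => by simpa using of_mem (hU a ha b hb)) zero_le_one
  simpa [mul_comm] using hx.bind (T := U) (LinearMap.mulRight ℝ y) (K := d)
    (fun a ha => by simpa using h1 a ha) hy.nonneg

/-- A presentation, written out as a finite sum. -/
lemma exists_sum (h : Pres S x c) : ∃ (N : ℕ) (Q : Fin N → A) (r : Fin N → ℝ),
    (∀ j, Q j ∈ S) ∧ x = ∑ j, r j • Q j ∧ ∑ j, |r j| ≤ c := by
  induction h with
  | zero h0 => exact ⟨0, Fin.elim0, Fin.elim0, fun j => j.elim0, by simp, by simpa using h0⟩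
  | step r _ hQ ih =>
    rename_i Q' _ _
    obtain ⟨N, Q, s, h1, h2, h3⟩ := ih
    refine ⟨N + 1, Fin.snoc Q Q', Fin.snoc s r, fun j => ?_, ?_, ?_⟩
    · refine Fin.lastCases ?_ (fun i => ?_) j
      · simpa using hQ
      · simpa using h1 i
    · simp [Fin.sum_univ_castSucc, h2]
    · simpa [Fin.sum_univ_castSucc] using h3

end Pres

/-! ### Words and commutator products -/

/-- The noncommutative monomial whose letters are listed in `l`. -/
def wordOf {n : ℕ} (l : List (Fin n)) : NCPoly n := MonoidAlgebra.single (FreeMonoid.ofList l) 1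

lemma wordOf_nil {n : ℕ} : wordOf ([] : List (Fin n)) = 1 := rfl

lemma wordOf_append {n : ℕ} (l l' : List (Fin n)) :
    wordOf (l ++ l') = wordOf l * wordOf l' := by
  simp [wordOf, FreeMonoid.ofList_append]

lemma wordOf_singleton {n : ℕ} (i : Fin n) : wordOf [i] = gen i := rfl

lemma wordOf_cons {n : ℕ} (i : Fin n) (l : List (Fin n)) :
    wordOf (i :: l) = gen i * wordOf l := by
  rw [← wordOf_singleton, ← wordOf_append]; rfl

lemma coeff_wordOf {n : ℕ} (l l' : List (Fin n)) :
    (wordOf l).coeff (FreeMonoid.ofList l') = if l = l' then 1 else 0 := by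
  classical
  rw [wordOf, MonoidAlgebra.coeff_single, Finsupp.single_apply]
  exact if_congr (FreeMonoid.ofList.injective.eq_iff) rfl rfl

/-- The words in which each of the letters in `s` occurs exactly once, and no other letter. -/
def multWords {n : ℕ} (s : Finset (Fin n)) : Set (NCPoly n) :=
  {x | ∃ l : List (Fin n), l.Nodup ∧ l.toFinset = s ∧ x = wordOf l}

/-- The products of commutator monomials in which each of the letters in `s` occurs exactly
once. -/
def commProducts {n : ℕ} (s : Finset (Fin n)) : Set (NCPoly n) := {Q | IsCommProduct s Q}

lemma multWords_mul {n : ℕ} {s t : Finset (Fin n)} (hst : Disjoint s t) :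
    ∀ a ∈ multWords s, ∀ b ∈ multWords t, a * b ∈ multWords (s ∪ t) := by
  rintro _ ⟨l, hl, hls, rfl⟩ _ ⟨l', hl', hls', rfl⟩
  refine ⟨l ++ l', ?_, by simp [hls, hls'], (wordOf_append _ _).symm⟩
  refine List.nodup_append.2 ⟨hl, hl', fun a ha b hb hab => ?_⟩
  subst hab
  exact Finset.disjoint_left.1 hst (hls ▸ List.mem_toFinset.2 ha) (hls' ▸ List.mem_toFinset.2 hb)

lemma IsLieMonomial.pres_multWords {n : ℕ} {s : Finset (Fin n)} {M : FreeLieAlgebra ℝ (Fin n)}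
    (h : IsLieMonomial s M) : Pres (multWords s) (toAssoc n M) (2 ^ s.card / 2) := by
  induction h with
  | of i =>
    rw [toAssoc_of]
    have hi : gen i ∈ multWords {i} := ⟨[i], by simp, by simp, rfl⟩
    exact (Pres.of_mem hi).mono (by simp)
  | bracket _ _ hst ih1 ih2 =>
    rw [toAssoc_bracket, Finset.card_union_of_disjoint hst, sub_eq_add_neg]
    have e1 := ih1.mul (multWords_mul hst) ih2
    have e2 := (ih2.mul (multWords_mul hst.symm) ih1).smul (-1)
    rw [Finset.union_comm] at e2
    simp only [neg_smul, one_smul, abs_neg, abs_one, one_mul] at e2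
    refine (e1.add e2).mono (le_of_eq ?_)
    rw [pow_add]; ring

lemma IsCommProduct.pres_multWords {n : ℕ} {s : Finset (Fin n)} {Q : NCPoly n}
    (h : IsCommProduct s Q) : Pres (multWords s) Q (2 ^ s.card) := by
  induction h with
  | one =>
    have h1 : (1 : NCPoly n) ∈ multWords ∅ := ⟨[], by simp, by simp, wordOf_nil.symm⟩
    exact (Pres.of_mem h1).mono (by simp)
  | mul hM _ hst ih =>
    rw [Finset.card_union_of_disjoint hst, pow_add]
    refine (hM.pres_multWords.mul (multWords_mul hst) ih).mono ?_
    gcongr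
    exact half_le_self (by positivity)

lemma IsCommProduct.of_isLieMonomial {n : ℕ} {s : Finset (Fin n)} {M : FreeLieAlgebra ℝ (Fin n)}
    (h : IsLieMonomial s M) : IsCommProduct s (toAssoc n M) := by
  simpa using IsCommProduct.mul h .one (Finset.disjoint_empty_right _)

lemma IsCommProduct.mul' {n : ℕ} {s t : Finset (Fin n)} {Q R : NCPoly n}
    (hQ : IsCommProduct s Q) (hR : IsCommProduct t R) (hst : Disjoint s t) :
    IsCommProduct (s ∪ t) (Q * R) := by
  induction hQ with
  | one => simpa using hR
  | mul hM _ hd ih =>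
    rw [Finset.disjoint_union_left] at hst
    rw [Finset.union_assoc, mul_assoc]
    exact .mul hM (ih hst.2) (Finset.disjoint_union_right.2 ⟨hd, hst.1⟩)

lemma IsCommProduct.of_nodup {n : ℕ} : ∀ {l : List (Fin n)}, l.Nodup →
    IsCommProduct l.toFinset (wordOf l)
  | [], _ => by simpa [wordOf_nil] using IsCommProduct.one
  | i :: l, h => by
    rw [wordOf_cons, List.toFinset_cons, Finset.insert_eq, ← toAssoc_of]
    rw [List.nodup_cons] at h
    exact .mul (.of i) (of_nodup h.2) (by simpa using h.1)

lemma commProducts_mul {n : ℕ} {s t : Finset (Fin n)} (hst : Disjoint s t) :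
    ∀ a ∈ commProducts s, ∀ b ∈ commProducts t, a * b ∈ commProducts (s ∪ t) :=
  fun _ ha _ hb => IsCommProduct.mul' ha hb hst

/-- The substitution of the variables `Y_i ↦ Y_{e i}`. -/
def relabel {m n : ℕ} (e : Fin m → Fin n) : NCPoly m →ₐ[ℝ] NCPoly n :=
  MonoidAlgebra.mapDomainAlgHom ℝ ℝ (FreeMonoid.map e)

lemma relabel_wordOf {m n : ℕ} (e : Fin m → Fin n) (l : List (Fin m)) :
    relabel e (wordOf l) = wordOf (l.map e) := by
  simp [relabel, wordOf, FreeMonoid.ofList_map]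

lemma relabel_gen {m n : ℕ} (e : Fin m → Fin n) (i : Fin m) :
    relabel e (gen i) = gen (e i) := by
  rw [← wordOf_singleton, relabel_wordOf]; rfl

lemma IsLieMonomial.relabel {m n : ℕ} {e : Fin m → Fin n} (he : Function.Injective e)
    {s : Finset (Fin m)} {M : FreeLieAlgebra ℝ (Fin m)} (h : IsLieMonomial s M) :
    ∃ M', IsLieMonomial (s.image e) M' ∧ toAssoc n M' = MagnusLie.relabel e (toAssoc m M) := by
  classical
  induction h with
  | of i => exact ⟨_, .of (e i), by rw [toAssoc_of, toAssoc_of, relabel_gen]⟩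
  | bracket _ _ hst ih1 ih2 =>
    obtain ⟨M1, h1, e1⟩ := ih1
    obtain ⟨M2, h2, e2⟩ := ih2
    refine ⟨⁅M1, M2⁆, ?_, ?_⟩
    · rw [Finset.image_union]
      exact .bracket h1 h2 ((Finset.disjoint_image he).2 hst)
    · rw [toAssoc_bracket, toAssoc_bracket, e1, e2, map_sub, map_mul, map_mul]

lemma IsCommProduct.relabel {m n : ℕ} {e : Fin m → Fin n} (he : Function.Injective e)
    {s : Finset (Fin m)} {Q : NCPoly m} (h : IsCommProduct s Q) :
    IsCommProduct (s.image e) (MagnusLie.relabel e Q) := by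
  classical
  induction h with
  | one => simpa using IsCommProduct.one
  | mul hM _ hst ih =>
    obtain ⟨M', h', e'⟩ := hM.relabel he
    rw [map_mul, ← e', Finset.image_union]
    exact .mul h' ih ((Finset.disjoint_image he).2 hst)

lemma Pres.relabel {m n : ℕ} {e : Fin m → Fin n} (he : Function.Injective e)
    {s : Finset (Fin m)} {x : NCPoly m} {c : ℝ} (h : Pres (commProducts s) x c) :
    Pres (commProducts (s.image e)) (MagnusLie.relabel e x) c := by
  simpa using h.bind (T := commProducts (s.image e)) (MagnusLie.relabel e).toLinearMap (K := 1)
    (fun a ha => Pres.of_mem (IsCommProduct.relabel he ha)) zero_le_one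

/-! ### The Lie norm of multilinear noncommutative polynomials -/

/-- The word `Y_{σ(0)} ⋯ Y_{σ(n-1)}`. -/
def permPoly {n : ℕ} (σ : Equiv.Perm (Fin n)) : NCPoly n := wordOf (List.ofFn σ)

lemma single_permWord {n : ℕ} (σ : Equiv.Perm (Fin n)) (r : ℝ) :
    MonoidAlgebra.single (permWord σ) r = r • permPoly σ := by
  simp [permPoly, wordOf, permWord]

lemma coeff_permPoly {n : ℕ} (σ τ : Equiv.Perm (Fin n)) :
    (permPoly σ).coeff (permWord τ) = if σ = τ then 1 else 0 := by
  rw [permPoly, permWord, coeff_wordOf]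
  exact if_congr (List.ofFn_injective.eq_iff.trans DFunLike.coe_fn_eq) rfl rfl

lemma ofFn_perm_nodup {n : ℕ} (σ : Equiv.Perm (Fin n)) : (List.ofFn σ).Nodup :=
  List.nodup_ofFn.2 σ.injective

lemma ofFn_perm_toFinset {n : ℕ} (σ : Equiv.Perm (Fin n)) :
    (List.ofFn σ).toFinset = Finset.univ := by
  ext i
  simpa [List.mem_ofFn] using ⟨σ.symm i, by simp⟩

lemma permPoly_mem {n : ℕ} (σ : Equiv.Perm (Fin n)) : permPoly σ ∈ commProducts Finset.univ := by
  have := IsCommProduct.of_nodup (ofFn_perm_nodup σ)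
  rwa [ofFn_perm_toFinset] at this

lemma exists_perm_of_nodup {n : ℕ} {l : List (Fin n)} (h : l.Nodup)
    (hl : l.toFinset = Finset.univ) : ∃ σ : Equiv.Perm (Fin n), l = List.ofFn σ := by
  have hlen : l.length = n := by
    rw [← List.toFinset_card_of_nodup h, hl]; simp
  obtain ⟨f, rfl⟩ : ∃ f : Fin n → Fin n, l = List.ofFn f := by
    exact ⟨fun i => l.get (i.cast hlen.symm), List.ext_get (by simpa) (by simp)⟩
  have hf : Function.Injective f := List.nodup_ofFn.1 h
  exact ⟨Equiv.ofBijective f (Finite.injective_iff_bijective.1 hf), rfl⟩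

/-- The multilinear polynomial `∑_σ c_σ Y_{σ(0)} ⋯ Y_{σ(n-1)}`. -/
def symPoly {n : ℕ} (c : Equiv.Perm (Fin n) → ℝ) : NCPoly n := ∑ σ, c σ • permPoly σ

lemma coeff_symPoly {n : ℕ} (c : Equiv.Perm (Fin n) → ℝ) (σ : Equiv.Perm (Fin n)) :
    (symPoly c).coeff (permWord σ) = c σ := by
  simp [symPoly, Finsupp.finsetSum_apply, coeff_permPoly]

lemma Pres.eq_symPoly {n : ℕ} {x : NCPoly n} {c : ℝ} (h : Pres (multWords Finset.univ) x c) :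
    x = symPoly (fun σ => x.coeff (permWord σ)) ∧ ∑ σ, |x.coeff (permWord σ)| ≤ c := by
  induction h with
  | zero h0 => exact ⟨by simp [symPoly], by simpa using h0⟩
  | step r _ hQ ih =>
    rename_i x Q c _
    obtain ⟨l, h1, h2, rfl⟩ := hQ
    obtain ⟨τ, rfl⟩ := exists_perm_of_nodup h1 h2
    change _ ∧ _ at ih
    have hc : ∀ σ, (x + r • wordOf (List.ofFn τ)).coeff (permWord σ)
        = x.coeff (permWord σ) + if τ = σ then r else 0 := by
      intro σ
      have := coeff_permPoly τ σ
      rw [permPoly] at this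
      simp [this]
    simp only [hc]
    constructor
    · conv_lhs => rw [ih.1]
      simp [symPoly, add_smul, Finset.sum_add_distrib, ite_smul, permPoly]
    · calc _ ≤ ∑ σ, (|x.coeff (permWord σ)| + |if τ = σ then r else 0|) :=
            Finset.sum_le_sum fun σ _ => abs_add_le _ _
        _ ≤ _ := by
            rw [Finset.sum_add_distrib]
            simp only [apply_ite abs, abs_zero, Finset.sum_ite_eq, Finset.mem_univ, if_true]
            linarith [ih.2]

lemma IsCommProduct.eq_symPoly {n : ℕ} {Q : NCPoly n} (h : IsCommProduct Finset.univ Q) :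
    Q = symPoly (fun σ => Q.coeff (permWord σ)) :=
  h.pres_multWords.eq_symPoly.1

lemma Pres.multWords_of_commProducts {n : ℕ} {x : NCPoly n} {c : ℝ} {s : Finset (Fin n)}
    (h : Pres (commProducts s) x c) : Pres (multWords s) x (2 ^ s.card * c) :=
  h.bind (T := multWords s) LinearMap.id (K := 2 ^ s.card)
    (fun _ ha => IsCommProduct.pres_multWords ha) (by positivity)

/-- The Lie norm of a multilinear noncommutative polynomial, given by its coefficients: the
infimum of the costs of its presentations by products of commutator monomials. -/
def symNorm {n : ℕ} (c : Equiv.Perm (Fin n) → ℝ) : ℝ :=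
  sInf {C : ℝ | Pres (commProducts Finset.univ) (symPoly c) C}

variable {n : ℕ}

lemma symPoly_add (c d : Equiv.Perm (Fin n) → ℝ) :
    symPoly (c + d) = symPoly c + symPoly d := by
  simp [symPoly, add_smul, Finset.sum_add_distrib]

lemma symPoly_smul (r : ℝ) (c : Equiv.Perm (Fin n) → ℝ) :
    symPoly (r • c) = r • symPoly c := by
  simp [symPoly, Finset.smul_sum, smul_smul]

lemma pres_l1 (c : Equiv.Perm (Fin n) → ℝ) :
    Pres (commProducts Finset.univ) (symPoly c) (∑ σ, |c σ|) :=
  Pres.sum _ fun σ _ => Pres.smul_mem _ (permPoly_mem σ)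

lemma symNorm_bddBelow (c : Equiv.Perm (Fin n) → ℝ) :
    BddBelow {C : ℝ | Pres (commProducts Finset.univ) (symPoly c) C} :=
  ⟨0, fun _ h => h.nonneg⟩

lemma symNorm_nonneg (c : Equiv.Perm (Fin n) → ℝ) : 0 ≤ symNorm c :=
  Real.sInf_nonneg fun _ h => h.nonneg

lemma symNorm_le {c : Equiv.Perm (Fin n) → ℝ} {C : ℝ}
    (h : Pres (commProducts Finset.univ) (symPoly c) C) : symNorm c ≤ C :=
  csInf_le (symNorm_bddBelow c) h

lemma pres_of_symNorm_lt {c : Equiv.Perm (Fin n) → ℝ} {C : ℝ} (h : symNorm c < C) :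
    Pres (commProducts Finset.univ) (symPoly c) C := by
  obtain ⟨C', h1, h2⟩ := exists_lt_of_csInf_lt ⟨_, pres_l1 c⟩ h
  exact Pres.mono h1 h2.le

lemma symNorm_le_l1 (c : Equiv.Perm (Fin n) → ℝ) : symNorm c ≤ ∑ σ, |c σ| :=
  symNorm_le (pres_l1 c)

lemma l1_le_symNorm (c : Equiv.Perm (Fin n) → ℝ) : ∑ σ, |c σ| ≤ 2 ^ n * symNorm c := by
  have h2 : (0 : ℝ) < 2 ^ n := by positivity
  rw [← div_le_iff₀' h2]
  refine le_csInf ⟨_, pres_l1 c⟩ fun C hC => ?_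
  rw [div_le_iff₀' h2]
  simpa [coeff_symPoly] using (Pres.multWords_of_commProducts hC).eq_symPoly.2

lemma symNorm_add_le (c d : Equiv.Perm (Fin n) → ℝ) :
    symNorm (c + d) ≤ symNorm c + symNorm d := by
  refine le_of_forall_pos_le_add fun ε hε => ?_
  have h1 := pres_of_symNorm_lt (c := c) (C := symNorm c + ε / 2) (by linarith)
  have h2 := pres_of_symNorm_lt (c := d) (C := symNorm d + ε / 2) (by linarith)
  have := symNorm_le (c := c + d) (by rw [symPoly_add]; exact h1.add h2)
  linarith

lemma symNorm_smul_le (r : ℝ) (c : Equiv.Perm (Fin n) → ℝ) :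
    symNorm (r • c) ≤ |r| * symNorm c := by
  refine le_of_forall_pos_le_add fun ε hε => ?_
  have hr : 0 < |r| + 1 := by positivity
  have h1 := pres_of_symNorm_lt (c := c) (C := symNorm c + ε / (|r| + 1))
    (by linarith [div_pos hε hr])
  have h2 := symNorm_le (c := r • c) (by rw [symPoly_smul]; exact h1.smul r)
  have h3 : |r| * (ε / (|r| + 1)) ≤ ε := by
    rw [mul_div_assoc', div_le_iff₀ hr]; nlinarith [abs_nonneg r]
  linarith

lemma abs_symNorm_sub_le (c d : Equiv.Perm (Fin n) → ℝ) :
    |symNorm c - symNorm d| ≤ ∑ σ, |c σ - d σ| := by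
  have h : ∀ c d : Equiv.Perm (Fin n) → ℝ, symNorm c - symNorm d ≤ ∑ σ, |c σ - d σ| := by
    intro c d
    have h1 := symNorm_add_le d (c - d)
    rw [add_sub_cancel] at h1
    have h2 := symNorm_le_l1 (c - d)
    simp only [Pi.sub_apply] at h2
    linarith
  refine abs_sub_le_iff.2 ⟨h c d, ?_⟩
  simpa [abs_sub_comm] using h d c

lemma continuous_symNorm : Continuous (symNorm (n := n)) := by
  rw [continuous_iff_continuousAt]
  intro c
  rw [ContinuousAt, tendsto_iff_dist_tendsto_zero]
  have : Filter.Tendsto (fun d : Equiv.Perm (Fin n) → ℝ => ∑ σ, |d σ - c σ|) (nhds c) (nhds 0) := by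
    have hc : Continuous fun d : Equiv.Perm (Fin n) → ℝ => ∑ σ, |d σ - c σ| := by fun_prop
    simpa using hc.tendsto c
  exact squeeze_zero (fun _ => dist_nonneg) (fun d => by
    rw [Real.dist_eq]; exact abs_symNorm_sub_le d c) this

lemma relabel_permPoly (τ σ : Equiv.Perm (Fin n)) :
    relabel τ (permPoly σ) = permPoly (τ * σ) := by
  rw [permPoly, relabel_wordOf, List.map_ofFn]; rfl

lemma relabel_symPoly (τ : Equiv.Perm (Fin n)) (c : Equiv.Perm (Fin n) → ℝ) :
    relabel τ (symPoly c) = symPoly fun σ => c (τ⁻¹ * σ) := by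
  rw [symPoly, map_sum, symPoly,
    ← Equiv.sum_comp (Equiv.mulLeft τ) fun σ => c (τ⁻¹ * σ) • permPoly σ]
  simp [map_smul, relabel_permPoly]

/-- The Lie norm is invariant under permutations of the variables. -/
lemma symNorm_comp_mul_left (τ : Equiv.Perm (Fin n)) (c : Equiv.Perm (Fin n) → ℝ) :
    symNorm (fun σ => c (τ * σ)) = symNorm c := by
  have h : ∀ (τ : Equiv.Perm (Fin n)) (c : Equiv.Perm (Fin n) → ℝ),
      symNorm (fun σ => c (τ * σ)) ≤ symNorm c := by
    intro τ c
    refine le_csInf ⟨_, pres_l1 c⟩ fun C hC => symNorm_le ?_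
    have := Pres.relabel (e := (τ⁻¹ : Equiv.Perm (Fin n))) (τ⁻¹).injective hC
    rw [relabel_symPoly, inv_inv] at this
    rwa [Finset.image_univ_of_surjective (τ⁻¹).surjective] at this
  refine le_antisymm (h τ c) ?_
  simpa using h τ⁻¹ fun σ => c (τ * σ)

/-! ### The Lie norm of noncommutative integrals as an average -/

/-- The uniform probability measure on the cube `[0,1]^n`. -/
def cubeMeasure (n : ℕ) : Measure (Fin n → ℝ) :=
  Measure.pi fun _ => volume.restrict (Icc (0 : ℝ) 1)

instance isProbabilityMeasure_Icc : IsProbabilityMeasure (volume.restrict (Icc (0 : ℝ) 1)) :=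
  ⟨by simp⟩

instance isProbabilityMeasure_cubeMeasure (n : ℕ) : IsProbabilityMeasure (cubeMeasure n) := by
  unfold cubeMeasure; infer_instance

lemma restrict_cube (n : ℕ) : volume.restrict (cube n) = cubeMeasure n := by
  rw [cube, ← Set.pi_univ_Icc, volume_pi, Measure.restrict_pi_pi]
  rfl

/-- The values of `f` at the points obtained from `b` by permuting the coordinates. -/
def orbit {n : ℕ} (f : (Fin n → ℝ) → ℝ) (b : Fin n → ℝ) (π : Equiv.Perm (Fin n)) : ℝ :=
  f fun i => b (π i)

lemma measurePreserving_perm {n : ℕ} (π : Equiv.Perm (Fin n)) :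
    MeasurePreserving (fun (b : Fin n → ℝ) i => b (π i)) (cubeMeasure n) (cubeMeasure n) := by
  have := measurePreserving_piCongrLeft (fun _ : Fin n => volume.restrict (Icc (0 : ℝ) 1)) π.symm
  have h : (fun (b : Fin n → ℝ) i => b (π i)) =
      MeasurableEquiv.piCongrLeft (fun _ => ℝ) π.symm := by
    ext b i
    simp [MeasurableEquiv.piCongrLeft, Equiv.piCongrLeft, Equiv.piCongrLeft']
  rw [h]
  exact this

lemma integrable_of_range_finite {α : Type*} [MeasurableSpace α] {μ : Measure α}
    [IsFiniteMeasure μ] {f : α → ℝ} (hf : Measurable f) (hfin : (range f).Finite) :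
    Integrable f μ := by
  obtain ⟨C, hC⟩ := hfin.isBounded.exists_norm_le
  exact Integrable.of_bound hf.aestronglyMeasurable C (ae_of_all _ fun x => hC _ ⟨x, rfl⟩)

lemma measurable_orbit {n : ℕ} {f : (Fin n → ℝ) → ℝ} (hf : Measurable f) :
    Measurable (orbit f) := by
  refine measurable_pi_lambda _ fun π => hf.comp ?_
  exact measurable_pi_lambda _ fun i => measurable_pi_apply _

lemma measurable_symNorm_orbit {n : ℕ} {f : (Fin n → ℝ) → ℝ} (hf : Measurable f) :
    Measurable fun b => symNorm (orbit f b) :=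
  continuous_symNorm.measurable.comp (measurable_orbit hf)

lemma range_orbit_finite {n : ℕ} {f : (Fin n → ℝ) → ℝ} (hfin : (range f).Finite) :
    (range (orbit f)).Finite := by
  refine (Set.Finite.pi' fun _ : Equiv.Perm (Fin n) => hfin).subset ?_
  rintro _ ⟨b, rfl⟩ π
  exact ⟨_, rfl⟩

lemma integrable_symNorm_orbit {n : ℕ} {f : (Fin n → ℝ) → ℝ} (hf : Measurable f)
    (hfin : (range f).Finite) : Integrable (fun b => symNorm (orbit f b)) (cubeMeasure n) := by
  refine integrable_of_range_finite (measurable_symNorm_orbit hf) ?_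
  have : range (fun b => symNorm (orbit f b)) = symNorm '' range (orbit f) := by
    rw [← range_comp]; rfl
  rw [this]
  exact (range_orbit_finite hfin).image _

/-- The average of the Lie norms of the multilinear polynomials `∑_π f(b ∘ π) Y_π`, divided by
`n!`. -/
def lieAvg {n : ℕ} (f : (Fin n → ℝ) → ℝ) : ℝ :=
  (1 / (n.factorial : ℝ)) * ∫ b, symNorm (orbit f b) ∂cubeMeasure n

lemma substitute_comp_perm {n : ℕ} (Q : NCPoly n) (g : (Fin n → ℝ) → ℝ) (b : Fin n → ℝ)
    (π : Equiv.Perm (Fin n)) :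
    substitute Q g (fun i => b (π i)) =
      ∑ ρ : Equiv.Perm (Fin n), Q.coeff (permWord (ρ⁻¹ * π)) * g fun i => b (ρ i) := by
  rw [substitute, ← Equiv.sum_comp (Equiv.inv (Equiv.Perm (Fin n))),
    ← Equiv.sum_comp (Equiv.mulLeft π⁻¹)]
  refine Finset.sum_congr rfl fun ρ _ => ?_
  simp only [Equiv.coe_mulLeft, Equiv.inv_apply, mul_inv_rev, inv_inv]
  congr 2
  ext i
  rw [← Equiv.Perm.inv_def, mul_inv_rev, inv_inv]
  simp [Equiv.Perm.mul_apply]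

lemma symPoly_orbit_of_presentation {n : ℕ} {ι : Type*} [Fintype ι] {f : (Fin n → ℝ) → ℝ}
    {Q : ι → NCPoly n} {g : ι → (Fin n → ℝ) → ℝ} (hQ : ∀ j, IsCommProduct Finset.univ (Q j))
    {b : Fin n → ℝ} (h : ∀ π : Equiv.Perm (Fin n),
      f (fun i => b (π i)) = ∑ j, substitute (Q j) (g j) fun i => b (π i)) :
    symPoly (orbit f b) =
      ∑ j, ∑ ρ : Equiv.Perm (Fin n), (g j fun i => b (ρ i)) • relabel ρ (Q j) := by
  have hr : ∀ j (ρ : Equiv.Perm (Fin n)), relabel ρ (Q j) =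
      symPoly fun σ => (Q j).coeff (permWord (ρ⁻¹ * σ)) := by
    intro j ρ
    conv_lhs => rw [(hQ j).eq_symPoly]
    exact relabel_symPoly ρ _
  simp only [hr, ← symPoly_smul]
  simp only [symPoly, orbit, h, substitute_comp_perm, Finset.sum_smul, Pi.smul_apply, smul_eq_mul]
  rw [Finset.sum_comm]
  refine Finset.sum_congr rfl fun j _ => ?_
  rw [Finset.sum_comm]
  refine Finset.sum_congr rfl fun ρ _ => Finset.sum_congr rfl fun π _ => ?_
  rw [mul_comm]

lemma lieNorm_bddBelow {n : ℕ} (f : (Fin n → ℝ) → ℝ) :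
    BddBelow {c : ℝ | ∃ (N : ℕ) (Q : Fin N → NCPoly n) (g : Fin N → (Fin n → ℝ) → ℝ),
    (∀ j, IsCommProduct Finset.univ (Q j)) ∧
    (∀ j, IntegrableOn (g j) (cube n)) ∧
    (∀ᵐ t ∂(volume.restrict (cube n)), f t = ∑ j, substitute (Q j) (g j) t) ∧
    c = ∑ j, ∫ s in cube n, |g j s|} := by
  refine ⟨0, ?_⟩
  rintro _ ⟨N, Q, g, -, -, -, rfl⟩
  exact Finset.sum_nonneg fun j _ => integral_nonneg fun _ => abs_nonneg _

lemma lieNorm_le {n : ℕ} {ι : Type*} [Fintype ι] {f : (Fin n → ℝ) → ℝ}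
    (Q : ι → NCPoly n) (g : ι → (Fin n → ℝ) → ℝ) (hQ : ∀ j, IsCommProduct Finset.univ (Q j))
    (hg : ∀ j, Integrable (g j) (cubeMeasure n))
    (h : ∀ᵐ t ∂(cubeMeasure n), f t = ∑ j, substitute (Q j) (g j) t) :
    lieNorm f ≤ ∑ j, ∫ s, |g j s| ∂cubeMeasure n := by
  let e := Fintype.equivFin ι
  refine csInf_le (lieNorm_bddBelow f) ⟨Fintype.card ι, fun j => Q (e.symm j),
    fun j => g (e.symm j), fun j => hQ _, fun j => ?_, ?_, ?_⟩
  · rw [IntegrableOn, restrict_cube]; exact hg _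
  · rw [restrict_cube]
    filter_upwards [h] with t ht
    rw [ht, ← e.symm.sum_comp]
  · rw [restrict_cube, ← e.symm.sum_comp]

lemma substitute_one {n : ℕ} (f : (Fin n → ℝ) → ℝ) (t : Fin n → ℝ) :
    substitute (permPoly 1) f t = f t := by
  simp only [substitute, coeff_permPoly]
  simp [Finset.sum_ite_eq, ← Equiv.Perm.inv_def]

lemma integral_comp_perm {n : ℕ} (π : Equiv.Perm (Fin n)) {g : (Fin n → ℝ) → ℝ}
    (hg : AEStronglyMeasurable g (cubeMeasure n)) :
    ∫ b, g (fun i => b (π i)) ∂cubeMeasure n = ∫ b, g b ∂cubeMeasure n := by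
  have h := measurePreserving_perm π
  rw [← h.map_eq] at hg
  have := integral_map h.measurable.aemeasurable hg
  rw [h.map_eq] at this
  exact this.symm

lemma lieAvg_le_lieNorm {n : ℕ} {f : (Fin n → ℝ) → ℝ} (hf : Measurable f)
    (hfin : (range f).Finite) : lieAvg f ≤ lieNorm f := by
  refine le_csInf ?_ ?_
  · refine ⟨_, 1, fun _ => permPoly 1, fun _ => f, fun _ => permPoly_mem 1, fun _ => ?_, ?_, rfl⟩
    · rw [IntegrableOn, restrict_cube]; exact integrable_of_range_finite hf hfin
    · exact ae_of_all _ fun t => by simp [substitute_one]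
  · rintro _ ⟨N, Q, g, hQ, hg, h, rfl⟩
    simp only [IntegrableOn, restrict_cube] at hg h ⊢
    have hall : ∀ᵐ b ∂cubeMeasure n, ∀ π : Equiv.Perm (Fin n),
        f (fun i => b (π i)) = ∑ j, substitute (Q j) (g j) fun i => b (π i) :=
      ae_all_iff.2 fun π => (measurePreserving_perm π).quasiMeasurePreserving.ae h
    have hint : ∀ j (ρ : Equiv.Perm (Fin n)),
        Integrable (fun b : Fin n → ℝ => |g j fun i => b (ρ i)|) (cubeMeasure n) := fun j ρ =>
      ((measurePreserving_perm ρ).integrable_comp_of_integrable (hg j)).abs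
    have hle : ∫ b, symNorm (orbit f b) ∂cubeMeasure n ≤
        ∫ b, ∑ j, ∑ ρ : Equiv.Perm (Fin n), |g j fun i => b (ρ i)| ∂cubeMeasure n := by
      refine integral_mono_ae (integrable_symNorm_orbit hf hfin)
        (integrable_finsetSum _ fun j _ => integrable_finsetSum _ fun ρ _ => hint j ρ) ?_
      filter_upwards [hall] with b hb
      refine symNorm_le ?_
      rw [symPoly_orbit_of_presentation hQ hb]
      refine Pres.sum _ fun j _ => Pres.sum _ fun ρ _ => Pres.smul_mem _ ?_
      have := (hQ j).relabel ρ.injective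
      rwa [Finset.image_univ_of_surjective ρ.surjective] at this
    rw [integral_finsetSum _ fun j _ => integrable_finsetSum _ fun ρ _ => hint j ρ] at hle
    have hfac : (0 : ℝ) < n.factorial := by positivity
    rw [lieAvg, one_div, inv_mul_le_iff₀ hfac, Finset.mul_sum]
    refine hle.trans (le_of_eq (Finset.sum_congr rfl fun j _ => ?_))
    rw [integral_finsetSum _ fun ρ _ => hint j ρ]
    rw [Finset.sum_congr rfl fun ρ _ =>
      integral_comp_perm ρ (g := fun b => |g j b|) (hg j).abs.aestronglyMeasurable]
    simp [Fintype.card_perm]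

lemma lieNorm_le_lieAvg {n : ℕ} {f : (Fin n → ℝ) → ℝ} (hf : Measurable f)
    (hfin : (range f).Finite) : lieNorm f ≤ lieAvg f := by
  classical
  refine le_of_forall_pos_le_add fun ε hε => ?_
  have hV := range_orbit_finite hfin
  -- a nearly optimal presentation for each of the finitely many values of the orbit
  choose N Q r hQ hsum hcost using fun v : Equiv.Perm (Fin n) → ℝ =>
    (pres_of_symNorm_lt (c := v) (C := symNorm v + ε) (by linarith)).exists_sum
  have hfac : (0 : ℝ) < n.factorial := by positivity
  set V : Finset (Equiv.Perm (Fin n) → ℝ) := hV.toFinset with hVdef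
  have hmem : ∀ b, orbit f b ∈ V := fun b => by simp [hVdef]
  have hind : ∀ (v : Equiv.Perm (Fin n) → ℝ) (x : ℝ),
      Measurable fun b => if orbit f b = v then x else 0 := fun v x =>
    Measurable.ite ((measurable_orbit hf) (measurableSet_singleton v)) measurable_const
      measurable_const
  have hindfin : ∀ (v : Equiv.Perm (Fin n) → ℝ) (x : ℝ),
      (range fun b => if orbit f b = v then x else 0).Finite := fun v x =>
    (Set.toFinite {x, 0}).subset (by rintro _ ⟨b, rfl⟩; dsimp only; split_ifs <;> simp)
  let ι := Σ v : V, Fin (N v)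
  let g : ι → (Fin n → ℝ) → ℝ := fun j b =>
    if orbit f b = j.1 then r j.1 j.2 / n.factorial else 0
  have hgint : ∀ j, Integrable (g j) (cubeMeasure n) := fun j =>
    integrable_of_range_finite (hind _ _) (hindfin _ _)
  have key := lieNorm_le (f := f) (fun j : ι => Q j.1 j.2) g (fun j => hQ _ _) hgint ?_
  · refine key.trans ?_
    have h1 : ∀ b, ∑ j, |g j b| ≤ (symNorm (orbit f b) + ε) / n.factorial := by
      intro b
      have : ∑ j, |g j b| = ∑ v : V, if orbit f b = v then
          ∑ i, |r v i| / n.factorial else 0 := by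
        rw [Fintype.sum_sigma]
        refine Finset.sum_congr rfl fun v _ => ?_
        simp only [g]
        split_ifs
        · exact Finset.sum_congr rfl fun i _ => by
            rw [abs_div, abs_of_pos hfac]
        · simp
      rw [this, Finset.sum_eq_single ⟨orbit f b, hmem b⟩]
      · rw [if_pos rfl, ← Finset.sum_div]
        exact div_le_div_of_nonneg_right (hcost _) hfac.le
      · intro v _ hv
        rw [if_neg fun h => hv (Subtype.ext h.symm)]
      · simp
    rw [← integral_finsetSum _ fun j _ => (hgint j).abs]
    calc _ ≤ ∫ b, (symNorm (orbit f b) + ε) / n.factorial ∂cubeMeasure n :=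
          integral_mono (integrable_finsetSum _ fun j _ => (hgint j).abs)
            (((integrable_symNorm_orbit hf hfin).add (integrable_const ε)).div_const _) h1
      _ = lieAvg f + ε / n.factorial := by
          rw [integral_div, integral_add (integrable_symNorm_orbit hf hfin) (integrable_const ε)]
          simp [lieAvg]; ring
      _ ≤ _ := by
          have : ε / n.factorial ≤ ε := div_le_self hε.le (by exact_mod_cast n.factorial_pos)
          linarith
  · refine ae_of_all _ fun t => ?_
    have h2 : ∀ (v : Equiv.Perm (Fin n) → ℝ) (σ : Equiv.Perm (Fin n)),
        ∑ i, (Q v i).coeff (permWord σ) * r v i = v σ := by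
      intro v σ
      have := congrArg (fun x : NCPoly n => x.coeff (permWord σ)) (hsum v)
      simp only [coeff_symPoly] at this
      rw [this]
      simp [Finsupp.finsetSum_apply, mul_comm]
    have h3 : ∀ σ : Equiv.Perm (Fin n), ∑ j : ι, (Q j.1 j.2).coeff (permWord σ) *
        g j (fun i => t (σ.symm i)) = f t / n.factorial := by
      intro σ
      rw [Fintype.sum_sigma, Finset.sum_eq_single
        (⟨orbit f fun i => t (σ.symm i), hmem _⟩ : V)]
      · simp only [g, if_true, ← mul_div_assoc, ← Finset.sum_div]
        rw [h2]
        simp [orbit]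
      · intro v _ hv
        have : ¬ (orbit f fun i => t (σ.symm i)) = v := fun h => hv (Subtype.ext h.symm)
        simp [g, this]
      · simp
    simp only [substitute]
    rw [Finset.sum_comm, Finset.sum_congr rfl fun σ _ => h3 σ]
    simp [Fintype.card_perm]
    field_simp

/-- The Lie norm of a noncommutative integral is computed pointwise: it is the average of the Lie
norms of the multilinear polynomials which collect the values of `f` along the orbits of the
symmetric group. -/
theorem lieNorm_eq_lieAvg {n : ℕ} {f : (Fin n → ℝ) → ℝ} (hf : Measurable f)
    (hfin : (range f).Finite) : lieNorm f = lieAvg f :=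
  le_antisymm (lieNorm_le_lieAvg hf hfin) (lieAvg_le_lieNorm hf hfin)

lemma assocNorm_eq {n : ℕ} (f : (Fin n → ℝ) → ℝ) :
    assocNorm f = ∫ b, |f b| ∂cubeMeasure n := by
  rw [assocNorm, restrict_cube]

lemma assocNorm_eq_avg {n : ℕ} {f : (Fin n → ℝ) → ℝ} (hf : Integrable f (cubeMeasure n)) :
    assocNorm f =
      (1 / (n.factorial : ℝ)) * ∫ b, ∑ π, |orbit f b π| ∂cubeMeasure n := by
  rw [assocNorm_eq, integral_finsetSum]
  · simp only [orbit]
    rw [Finset.sum_congr rfl fun ρ _ =>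
      integral_comp_perm ρ (g := fun b => |f b|) hf.abs.aestronglyMeasurable]
    have hfac : (n.factorial : ℝ) ≠ 0 := by positivity
    simp [Fintype.card_perm]
    field_simp
  · exact fun π _ => ((measurePreserving_perm π).integrable_comp_of_integrable hf).abs

/-! ### Ascents and descents of lists -/

section Ascents

variable {α β : Type*} [LinearOrder α] [LinearOrder β]

/-- The number of ascents of a list. -/
def ascents : List α → ℕ
  | a :: b :: l => (if a < b then 1 else 0) + ascents (b :: l)
  | _ => 0

/-- The number of descents of a list. -/
def descents : List α → ℕ
  | a :: b :: l => (if b < a then 1 else 0) + descents (b :: l)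
  | _ => 0

/-- The weight `λ^{asc}(λ-1)^{des}` of a list. -/
def listWeight (lam : ℝ) (l : List α) : ℝ := lam ^ ascents l * (lam - 1) ^ descents l

@[simp] lemma ascents_nil : ascents ([] : List α) = 0 := rfl
@[simp] lemma ascents_singleton (a : α) : ascents [a] = 0 := rfl
@[simp] lemma descents_nil : descents ([] : List α) = 0 := rfl
@[simp] lemma descents_singleton (a : α) : descents [a] = 0 := rfl

/-- The contribution of two consecutive entries to the weight of a list. -/
def stepWeight (lam : ℝ) (a b : α) : ℝ := if a < b then lam else if b < a then lam - 1 else 1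

lemma ascents_cons_cons (a b : α) (l : List α) :
    ascents (a :: b :: l) = (if a < b then 1 else 0) + ascents (b :: l) := rfl

lemma descents_cons_cons (a b : α) (l : List α) :
    descents (a :: b :: l) = (if b < a then 1 else 0) + descents (b :: l) := rfl

@[simp] lemma listWeight_singleton (lam : ℝ) (a : α) : listWeight lam [a] = 1 := by
  simp [listWeight]

lemma listWeight_cons_cons (lam : ℝ) (a b : α) (l : List α) :
    listWeight lam (a :: b :: l) = stepWeight lam a b * listWeight lam (b :: l) := by
  rw [listWeight, listWeight, ascents_cons_cons, descents_cons_cons, stepWeight]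
  rcases lt_trichotomy a b with h | h | h
  · simp [h, h.not_gt, pow_add]; ring
  · simp [h]
  · simp [h, h.not_gt, pow_add]; ring

/-- The weight is multiplicative with respect to cutting a list at one of its entries. -/
lemma listWeight_append (lam : ℝ) (l : List α) (s : α) (l' : List α) :
    listWeight lam (l ++ s :: l') = listWeight lam (l ++ [s]) * listWeight lam (s :: l') := by
  induction l with
  | nil => simp
  | cons a l ih =>
    cases l with
    | nil => simp [listWeight_cons_cons]
    | cons b l =>
      simp only [List.cons_append, listWeight_cons_cons] at ih ⊢
      rw [ih, mul_assoc]

lemma ascents_map {f : α → β} {l : List α}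
    (h : ∀ a ∈ l, ∀ b ∈ l, f a < f b ↔ a < b) : ascents (l.map f) = ascents l := by
  induction l with
  | nil => rfl
  | cons a l ih =>
    cases l with
    | nil => rfl
    | cons b l =>
      have := ih fun x hx y hy => h x (List.mem_cons_of_mem _ hx) y (List.mem_cons_of_mem _ hy)
      simp only [List.map_cons, ascents_cons_cons] at this ⊢
      rw [this, if_congr (h a (by simp) b (by simp)) rfl rfl]

lemma descents_map {f : α → β} {l : List α}
    (h : ∀ a ∈ l, ∀ b ∈ l, f a < f b ↔ a < b) : descents (l.map f) = descents l := by
  induction l with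
  | nil => rfl
  | cons a l ih =>
    cases l with
    | nil => rfl
    | cons b l =>
      have := ih fun x hx y hy => h x (List.mem_cons_of_mem _ hx) y (List.mem_cons_of_mem _ hy)
      simp only [List.map_cons, descents_cons_cons] at this ⊢
      rw [this, if_congr (h b (by simp) a (by simp)) rfl rfl]

lemma listWeight_map (lam : ℝ) {f : α → β} {l : List α}
    (h : ∀ a ∈ l, ∀ b ∈ l, f a < f b ↔ a < b) :
    listWeight lam (l.map f) = listWeight lam l := by
  rw [listWeight, ascents_map h, descents_map h, listWeight]

lemma ascents_map_anti {f : α → β} {l : List α}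
    (h : ∀ a ∈ l, ∀ b ∈ l, f a < f b ↔ b < a) : ascents (l.map f) = descents l := by
  induction l with
  | nil => rfl
  | cons a l ih =>
    cases l with
    | nil => rfl
    | cons b l =>
      have := ih fun x hx y hy => h x (List.mem_cons_of_mem _ hx) y (List.mem_cons_of_mem _ hy)
      simp only [List.map_cons, ascents_cons_cons, descents_cons_cons] at this ⊢
      rw [this, if_congr (h a (by simp) b (by simp)) rfl rfl]

lemma descents_map_anti {f : α → β} {l : List α}
    (h : ∀ a ∈ l, ∀ b ∈ l, f a < f b ↔ b < a) : descents (l.map f) = ascents l := by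
  induction l with
  | nil => rfl
  | cons a l ih =>
    cases l with
    | nil => rfl
    | cons b l =>
      have := ih fun x hx y hy => h x (List.mem_cons_of_mem _ hx) y (List.mem_cons_of_mem _ hy)
      simp only [List.map_cons, ascents_cons_cons, descents_cons_cons] at this ⊢
      rw [this, if_congr (h b (by simp) a (by simp)) rfl rfl]

lemma ascents_add_descents {l : List α} (h : l.Nodup) :
    ascents l + descents l = l.length - 1 := by
  induction l with
  | nil => rfl
  | cons a l ih =>
    cases l with
    | nil => rfl
    | cons b l =>
      have := ih (List.nodup_cons.1 h).2
      have hab : a ≠ b := fun e => (List.nodup_cons.1 h).1 (by simp [e])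
      simp only [ascents_cons_cons, descents_cons_cons, List.length_cons] at this ⊢
      rcases hab.lt_or_gt with h | h
      · simp only [h, h.not_gt, if_true, if_false]; omega
      · simp only [h, h.not_gt, if_true, if_false]; omega

lemma ascents_add_descents_le (l : List α) : ascents l + descents l ≤ l.length - 1 := by
  induction l with
  | nil => simp
  | cons a l ih =>
    cases l with
    | nil => simp
    | cons b l =>
      simp only [ascents_cons_cons, descents_cons_cons, List.length_cons] at ih ⊢
      rcases lt_trichotomy a b with h | h | h
      · simp only [h, h.not_gt, if_true, if_false]; omega
      · simp only [h, lt_irrefl, if_false]; omega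
      · simp only [h, h.not_gt, if_true, if_false]; omega

lemma abs_listWeight_le_one {lam : ℝ} (h0 : 0 ≤ lam) (h1 : lam ≤ 1) (l : List α) :
    |listWeight lam l| ≤ 1 := by
  rw [listWeight, abs_mul, abs_pow, abs_pow]
  have e1 : |lam| ≤ 1 := by rw [abs_of_nonneg h0]; exact h1
  have e2 : |lam - 1| ≤ 1 := by rw [abs_of_nonpos (by linarith)]; linarith
  exact mul_le_one₀ (pow_le_one₀ (abs_nonneg _) e1) (by positivity)
    (pow_le_one₀ (abs_nonneg _) e2)

lemma listWeight_ne_zero {lam : ℝ} (h0 : 0 < lam) (h1 : lam < 1) (l : List α) :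
    listWeight lam l ≠ 0 :=
  mul_ne_zero (pow_ne_zero _ h0.ne') (pow_ne_zero _ (by linarith))

end Ascents

lemma asc_eq_ascents {m : ℕ} (v : Fin (m + 1) → ℝ) : asc v = ascents (List.ofFn v) := by
  induction m with
  | zero => simp [asc]
  | succ m ih =>
    have h := ih fun i => v i.succ
    rw [List.ofFn_succ, List.ofFn_succ, ascents_cons_cons, ← List.ofFn_succ (f := fun i => v i.succ),
      ← h]
    simp only [asc, Finset.card_filter]
    rw [Fin.sum_univ_succ]
    rfl

lemma des_eq_descents {m : ℕ} (v : Fin (m + 1) → ℝ) : des v = descents (List.ofFn v) := by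
  induction m with
  | zero => simp [des]
  | succ m ih =>
    have h := ih fun i => v i.succ
    rw [List.ofFn_succ, List.ofFn_succ, descents_cons_cons,
      ← List.ofFn_succ (f := fun i => v i.succ), ← h]
    simp only [des, Finset.card_filter]
    rw [Fin.sum_univ_succ]
    rfl

lemma resolventWeight_eq (n : ℕ) (lam t₀ t' : ℝ) (t : Fin n → ℝ) :
    resolventWeight n lam t₀ t' t = listWeight lam (t₀ :: (List.ofFn t ++ [t'])) := by
  have h : List.ofFn (Fin.cons t₀ (Fin.snoc (α := fun _ => ℝ) t t') : Fin (n + 1 + 1) → ℝ) =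
      t₀ :: (List.ofFn t ++ [t']) := by
    rw [List.ofFn_succ]
    simp only [Fin.cons_zero, Fin.cons_succ]
    rw [List.ofFn_succ']
    simp
  rw [resolventWeight, listWeight, ← h, ← asc_eq_ascents, ← des_eq_descents]

/-! ### Measurability and almost sure properties -/

lemma measurable_ascents_ofFn {m : ℕ} {Ω : Type*} [MeasurableSpace Ω] {v : Ω → Fin m → ℝ}
    (hv : ∀ i, Measurable fun ω => v ω i) : Measurable fun ω => ascents (List.ofFn (v ω)) := by
  cases m with
  | zero => simp
  | succ m =>
    simp only [← asc_eq_ascents, asc, Finset.card_filter]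
    exact Finset.measurable_fun_sum _ fun i _ =>
      Measurable.ite (measurableSet_lt (hv _) (hv _)) measurable_const measurable_const

lemma measurable_descents_ofFn {m : ℕ} {Ω : Type*} [MeasurableSpace Ω] {v : Ω → Fin m → ℝ}
    (hv : ∀ i, Measurable fun ω => v ω i) : Measurable fun ω => descents (List.ofFn (v ω)) := by
  cases m with
  | zero => simp
  | succ m =>
    simp only [← des_eq_descents, des, Finset.card_filter]
    exact Finset.measurable_fun_sum _ fun i _ =>
      Measurable.ite (measurableSet_lt (hv _) (hv _)) measurable_const measurable_const

lemma measurable_listWeight_ofFn {m : ℕ} (lam : ℝ) {Ω : Type*} [MeasurableSpace Ω]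
    {v : Ω → Fin m → ℝ} (hv : ∀ i, Measurable fun ω => v ω i) :
    Measurable fun ω => listWeight lam (List.ofFn (v ω)) :=
  ((measurable_from_nat (f := fun k => lam ^ k)).comp (measurable_ascents_ofFn hv)).mul
    ((measurable_from_nat (f := fun k => (lam - 1) ^ k)).comp (measurable_descents_ofFn hv))

lemma measurable_resolventWeight' {n : ℕ} (lam : ℝ) {Ω : Type*} [MeasurableSpace Ω]
    {s s' : Ω → ℝ} {v : Ω → Fin n → ℝ} (hs : Measurable s) (hs' : Measurable s')
    (hv : ∀ i, Measurable fun ω => v ω i) :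
    Measurable fun ω => resolventWeight n lam (s ω) (s' ω) (v ω) := by
  have h : ∀ ω, resolventWeight n lam (s ω) (s' ω) (v ω) = listWeight lam (List.ofFn
      (Fin.cons (s ω) (Fin.snoc (α := fun _ => ℝ) (v ω) (s' ω)) : Fin (n + 1 + 1) → ℝ)) := by
    intro ω
    rw [listWeight, ← asc_eq_ascents, ← des_eq_descents]; rfl
  simp only [h]
  refine measurable_listWeight_ofFn lam fun i => ?_
  refine Fin.cases (by simpa using hs) (fun i => ?_) i
  refine Fin.lastCases (by simpa using hs') (fun i => by simpa using hv i) i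

lemma measurable_resolventWeight (n : ℕ) (lam t₀ t' : ℝ) :
    Measurable (resolventWeight n lam t₀ t') :=
  measurable_resolventWeight' lam measurable_const measurable_const fun i => measurable_pi_apply i

lemma finite_range_resolventWeight (n : ℕ) (lam t₀ t' : ℝ) :
    (range (resolventWeight n lam t₀ t')).Finite := by
  have : range (resolventWeight n lam t₀ t') ⊆
      (fun p : ℕ × ℕ => lam ^ p.1 * (lam - 1) ^ p.2) '' (Iic (n + 1) ×ˢ Iic (n + 1)) := by
    rintro _ ⟨t, rfl⟩
    have h := ascents_add_descents_le (t₀ :: (List.ofFn t ++ [t']))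
    simp only [List.length_cons, List.length_append, List.length_ofFn, List.length_nil] at h
    exact ⟨(ascents (t₀ :: (List.ofFn t ++ [t'])), descents (t₀ :: (List.ofFn t ++ [t']))),
      ⟨by simp only [mem_Iic]; omega, by simp only [mem_Iic]; omega⟩,
      (resolventWeight_eq _ _ _ _ _).symm⟩
  exact (((finite_Iic _).prod (finite_Iic _)).image _).subset this

lemma abs_resolventWeight_le_one {n : ℕ} {lam : ℝ} (h : lam ∈ Icc (0 : ℝ) 1) (t₀ t' : ℝ)
    (t : Fin n → ℝ) : |resolventWeight n lam t₀ t' t| ≤ 1 := by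
  rw [resolventWeight_eq]; exact abs_listWeight_le_one h.1 h.2 _

lemma ae_apply_ne {n : ℕ} (i : Fin n) (x : ℝ) : ∀ᵐ b ∂cubeMeasure n, b i ≠ x := by
  have : cubeMeasure n {b | b i = x} = 0 := by
    rw [← restrict_cube]
    refine Measure.absolutelyContinuous_of_le Measure.restrict_le_self ?_
    rw [volume_pi]
    exact Measure.pi_hyperplane (fun _ : Fin n => (volume : Measure ℝ)) i x
  exact compl_mem_ae_iff.2 this

lemma ae_injective (n : ℕ) : ∀ᵐ b ∂cubeMeasure n, Function.Injective b := by
  have h : ∀ i j : Fin n, i ≠ j → ∀ᵐ b ∂cubeMeasure n, b i ≠ b j := by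
    intro i j hij
    let S : Submodule ℝ (Fin n → ℝ) :=
      LinearMap.ker (LinearMap.proj (R := ℝ) (φ := fun _ : Fin n => ℝ) i - LinearMap.proj j)
    have hS : S ≠ ⊤ := by
      intro hS
      have : (Pi.single i 1 : Fin n → ℝ) ∈ S := hS ▸ Submodule.mem_top
      simp [S, hij.symm] at this
    have h0 := Measure.addHaar_submodule volume S hS
    have : cubeMeasure n {b | b i = b j} = 0 := by
      rw [← restrict_cube]
      refine Measure.absolutelyContinuous_of_le Measure.restrict_le_self ?_
      refine measure_mono_null (fun b hb => ?_) h0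
      have hb' : b i = b j := hb
      simp [S, hb']
    exact compl_mem_ae_iff.2 this
  have h' : ∀ᵐ b ∂cubeMeasure n, ∀ i j : Fin n, i ≠ j → b i ≠ b j := by
    refine ae_all_iff.2 fun i => ae_all_iff.2 fun j => ?_
    by_cases hij : i = j
    · exact ae_of_all _ fun b h => absurd hij h
    · filter_upwards [h i j hij] with b hb _ using hb
  filter_upwards [h'] with b hb i j hij
  by_contra hne
  exact hb i j hne hij

lemma ae_mem_Ioo (n : ℕ) : ∀ᵐ b ∂cubeMeasure n, ∀ i, b i ∈ Ioo (0 : ℝ) 1 := by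
  have h1 : ∀ᵐ b ∂cubeMeasure n, b ∈ cube n := by
    rw [← restrict_cube]
    exact ae_restrict_mem measurableSet_Icc
  have h2 : ∀ᵐ b ∂cubeMeasure n, ∀ i, b i ≠ 0 := ae_all_iff.2 fun i => ae_apply_ne i 0
  have h3 : ∀ᵐ b ∂cubeMeasure n, ∀ i, b i ≠ 1 := ae_all_iff.2 fun i => ae_apply_ne i 1
  filter_upwards [h1, h2, h3] with b hb h0 h1 i
  exact ⟨lt_of_le_of_ne (hb.1 i) (h0 i).symm, lt_of_le_of_ne (hb.2 i) (h1 i)⟩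

/-- Almost surely, the coordinates are distinct, lie in the open unit interval, and avoid two
given numbers. -/
lemma ae_generic (n : ℕ) (x y : ℝ) : ∀ᵐ b ∂cubeMeasure n, Function.Injective b ∧
    (∀ i, b i ∈ Ioo (0 : ℝ) 1) ∧ (∀ i, b i ≠ x) ∧ ∀ i, b i ≠ y := by
  filter_upwards [ae_injective n, ae_mem_Ioo n, ae_all_iff.2 fun i => ae_apply_ne i x,
    ae_all_iff.2 fun i => ae_apply_ne i y] with b h1 h2 h3 h4
  exact ⟨h1, h2, h3, h4⟩

/-! ### Symmetries of the kernels -/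

lemma symNorm_smul {n : ℕ} (r : ℝ) (c : Equiv.Perm (Fin n) → ℝ) :
    symNorm (r • c) = |r| * symNorm c := by
  refine le_antisymm (symNorm_smul_le r c) ?_
  rcases eq_or_ne r 0 with rfl | hr
  · simpa using symNorm_nonneg _
  · have h := symNorm_smul_le r⁻¹ (r • c)
    rw [smul_smul, inv_mul_cancel₀ hr, one_smul, abs_inv] at h
    rwa [← div_eq_inv_mul, le_div_iff₀ (abs_pos.2 hr), mul_comm] at h

/-- The `ℓ¹` norm of a family of coefficients. -/
def l1Norm {n : ℕ} (c : Equiv.Perm (Fin n) → ℝ) : ℝ := ∑ σ, |c σ|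

lemma continuous_l1Norm {n : ℕ} : Continuous (l1Norm (n := n)) := by
  unfold l1Norm; fun_prop

lemma l1Norm_smul {n : ℕ} (r : ℝ) (c : Equiv.Perm (Fin n) → ℝ) :
    l1Norm (r • c) = |r| * l1Norm c := by
  simp [l1Norm, abs_mul, Finset.mul_sum]

/-- The average over the cube of a function of the values of the resolvent weight along the orbit
of the symmetric group. -/
def orbitAvg {n : ℕ} (φ : (Equiv.Perm (Fin n) → ℝ) → ℝ) (lam t₀ t' : ℝ) : ℝ :=
  ∫ b, φ (orbit (resolventWeight n lam t₀ t') b) ∂cubeMeasure n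

lemma kernelLie₂_eq (n : ℕ) (lam t₀ t' : ℝ) :
    kernelLie₂ n lam t₀ t' = 1 / (n.factorial : ℝ) * orbitAvg (n := n) symNorm lam t₀ t' :=
  lieNorm_eq_lieAvg (measurable_resolventWeight n lam t₀ t')
    (finite_range_resolventWeight n lam t₀ t')

lemma kernel₂_eq (n : ℕ) (lam t₀ t' : ℝ) :
    kernel₂ n lam t₀ t' = 1 / (n.factorial : ℝ) * orbitAvg (n := n) l1Norm lam t₀ t' :=
  assocNorm_eq_avg (integrable_of_range_finite (measurable_resolventWeight n lam t₀ t')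
    (finite_range_resolventWeight n lam t₀ t'))

/-- The rotation of the unit interval, seen as a circle, which moves `c` to `0`. -/
def rot (c x : ℝ) : ℝ := if x < c then x - c + 1 else x - c

/-- The indicator of the part of the unit interval which crosses the end point under `rot c`. -/
def wrap (c x : ℝ) : ℕ := if x < c then 1 else 0

lemma measurable_rot (c : ℝ) : Measurable (rot c) :=
  Measurable.ite measurableSet_Iio (by fun_prop) (by fun_prop)

lemma measurePreserving_rot {c : ℝ} (hc : c ∈ Icc (0 : ℝ) 1) :
    MeasurePreserving (rot c) (volume.restrict (Icc (0 : ℝ) 1))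
      (volume.restrict (Icc (0 : ℝ) 1)) := by
  have hI : volume.restrict (Icc (0 : ℝ) 1) = volume.restrict (Ico (0 : ℝ) 1) :=
    Measure.restrict_congr_set Ico_ae_eq_Icc.symm
  rw [hI]
  refine ⟨measurable_rot c, Measure.ext fun s hs => ?_⟩
  rw [Measure.map_apply (measurable_rot c) hs, Measure.restrict_apply hs,
    Measure.restrict_apply (measurable_rot c hs)]
  have h1 : rot c ⁻¹' s ∩ Ico 0 1 =
      (fun x => x + (1 - c)) ⁻¹' (s ∩ Ico (1 - c) 1) ∪ (fun x => x + -c) ⁻¹' (s ∩ Ico 0 (1 - c)) := by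
    ext x
    simp only [rot, mem_inter_iff, mem_preimage, mem_Ico, mem_union]
    have e1 : x - c + 1 = x + (1 - c) := by ring
    have e2 : x - c = x + -c := by ring
    split_ifs with h
    · rw [e1]
      constructor
      · rintro ⟨h2, h3, h4⟩; exact Or.inl ⟨h2, by linarith, by linarith⟩
      · rintro (⟨h2, h3, h4⟩ | ⟨h2, h3, h4⟩)
        · exact ⟨h2, by linarith, by linarith [hc.2]⟩
        · linarith
    · rw [e2]
      constructor
      · rintro ⟨h2, h3, h4⟩; exact Or.inr ⟨h2, by linarith, by linarith⟩
      · rintro (⟨h2, h3, h4⟩ | ⟨h2, h3, h4⟩)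
        · linarith
        · exact ⟨h2, by linarith [hc.1], by linarith⟩
  have h2 : s ∩ Ico 0 1 = (s ∩ Ico (1 - c) 1) ∪ (s ∩ Ico 0 (1 - c)) := by
    rw [← inter_union_distrib_left, union_comm, Ico_union_Ico_eq_Ico (by linarith [hc.2])
      (by linarith [hc.1])]
  have hm : ∀ u v : ℝ, MeasurableSet (s ∩ Ico u v) := fun u v => hs.inter measurableSet_Ico
  rw [h1, measure_union _ ((measurable_add_const (-c)) (hm _ _)),
    measure_preimage_add_right, measure_preimage_add_right, h2, measure_union _ (hm _ _)]
  · refine Set.disjoint_left.2 ?_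
    rintro x ⟨-, hx⟩ ⟨-, hx'⟩
    exact absurd hx.1 (not_le.2 hx'.2)
  · refine Set.disjoint_left.2 ?_
    rintro x ⟨-, hx⟩ ⟨-, hx'⟩
    simp only [mem_Ico] at hx hx'
    linarith [hx.1, hx'.2]

lemma measurePreserving_reflect :
    MeasurePreserving (fun x : ℝ => 1 - x) (volume.restrict (Icc (0 : ℝ) 1))
      (volume.restrict (Icc (0 : ℝ) 1)) := by
  have h := (Measure.measurePreserving_sub_left (volume : Measure ℝ) 1).restrict_preimage
    (s := Icc (0 : ℝ) 1) measurableSet_Icc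
  simpa using h

lemma measurePreserving_cube {T : ℝ → ℝ} (n : ℕ)
    (hT : MeasurePreserving T (volume.restrict (Icc (0 : ℝ) 1)) (volume.restrict (Icc (0 : ℝ) 1))) :
    MeasurePreserving (fun (b : Fin n → ℝ) i => T (b i)) (cubeMeasure n) (cubeMeasure n) :=
  measurePreserving_pi _ _ fun _ => hT

/-- A step of a sequence changes its type under a rotation only if exactly one of its two ends
crosses the end point of the interval; these changes add up to a boundary term. -/
lemma ascents_rot {c : ℝ} {l : List ℝ} {a : ℝ}
    (h : List.IsChain (fun x y => |x - y| < 1) (a :: l)) :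
    ascents ((a :: l).map (rot c)) + wrap c a =
      ascents (a :: l) + wrap c ((a :: l).getLast (by simp)) ∧
    descents ((a :: l).map (rot c)) + wrap c ((a :: l).getLast (by simp)) =
      descents (a :: l) + wrap c a := by
  induction l generalizing a with
  | nil => simp
  | cons b l ih =>
    rw [List.isChain_cons_cons] at h
    obtain ⟨i1, i2⟩ := ih h.2
    obtain ⟨h1, h2⟩ := abs_lt.1 h.1
    have key : ((if rot c a < rot c b then 1 else 0) + wrap c a =
        (if a < b then 1 else 0) + wrap c b) ∧
        ((if rot c b < rot c a then 1 else 0) + wrap c b =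
        (if b < a then 1 else 0) + wrap c a) := by
      simp only [rot, wrap]
      constructor
      · split_ifs <;> first | rfl | (exfalso; linarith)
      · split_ifs <;> first | rfl | (exfalso; linarith)
    rw [List.getLast_cons (by simp)]
    simp only [List.map_cons, ascents_cons_cons, descents_cons_cons] at i1 i2 ⊢
    omega

lemma isChain_of_mem_Ioo {l : List ℝ} {a b z : ℝ} (ha : a ∈ Icc (0 : ℝ) 1) (hz : z ∈ Icc (0 : ℝ) 1)
    (hb : b ∈ Ioo (0 : ℝ) 1) (hl : ∀ x ∈ l, x ∈ Ioo (0 : ℝ) 1) :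
    List.IsChain (fun x y : ℝ => |x - y| < 1) (a :: b :: (l ++ [z])) := by
  have hab : ∀ {a b : ℝ}, a ∈ Icc (0 : ℝ) 1 → b ∈ Ioo (0 : ℝ) 1 → |a - b| < 1 := fun ha hb =>
    abs_lt.2 ⟨by linarith [ha.1, hb.2], by linarith [ha.2, hb.1]⟩
  induction l generalizing a b with
  | nil => simpa using ⟨hab ha hb, by rw [abs_sub_comm]; exact hab hz hb⟩
  | cons c l ih =>
    rw [List.isChain_cons_cons]
    exact ⟨hab ha hb, ih ⟨hb.1.le, hb.2.le⟩ (hl c (by simp)) fun x hx => hl x (by simp [hx])⟩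

lemma resolventWeight_rot {n : ℕ} (hn : 1 ≤ n) (lam c : ℝ) {t₀ t' : ℝ} (h₀ : t₀ ∈ Icc (0 : ℝ) 1)
    (h' : t' ∈ Icc (0 : ℝ) 1) {b : Fin n → ℝ} (hb : ∀ i, b i ∈ Ioo (0 : ℝ) 1) :
    lam ^ wrap c t₀ * (lam - 1) ^ wrap c t' *
        resolventWeight n lam (rot c t₀) (rot c t') (fun i => rot c (b i)) =
      lam ^ wrap c t' * (lam - 1) ^ wrap c t₀ * resolventWeight n lam t₀ t' b := by
  have hmap : rot c t₀ :: (List.ofFn (fun i => rot c (b i)) ++ [rot c t']) =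
      (t₀ :: (List.ofFn b ++ [t'])).map (rot c) := by
    simp [List.map_ofFn, Function.comp_def]
  have hchain : List.IsChain (fun x y : ℝ => |x - y| < 1) (t₀ :: (List.ofFn b ++ [t'])) := by
    obtain ⟨m, rfl⟩ : ∃ m, n = m + 1 := ⟨n - 1, by omega⟩
    rw [List.ofFn_succ]
    refine isChain_of_mem_Ioo h₀ h' (hb 0) fun x hx => ?_
    obtain ⟨i, rfl⟩ := List.mem_ofFn.1 hx
    exact hb _
  obtain ⟨e1, e2⟩ := ascents_rot (c := c) hchain
  have hlast : (t₀ :: (List.ofFn b ++ [t'])).getLast (by simp) = t' := by simp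
  rw [hlast] at e1 e2
  rw [resolventWeight_eq, resolventWeight_eq, hmap, listWeight, listWeight]
  calc _ = lam ^ (ascents ((t₀ :: (List.ofFn b ++ [t'])).map (rot c)) + wrap c t₀) *
        (lam - 1) ^ (descents ((t₀ :: (List.ofFn b ++ [t'])).map (rot c)) + wrap c t') := by
        rw [pow_add, pow_add]; ring
    _ = _ := by rw [e1, e2, pow_add, pow_add]; ring

section Avg

variable {n : ℕ} {φ : (Equiv.Perm (Fin n) → ℝ) → ℝ}

lemma integral_cube_comp {T : ℝ → ℝ}
    (hT : MeasurePreserving T (volume.restrict (Icc (0 : ℝ) 1)) (volume.restrict (Icc (0 : ℝ) 1)))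
    {g : (Fin n → ℝ) → ℝ} (hg : Measurable g) :
    ∫ b, g (fun i => T (b i)) ∂cubeMeasure n = ∫ b, g b ∂cubeMeasure n := by
  have h := measurePreserving_cube n hT
  have := integral_map (μ := cubeMeasure n) h.measurable.aemeasurable
    (f := g) hg.aestronglyMeasurable
  rw [h.map_eq] at this
  exact this.symm

lemma measurable_comp_orbit (hφ : Continuous φ) (lam t₀ t' : ℝ) :
    Measurable fun b => φ (orbit (resolventWeight n lam t₀ t') b) :=
  hφ.measurable.comp (measurable_orbit (measurable_resolventWeight n lam t₀ t'))

lemma orbitAvg_rot (hφ : Continuous φ) (hsm : ∀ (r : ℝ) c, φ (r • c) = |r| * φ c)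
    (hn : 1 ≤ n) (lam : ℝ) {c : ℝ} (hc : c ∈ Icc (0 : ℝ) 1) {t₀ t' : ℝ} (h₀ : t₀ ∈ Icc (0 : ℝ) 1)
    (h' : t' ∈ Icc (0 : ℝ) 1) :
    |lam ^ wrap c t₀ * (lam - 1) ^ wrap c t'| * orbitAvg φ lam (rot c t₀) (rot c t') =
      |lam ^ wrap c t' * (lam - 1) ^ wrap c t₀| * orbitAvg φ lam t₀ t' := by
  rw [orbitAvg, ← integral_cube_comp (measurePreserving_rot hc)
    (measurable_comp_orbit hφ _ _ _), orbitAvg, ← integral_const_mul, ← integral_const_mul]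
  refine integral_congr_ae ?_
  filter_upwards [ae_mem_Ioo n] with b hb
  rw [← hsm, ← hsm]
  congr 1
  ext π
  simpa [orbit] using resolventWeight_rot hn lam c h₀ h' (b := fun i => b (π i)) fun i => hb _

lemma nodup_ofFn_append {b : Fin n → ℝ} (hb : Function.Injective b) {t' : ℝ}
    (h' : ∀ i, b i ≠ t') : (List.ofFn b ++ [t']).Nodup := by
  rw [List.nodup_append]
  refine ⟨List.nodup_ofFn.2 hb, by simp, ?_⟩
  rintro _ hx _ hy rfl
  obtain ⟨i, hi⟩ := List.mem_ofFn.1 hx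
  exact h' i (hi.trans (by simpa using hy))

lemma resolventWeight_reflect (lam : ℝ) {t₀ t' : ℝ}
    {b : Fin n → ℝ} (hb : Function.Injective b) (hn : 1 ≤ n) (h₀ : ∀ i, b i ≠ t₀)
    (h' : ∀ i, b i ≠ t') :
    resolventWeight n (1 - lam) (1 - t₀) (1 - t') (fun i => 1 - b i) =
      (-1) ^ (n + 1) * resolventWeight n lam t₀ t' b := by
  have hmap : (1 - t₀) :: (List.ofFn (fun i => 1 - b i) ++ [1 - t']) =
      (t₀ :: (List.ofFn b ++ [t'])).map (fun x => 1 - x) := by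
    simp [List.map_ofFn, Function.comp_def]
  have hcount : ascents (t₀ :: (List.ofFn b ++ [t'])) + descents (t₀ :: (List.ofFn b ++ [t'])) =
      n + 1 := by
    obtain ⟨m, rfl⟩ : ∃ m, n = m + 1 := ⟨n - 1, by omega⟩
    have e1 := ascents_add_descents (nodup_ofFn_append hb h')
    rw [List.ofFn_succ] at e1 ⊢
    simp only [List.cons_append, ascents_cons_cons, descents_cons_cons, List.length_cons,
      List.length_append, List.length_ofFn, List.length_nil] at e1 ⊢
    rcases (h₀ 0).lt_or_gt with h | h
    · simp only [h, h.not_gt, if_true, if_false]; omega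
    · simp only [h, h.not_gt, if_true, if_false]; omega
  rw [resolventWeight_eq, resolventWeight_eq, hmap, listWeight, listWeight,
    ascents_map_anti (fun a _ b _ => by simp), descents_map_anti (fun a _ b _ => by simp), ← hcount,
    pow_add, show 1 - lam = -1 * (lam - 1) by ring, show -1 * (lam - 1) - 1 = -1 * lam by ring,
    mul_pow, mul_pow]
  ring

lemma orbitAvg_reflect (hφ : Continuous φ) (hsm : ∀ (r : ℝ) c, φ (r • c) = |r| * φ c)
    (hn : 1 ≤ n) (lam t₀ t' : ℝ) :
    orbitAvg φ (1 - lam) (1 - t₀) (1 - t') = orbitAvg φ lam t₀ t' := by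
  rw [orbitAvg, ← integral_cube_comp measurePreserving_reflect
    (measurable_comp_orbit hφ _ _ _), orbitAvg]
  refine integral_congr_ae ?_
  filter_upwards [ae_generic n t₀ t'] with b hb
  have : orbit (resolventWeight n (1 - lam) (1 - t₀) (1 - t')) (fun i => 1 - b i) =
      ((-1 : ℝ) ^ (n + 1)) • orbit (resolventWeight n lam t₀ t') b := by
    ext π
    exact resolventWeight_reflect lam (b := fun i => b (π i)) (hb.1.comp π.injective) hn
      (fun i => hb.2.2.1 _) fun i => hb.2.2.2 _
  rw [this, hsm]
  simp

lemma orbitAvg_sub (hφ : Continuous φ) (hsm : ∀ (r : ℝ) c, φ (r • c) = |r| * φ c)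
    (hn : 1 ≤ n) (lam : ℝ) {t₀ t' : ℝ} (h₀ : t₀ ∈ Icc (0 : ℝ) 1)
    (h' : t' ∈ Icc (0 : ℝ) 1) :
    orbitAvg φ lam t₀ t' = orbitAvg φ lam (max 0 (-(t' - t₀))) (max 0 (t' - t₀)) := by
  have hc : min t₀ t' ∈ Icc (0 : ℝ) 1 := ⟨le_min h₀.1 h'.1, (min_le_left _ _).trans h₀.2⟩
  have h := orbitAvg_rot hφ hsm hn lam hc h₀ h'
  have e1 : wrap (min t₀ t') t₀ = 0 := if_neg (not_lt.2 (min_le_left _ _))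
  have e2 : wrap (min t₀ t') t' = 0 := if_neg (not_lt.2 (min_le_right _ _))
  have e3 : rot (min t₀ t') t₀ = max 0 (-(t' - t₀)) := by
    rw [rot, if_neg (not_lt.2 (min_le_left _ _))]
    rcases le_total t₀ t' with h | h
    · rw [min_eq_left h, max_eq_left (by linarith)]; ring
    · rw [min_eq_right h, max_eq_right (by linarith)]; ring
  have e4 : rot (min t₀ t') t' = max 0 (t' - t₀) := by
    rw [rot, if_neg (not_lt.2 (min_le_right _ _))]
    rcases le_total t₀ t' with h | h
    · rw [min_eq_left h, max_eq_right (by linarith)]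
    · rw [min_eq_right h, max_eq_left (by linarith)]; ring
  rw [e1, e2, e3, e4] at h
  simpa using h.symm

/-- Moving the terminal point once around the circle multiplies the averages by
`(1-λ)/λ`. -/
lemma orbitAvg_periodic (hφ : Continuous φ) (hsm : ∀ (r : ℝ) c, φ (r • c) = |r| * φ c)
    (hn : 1 ≤ n) (lam : ℝ) {t : ℝ} (ht : t ∈ Ico (0 : ℝ) 1) :
    |lam| * orbitAvg φ lam (1 - t) 0 = |lam - 1| * orbitAvg φ lam 0 t := by
  have hc : 1 - t ∈ Icc (0 : ℝ) 1 := ⟨by linarith [ht.2], by linarith [ht.1]⟩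
  have h := orbitAvg_rot hφ hsm hn lam hc hc (t' := 0) ⟨le_rfl, zero_le_one⟩
  have e1 : wrap (1 - t) (1 - t) = 0 := if_neg (lt_irrefl _)
  have e2 : wrap (1 - t) 0 = 1 := if_pos (by linarith [ht.2])
  have e3 : rot (1 - t) (1 - t) = 0 := by simp [rot]
  have e4 : rot (1 - t) 0 = t := by rw [rot, if_pos (by linarith [ht.2])]; ring
  rw [e1, e2, e3, e4] at h
  simpa only [pow_zero, pow_one, one_mul, mul_one] using h.symm

end Avg

/-! ### Continuity and positivity of the kernels -/

open Filter Topology in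
lemma eventually_ascents_eq {X : Type*} [TopologicalSpace X] {p₀ : X} {L : List (X → ℝ)}
    (hL : ∀ f ∈ L, ContinuousAt f p₀)
    (h : List.IsChain (fun f g : X → ℝ => f p₀ ≠ g p₀) L) :
    ∀ᶠ p in 𝓝 p₀, ascents (L.map fun f => f p) = ascents (L.map fun f => f p₀) ∧
      descents (L.map fun f => f p) = descents (L.map fun f => f p₀) := by
  induction L with
  | nil => simp
  | cons f L ih =>
    cases L with
    | nil => simp
    | cons g L =>
      rw [List.isChain_cons_cons] at h
      have hf : ContinuousAt f p₀ := hL f (by simp)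
      have hg : ContinuousAt g p₀ := hL g (by simp)
      filter_upwards [ih (fun k hk => hL k (List.mem_cons_of_mem _ hk)) h.2,
        (h.1.lt_or_gt.elim
          (fun hlt => ((hf.eventually_lt hg hlt).mono fun p hp =>
            (⟨iff_of_true hp hlt, iff_of_false hp.not_gt hlt.not_gt⟩ :
              (f p < g p ↔ f p₀ < g p₀) ∧ (g p < f p ↔ g p₀ < f p₀))))
          (fun hlt => ((hg.eventually_lt hf hlt).mono fun p hp =>
            (⟨iff_of_false hp.not_gt hlt.not_gt, iff_of_true hp hlt⟩ :
              (f p < g p ↔ f p₀ < g p₀) ∧ (g p < f p ↔ g p₀ < f p₀)))))] with p hp hp'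
      simp only [List.map_cons, ascents_cons_cons, descents_cons_cons] at hp ⊢
      exact ⟨by rw [hp.1, if_congr hp'.1 rfl rfl], by rw [hp.2, if_congr hp'.2 rfl rfl]⟩

section

variable {n : ℕ} {φ : (Equiv.Perm (Fin n) → ℝ) → ℝ}

lemma continuousAt_resolventWeight (hn : 1 ≤ n) {b : Fin n → ℝ} (hb : Function.Injective b)
    {p₀ : ℝ × ℝ × ℝ} (h₀ : ∀ i, b i ≠ p₀.2.1) (h' : ∀ i, b i ≠ p₀.2.2) :
    ContinuousAt (fun p : ℝ × ℝ × ℝ => resolventWeight n p.1 p.2.1 p.2.2 b) p₀ := by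
  let L : List (ℝ × ℝ × ℝ → ℝ) :=
    (fun p => p.2.1) :: ((List.ofFn fun i p => b i) ++ [fun p => p.2.2])
  have hmap : ∀ p : ℝ × ℝ × ℝ, L.map (fun f => f p) = p.2.1 :: (List.ofFn b ++ [p.2.2]) := by
    intro p
    simp [L, List.map_ofFn, Function.comp_def]
  have hcont : ∀ f ∈ L, ContinuousAt f p₀ := by
    intro f hf
    simp only [L, List.mem_cons, List.mem_append, List.mem_ofFn, List.not_mem_nil,
      or_false] at hf
    rcases hf with rfl | ⟨i, rfl⟩ | rfl <;> fun_prop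
  have hchain : List.IsChain (fun f g : ℝ × ℝ × ℝ → ℝ => f p₀ ≠ g p₀) L := by
    rw [← List.isChain_map (fun f : ℝ × ℝ × ℝ → ℝ => f p₀) (R := fun x y => x ≠ y), hmap]
    obtain ⟨m, rfl⟩ : ∃ m, n = m + 1 := ⟨n - 1, by omega⟩
    have h1 := (nodup_ofFn_append hb h').isChain
    rw [List.ofFn_succ] at h1 ⊢
    rw [List.cons_append, List.isChain_cons_cons]
    exact ⟨(h₀ 0).symm, h1⟩
  have hev := eventually_ascents_eq hcont hchain
  simp only [hmap] at hev
  have hc : ContinuousAt (fun p : ℝ × ℝ × ℝ =>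
      p.1 ^ ascents (p₀.2.1 :: (List.ofFn b ++ [p₀.2.2])) *
        (p.1 - 1) ^ descents (p₀.2.1 :: (List.ofFn b ++ [p₀.2.2]))) p₀ := by fun_prop
  refine hc.congr ?_
  filter_upwards [hev] with p hp
  rw [resolventWeight_eq, listWeight, hp.1, hp.2]

lemma continuousOn_orbitAvg (hφ : Continuous φ) (hn : 1 ≤ n) :
    ContinuousOn (fun p : ℝ × ℝ × ℝ => orbitAvg φ p.1 p.2.1 p.2.2) {p | p.1 ∈ Icc (0 : ℝ) 1} := by
  intro p₀ hp₀
  have hK : IsCompact (Set.pi univ fun _ : Equiv.Perm (Fin n) => Icc (-1 : ℝ) 1) :=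
    isCompact_univ_pi fun _ => isCompact_Icc
  obtain ⟨C, hC⟩ := hK.exists_bound_of_continuousOn hφ.continuousOn
  refine tendsto_integral_filter_of_dominated_convergence (fun _ => C) ?_ ?_
    (integrable_const C) ?_
  · exact Filter.Eventually.of_forall fun p =>
      (measurable_comp_orbit hφ _ _ _).aestronglyMeasurable
  · filter_upwards [self_mem_nhdsWithin] with p hp
    refine ae_of_all _ fun b => hC _ fun π _ => abs_le.1 ?_
    exact abs_resolventWeight_le_one hp _ _ _
  · filter_upwards [ae_generic n p₀.2.1 p₀.2.2] with b hb
    refine (hφ.tendsto _).comp (Filter.Tendsto.mono_left ?_ nhdsWithin_le_nhds)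
    refine tendsto_pi_nhds.2 fun π => ?_
    exact continuousAt_resolventWeight hn (hb.1.comp π.injective) (fun i => hb.2.2.1 _)
      fun i => hb.2.2.2 _

lemma continuousOn_kernel (hn : 1 ≤ n) :
    ContinuousOn (fun p : ℝ × ℝ => kernel n p.1 p.2) {p | p.1 ∈ Icc (0 : ℝ) 1} := by
  simp only [kernel, kernel₂_eq]
  refine continuousOn_const.mul ?_
  exact (continuousOn_orbitAvg continuous_l1Norm hn).comp
    (f := fun p : ℝ × ℝ => (p.1, max 0 (-p.2), max 0 p.2)) (by fun_prop) fun p hp => hp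

lemma continuousOn_kernelLie (hn : 1 ≤ n) :
    ContinuousOn (fun p : ℝ × ℝ => kernelLie n p.1 p.2) {p | p.1 ∈ Icc (0 : ℝ) 1} := by
  simp only [kernelLie, kernelLie₂_eq]
  refine continuousOn_const.mul ?_
  exact (continuousOn_orbitAvg continuous_symNorm hn).comp
    (f := fun p : ℝ × ℝ => (p.1, max 0 (-p.2), max 0 p.2)) (by fun_prop) fun p hp => hp

lemma integrable_comp_orbit (hφ : Continuous φ) (lam t₀ t' : ℝ) :
    Integrable (fun b => φ (orbit (resolventWeight n lam t₀ t') b)) (cubeMeasure n) := by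
  refine integrable_of_range_finite (measurable_comp_orbit hφ _ _ _) ?_
  have : range (fun b => φ (orbit (resolventWeight n lam t₀ t') b)) =
      φ '' range (orbit (resolventWeight n lam t₀ t')) := by
    rw [← range_comp]; rfl
  rw [this]
  exact (range_orbit_finite (finite_range_resolventWeight _ _ _ _)).image _

lemma kernelLie₂_nonneg (n : ℕ) (lam t₀ t' : ℝ) : 0 ≤ kernelLie₂ n lam t₀ t' := by
  rw [kernelLie₂_eq]
  exact mul_nonneg (by positivity) (integral_nonneg fun _ => symNorm_nonneg _)

lemma kernelLie₂_le_kernel₂ (n : ℕ) (lam t₀ t' : ℝ) :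
    kernelLie₂ n lam t₀ t' ≤ kernel₂ n lam t₀ t' := by
  rw [kernelLie₂_eq, kernel₂_eq]
  exact mul_le_mul_of_nonneg_left (integral_mono (integrable_comp_orbit continuous_symNorm _ _ _)
    (integrable_comp_orbit continuous_l1Norm _ _ _) fun b => symNorm_le_l1 _) (by positivity)

lemma kernel₂_le_kernelLie₂ (n : ℕ) (lam t₀ t' : ℝ) :
    kernel₂ n lam t₀ t' ≤ 2 ^ n * kernelLie₂ n lam t₀ t' := by
  have h : orbitAvg (n := n) l1Norm lam t₀ t' ≤ 2 ^ n * orbitAvg (n := n) symNorm lam t₀ t' := by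
    rw [orbitAvg, orbitAvg, ← integral_const_mul]
    exact integral_mono (integrable_comp_orbit continuous_l1Norm _ _ _)
      ((integrable_comp_orbit continuous_symNorm _ _ _).const_mul _) fun b => l1_le_symNorm _
  rw [kernelLie₂_eq, kernel₂_eq, mul_left_comm]
  exact mul_le_mul_of_nonneg_left h (by positivity)

lemma kernel₂_pos (n : ℕ) {lam : ℝ} (h : lam ∈ Ioo (0 : ℝ) 1) (t₀ t' : ℝ) :
    0 < kernel₂ n lam t₀ t' := by
  rw [kernel₂, assocNorm_eq, integral_pos_iff_support_of_nonneg (fun _ => abs_nonneg _)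
    (integrable_of_range_finite (measurable_resolventWeight n lam t₀ t')
      (finite_range_resolventWeight n lam t₀ t')).abs]
  have : Function.support (fun b => |resolventWeight n lam t₀ t' b|) = univ := by
    refine eq_univ_of_forall fun b => ?_
    rw [Function.mem_support, resolventWeight_eq]
    exact abs_ne_zero.2 (listWeight_ne_zero h.1 h.2 _)
  simp [this]

/-! ### Strict inequality of the kernels -/

/-- If two words which differ in the order of their last two letters occur with coefficients of
opposite signs, then combining them into a commutator saves some cost. -/
lemma symNorm_lt_l1Norm {m : ℕ} {c : Equiv.Perm (Fin (m + 2)) → ℝ}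
    (h : c 1 * c (Equiv.swap (Fin.last m).castSucc (Fin.last (m + 1))) < 0) :
    symNorm c < l1Norm c := by
  set τ := Equiv.swap (Fin.last m).castSucc (Fin.last (m + 1)) with hτ
  have hτ1 : τ ≠ 1 := by
    intro e
    have := congrArg (fun σ : Equiv.Perm (Fin (m + 2)) => σ (Fin.last (m + 1))) e
    simp only [hτ, Equiv.swap_apply_right, Equiv.Perm.one_apply] at this
    exact (Fin.castSucc_lt_last _).ne this
  have hword : ∀ σ : Equiv.Perm (Fin (m + 2)), permPoly σ =
      wordOf (List.ofFn fun i : Fin m => σ i.castSucc.castSucc) *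
        (gen (σ (Fin.last m).castSucc) * gen (σ (Fin.last (m + 1)))) := by
    intro σ
    rw [permPoly, List.ofFn_succ', List.ofFn_succ', List.concat_eq_append, List.concat_eq_append,
      wordOf_append, wordOf_append, wordOf_singleton, wordOf_singleton, mul_assoc]
  have hQ : IsCommProduct Finset.univ (permPoly (1 : Equiv.Perm (Fin (m + 2))) - permPoly τ) := by
    have hne : (Fin.last m).castSucc ≠ Fin.last (m + 1) := (Fin.castSucc_lt_last _).ne
    have hfix : ∀ i : Fin m, τ i.castSucc.castSucc = i.castSucc.castSucc := fun i =>
      Equiv.swap_apply_of_ne_of_ne (by simp [Fin.ext_iff, i.2.ne]) (by simp [Fin.ext_iff]; omega)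
    have e : permPoly (1 : Equiv.Perm (Fin (m + 2))) - permPoly τ =
        wordOf (List.ofFn fun i : Fin m => i.castSucc.castSucc) *
          toAssoc (m + 2) ⁅FreeLieAlgebra.of ℝ (Fin.last m).castSucc,
            FreeLieAlgebra.of ℝ (Fin.last (m + 1))⁆ := by
      rw [hword, hword, toAssoc_bracket, toAssoc_of, toAssoc_of]
      simp only [hfix]
      simp only [Equiv.Perm.one_apply, hτ, Equiv.swap_apply_left, Equiv.swap_apply_right]
      rw [mul_sub]
    have hnod : (List.ofFn fun i : Fin m => (i.castSucc.castSucc : Fin (m + 2))).Nodup :=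
      List.nodup_ofFn.2 fun i j hij => by simpa using hij
    have hdisj : Disjoint (List.ofFn fun i : Fin m => (i.castSucc.castSucc : Fin (m + 2))).toFinset
        ({(Fin.last m).castSucc} ∪ {Fin.last (m + 1)}) := by
      rw [Finset.disjoint_left]
      intro x hx hx'
      rw [List.mem_toFinset, List.mem_ofFn] at hx
      obtain ⟨i, rfl⟩ := hx
      simp only [Finset.mem_union, Finset.mem_singleton, Fin.ext_iff, Fin.val_castSucc,
        Fin.val_last] at hx'
      omega
    have := (IsCommProduct.of_nodup hnod).mul' (IsCommProduct.of_isLieMonomial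
      (.bracket (.of (Fin.last m).castSucc) (.of (Fin.last (m + 1))) (by simp))) hdisj
    rw [e]
    convert this
    symm
    rw [Finset.eq_univ_iff_forall]
    intro x
    simp only [Finset.mem_union, List.mem_toFinset, List.mem_ofFn, Finset.mem_singleton]
    rcases lt_or_ge x.1 m with hx | hx
    · exact Or.inl ⟨⟨x, hx⟩, by simp⟩
    · right
      simp only [Fin.ext_iff, Fin.val_castSucc, Fin.val_last]
      omega
  have key : ∀ r : ℝ, symNorm c ≤
      (∑ σ, |c σ - r * ((if σ = 1 then 1 else 0) - if σ = τ then 1 else 0)|) + |r| := by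
    intro r
    refine symNorm_le ?_
    have h1 := (pres_l1 fun σ => c σ - r * ((if σ = 1 then 1 else 0) - if σ = τ then 1 else 0)).add
      (Pres.smul_mem r (x := permPoly 1 - permPoly τ) hQ)
    convert h1 using 1
    simp only [symPoly, sub_smul, mul_sub, Finset.sum_sub_distrib]
    simp [ite_smul, smul_sub]
  have hsum : ∀ r : ℝ,
      ∑ σ, |c σ - r * ((if σ = 1 then 1 else 0) - if σ = τ then 1 else 0)| =
        l1Norm c + ((|c 1 - r| - |c 1|) + (|c τ + r| - |c τ|)) := by
    intro r
    have : ∀ σ, |c σ - r * ((if σ = 1 then 1 else 0) - if σ = τ then 1 else 0)| =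
        |c σ| + ((if σ = 1 then |c 1 - r| - |c 1| else 0) +
          if σ = τ then |c τ + r| - |c τ| else 0) := by
      intro σ
      by_cases h1 : σ = 1
      · subst h1; simp [hτ1.symm]
      · by_cases h2 : σ = τ
        · subst h2; simp [hτ1]
        · simp [h1, h2]
    rw [Finset.sum_congr rfl fun σ _ => this σ]
    simp [Finset.sum_add_distrib, l1Norm]
  rcases le_total |c 1| |c τ| with hle | hle
  · have h1 := key (c 1)
    rw [hsum] at h1
    rcases mul_neg_iff.1 h with ⟨hp, hn⟩ | ⟨hp, hn⟩
    · rw [abs_of_pos hp, abs_of_neg hn] at *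
      rw [abs_of_nonpos (by linarith : c τ + c 1 ≤ 0)] at h1
      simp only [sub_self, abs_zero] at h1; linarith
    · rw [abs_of_neg hp, abs_of_pos hn] at *
      rw [abs_of_nonneg (by linarith : 0 ≤ c τ + c 1)] at h1
      simp only [sub_self, abs_zero] at h1; linarith
  · have h1 := key (-c τ)
    rw [hsum, abs_neg] at h1
    rcases mul_neg_iff.1 h with ⟨hp, hn⟩ | ⟨hp, hn⟩
    · rw [abs_of_pos hp, abs_of_neg hn] at *
      rw [abs_of_nonneg (by linarith : 0 ≤ c 1 - -c τ)] at h1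
      simp only [add_neg_cancel, abs_zero] at h1; linarith
    · rw [abs_of_neg hp, abs_of_pos hn] at *
      rw [abs_of_nonpos (by linarith : c 1 - -c τ ≤ 0)] at h1
      simp only [add_neg_cancel, abs_zero] at h1; linarith

end

section

variable {α : Type*} [LinearOrder α]

lemma listWeight_append_singleton_congr (lam : ℝ) {l : List α} (hl : l ≠ []) {a b : α}
    (h : ∀ x ∈ l, stepWeight lam x a = stepWeight lam x b) :
    listWeight lam (l ++ [a]) = listWeight lam (l ++ [b]) := by
  induction l with
  | nil => exact absurd rfl hl
  | cons x l ih =>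
    cases l with
    | nil =>
      simp only [List.cons_append, List.nil_append, listWeight_cons_cons]
      rw [h x (by simp)]
      simp [listWeight]
    | cons y l =>
      simp only [List.cons_append, listWeight_cons_cons] at ih ⊢
      rw [ih (by simp) fun z hz => h z (List.mem_cons_of_mem _ hz)]

end

/-- Interchanging the last two entries of a sequence which are neighbours in the order of all
entries changes the number of ascents by one. -/
lemma listWeight_swap_neg {lam : ℝ} (hlam : lam ∈ Ioo (0 : ℝ) 1) {l : List ℝ} (hl : l ≠ [])
    {a b t : ℝ} (hab : a < b) (h : ∀ x ∈ l, x < a ∧ x < b ∨ a < x ∧ b < x)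
    (ht : t < a ∧ t < b ∨ a < t ∧ b < t) :
    listWeight lam (l ++ [a, b, t]) * listWeight lam (l ++ [b, a, t]) < 0 := by
  have h1 : listWeight lam (l ++ [a]) = listWeight lam (l ++ [b]) := by
    refine listWeight_append_singleton_congr lam hl fun x hx => ?_
    rcases h x hx with ⟨h1, h2⟩ | ⟨h1, h2⟩ <;> simp [stepWeight, h1, h2, h1.not_gt, h2.not_gt]
  have h2 : stepWeight lam a t = stepWeight lam b t := by
    rcases ht with ⟨h1, h2⟩ | ⟨h1, h2⟩ <;> simp [stepWeight, h1, h2, h1.not_gt, h2.not_gt]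
  have h3 : stepWeight lam b t ≠ 0 := by
    have h1 := hlam.1.ne'
    have h2 : lam - 1 ≠ 0 := (sub_neg.2 hlam.2).ne
    unfold stepWeight
    split_ifs <;> simp [h1, h2]
  have h4 : listWeight lam (l ++ [b]) ≠ 0 := listWeight_ne_zero hlam.1 hlam.2 _
  rw [listWeight_append lam l a, listWeight_append lam l b, listWeight_cons_cons,
    listWeight_cons_cons, listWeight_cons_cons, listWeight_cons_cons, h1, h2]
  have h5 : stepWeight lam a b = lam := if_pos hab
  have h6 : stepWeight lam b a = lam - 1 := by rw [stepWeight, if_neg hab.not_gt, if_pos hab]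
  have h7 : listWeight lam [t] = 1 := by simp [listWeight]
  rw [h5, h6, h7]
  have : 0 < (listWeight lam (l ++ [b]) * stepWeight lam b t) ^ 2 := by positivity
  have h8 : lam * (lam - 1) < 0 := mul_neg_of_pos_of_neg hlam.1 (sub_neg.2 hlam.2)
  nlinarith [mul_neg_of_pos_of_neg this h8]

lemma resolventWeight_swap_neg {m : ℕ} {lam : ℝ} (hlam : lam ∈ Ioo (0 : ℝ) 1) {t₀ t' : ℝ}
    {b : Fin (m + 2) → ℝ} (hb : StrictMono b)
    (h₀ : (∀ i, t₀ < b i) ∨ ∀ i, b i < t₀) (h' : (∀ i, t' < b i) ∨ ∀ i, b i < t') :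
    orbit (resolventWeight (m + 2) lam t₀ t') b 1 * orbit (resolventWeight (m + 2) lam t₀ t') b
      (Equiv.swap (Fin.last m).castSucc (Fin.last (m + 1))) < 0 := by
  have hlist : ∀ σ : Equiv.Perm (Fin (m + 2)), (∀ i : Fin m, σ i.castSucc.castSucc =
      i.castSucc.castSucc) → orbit (resolventWeight (m + 2) lam t₀ t') b σ =
        listWeight lam ((t₀ :: List.ofFn fun i : Fin m => b i.castSucc.castSucc) ++
          [b (σ (Fin.last m).castSucc), b (σ (Fin.last (m + 1))), t']) := by
    intro σ hσ
    rw [orbit, resolventWeight_eq, List.ofFn_succ', List.ofFn_succ']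
    simp [hσ]
  have hfix : ∀ i : Fin m, Equiv.swap (Fin.last m).castSucc (Fin.last (m + 1))
      i.castSucc.castSucc = i.castSucc.castSucc := fun i =>
    Equiv.swap_apply_of_ne_of_ne (by simp [Fin.ext_iff, i.2.ne]) (by simp [Fin.ext_iff]; omega)
  rw [hlist 1 fun _ => rfl, hlist _ hfix]
  simp only [Equiv.swap_apply_left, Equiv.swap_apply_right, Equiv.Perm.one_apply]
  refine listWeight_swap_neg hlam (by simp) (hb (Fin.castSucc_lt_last _)) ?_ ?_
  · intro x hx
    rw [List.mem_cons, List.mem_ofFn] at hx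
    rcases hx with rfl | ⟨i, rfl⟩
    · exact h₀.imp (fun h => ⟨h _, h _⟩) fun h => ⟨h _, h _⟩
    · exact Or.inl ⟨hb (Fin.lt_def.2 (by simp)), hb (Fin.lt_def.2 (by simp [Fin.val_last]; try omega))⟩
  · exact h'.imp (fun h => ⟨h _, h _⟩) fun h => ⟨h _, h _⟩

/-- Every interval contains a set of positive measure of increasing sequences. -/
lemma exists_box_strictMono (n : ℕ) (S : Set ℝ) (hS : S.Finite) :
    ∃ B : Set (Fin n → ℝ), cubeMeasure n B ≠ 0 ∧ ∀ b ∈ B, StrictMono b ∧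
      ∀ s ∈ S, (∀ i, s < b i) ∨ ∀ i, b i < s := by
  obtain ⟨x, hx⟩ := ((Ioo_infinite (zero_lt_one' ℝ)).sdiff hS).nonempty
  have hopen : IsOpen (Ioo (0 : ℝ) 1 \ S) := isOpen_Ioo.sdiff hS.isClosed
  obtain ⟨ε, hε, hball⟩ := Metric.isOpen_iff.1 hopen x hx
  rw [Real.ball_eq_Ioo] at hball
  have hδ : 0 < ε / (n + 1) := by positivity
  set δ := ε / (n + 1) with hδ'
  have hδn : (n + 1) * δ = ε := by rw [hδ']; field_simp
  let I : Fin n → Set ℝ := fun i => Ioo (x + i * δ) (x + (i + 1) * δ)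
  have hI : ∀ i, I i ⊆ Ioo (x - ε) (x + ε) := by
    intro i y hy
    have hi : ((i : ℕ) : ℝ) + 1 ≤ n := by exact_mod_cast i.2
    have h1 : ((i : ℕ) + 1) * δ ≤ n * δ := mul_le_mul_of_nonneg_right hi hδ.le
    have h2 : 0 ≤ ((i : ℕ) : ℝ) * δ := by positivity
    exact ⟨by linarith [hy.1], by linarith [hy.2]⟩
  refine ⟨Set.pi univ I, ?_, fun b hb => ⟨fun i j hij => ?_, fun s hs => ?_⟩⟩
  · rw [cubeMeasure, Measure.pi_pi, Finset.prod_ne_zero_iff]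
    intro i _
    rw [Measure.restrict_apply measurableSet_Ioo, inter_eq_left.2, Real.volume_Ioo]
    · rw [Ne, ENNReal.ofReal_eq_zero, not_le]; linarith
    · exact fun y hy => Ioo_subset_Icc_self (hball (hI i hy)).1
  · have hi := (hb i trivial).2
    have hj := (hb j trivial).1
    have : ((i : ℕ) : ℝ) + 1 ≤ (j : ℕ) := by exact_mod_cast hij
    have := mul_le_mul_of_nonneg_right this hδ.le
    linarith
  · have hs' : s ∉ Ioo (x - ε) (x + ε) := fun h => (hball h).2 hs
    rw [mem_Ioo, not_and_or, not_lt, not_lt] at hs'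
    rcases hs' with h | h
    · exact Or.inl fun i => h.trans_lt (hI i (hb i trivial)).1
    · exact Or.inr fun i => (hI i (hb i trivial)).2.trans_le h

lemma kernelLie₂_lt_kernel₂ {n : ℕ} (hn : 2 ≤ n) {lam : ℝ} (hlam : lam ∈ Ioo (0 : ℝ) 1)
    (t₀ t' : ℝ) : kernelLie₂ n lam t₀ t' < kernel₂ n lam t₀ t' := by
  obtain ⟨m, rfl⟩ : ∃ m, n = m + 2 := ⟨n - 2, by omega⟩
  obtain ⟨B, hB, hB'⟩ := exists_box_strictMono (m + 2) {t₀, t'} (by simp)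
  rw [kernelLie₂_eq, kernel₂_eq]
  refine mul_lt_mul_of_pos_left ?_ (by positivity)
  have hi := integrable_comp_orbit (n := m + 2) continuous_symNorm lam t₀ t'
  have hi' := integrable_comp_orbit (n := m + 2) continuous_l1Norm lam t₀ t'
  rw [← sub_pos, orbitAvg, orbitAvg, ← integral_sub hi' hi]
  refine (integral_pos_iff_support_of_nonneg (fun b => sub_nonneg.2 (symNorm_le_l1 _))
    (hi'.sub hi)).2 (pos_iff_ne_zero.2 ?_)
  refine fun h0 => hB (measure_mono_null (fun b hb => (sub_pos.2 ?_).ne') h0)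
  obtain ⟨hm, hs⟩ := hB' b hb
  exact symNorm_lt_l1Norm (resolventWeight_swap_neg hlam hm (hs _ (by simp)) (hs _ (by simp)))

/-! ### The maximum of the ratio of the kernels -/

/-- The ratio of the Lie kernel and the associative kernel. -/
def kernelRatio (n : ℕ) (lam t : ℝ) : ℝ := kernelLie n lam t / kernel n lam t

section

variable {n : ℕ} {lam : ℝ}

lemma kernel_pos (hlam : lam ∈ Ioo (0 : ℝ) 1) (t : ℝ) : 0 < kernel n lam t :=
  kernel₂_pos n hlam _ _

lemma kernelRatio_le_one (hlam : lam ∈ Ioo (0 : ℝ) 1) (t : ℝ) : kernelRatio n lam t ≤ 1 :=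
  (div_le_one (kernel_pos hlam t)).2 (kernelLie₂_le_kernel₂ _ _ _ _)

lemma kernelRatio_lt_one (hn : 2 ≤ n) (hlam : lam ∈ Ioo (0 : ℝ) 1) (t : ℝ) :
    kernelRatio n lam t < 1 :=
  (div_lt_one (kernel_pos hlam t)).2 (kernelLie₂_lt_kernel₂ hn hlam _ _)

lemma kernelRatio_pos (hlam : lam ∈ Ioo (0 : ℝ) 1) (t : ℝ) : 0 < kernelRatio n lam t := by
  refine div_pos ?_ (kernel_pos hlam t)
  have h1 : kernel n lam t ≤ 2 ^ n * kernelLie n lam t := kernel₂_le_kernelLie₂ n lam _ _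
  exact (mul_pos_iff_of_pos_left (by positivity)).1 ((kernel_pos hlam t).trans_le h1)

lemma continuousOn_kernelRatio (hn : 1 ≤ n) :
    ContinuousOn (fun p : ℝ × ℝ => kernelRatio n p.1 p.2) {p | p.1 ∈ Ioo (0 : ℝ) 1} :=
  ((continuousOn_kernelLie hn).mono fun _ hp => Ioo_subset_Icc_self hp).div
    ((continuousOn_kernel hn).mono fun _ hp => Ioo_subset_Icc_self hp)
    fun _ hp => (kernel_pos hp _).ne'

lemma isGreatest_ratioS (hn : 1 ≤ n) (hlam : lam ∈ Ioo (0 : ℝ) 1) :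
    IsGreatest (kernelRatio n lam '' Icc (-1) 1) (ratioS n lam) := by
  have hc : ContinuousOn (kernelRatio n lam) (Icc (-1) 1) :=
    (continuousOn_kernelRatio hn).comp (f := fun t => (lam, t)) (by fun_prop) fun t _ => hlam
  obtain ⟨t, ht⟩ := (isCompact_Icc.image_of_continuousOn hc).exists_isGreatest
    (nonempty_Icc.2 (by norm_num) |>.image _)
  have : ratioS n lam = t := by
    rw [ratioS, if_pos (show 0 < lam ∧ lam < 1 from hlam)]
    exact ht.csSup_eq
  rwa [this]

end

/-! ### The weight function -/

section

variable {lam : ℝ}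

lemma weight_of_notMem (h : lam ∉ Ioo (0 : ℝ) 1) : weight lam = 0 := if_neg h

/-- The function `x ↦ log ((1 + x) / (1 - x))`, whose difference quotient at `0` is the inverse of
the weight. -/
def logRatio (x : ℝ) : ℝ := Real.log (1 + x) - Real.log (1 - x)

lemma logRatio_zero : logRatio 0 = 0 := by simp [logRatio]

lemma hasDerivAt_logRatio_zero : HasDerivAt logRatio 2 0 := by
  have h1 : HasDerivAt (fun x : ℝ => Real.log (1 + x)) (1 / (1 + 0)) 0 :=
    ((hasDerivAt_id (0 : ℝ)).const_add 1).log (by norm_num)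
  have h2 : HasDerivAt (fun x : ℝ => Real.log (1 - x)) (-1 / (1 - 0)) 0 :=
    ((hasDerivAt_id (0 : ℝ)).const_sub 1).log (by norm_num)
  exact (h1.sub h2).congr_deriv (by norm_num)

lemma weight_eq_inv_dslope (h : lam ∈ Ioo (0 : ℝ) 1) :
    weight lam = (dslope logRatio 0 (1 - 2 * lam))⁻¹ := by
  rw [weight, if_pos (show 0 < lam ∧ lam < 1 from h)]
  split_ifs with h2
  · rw [h2]
    norm_num
    rw [hasDerivAt_logRatio_zero.deriv, one_div]
  · have hne : 1 - 2 * lam ≠ 0 := fun h => h2 (by linarith)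
    rw [dslope_of_ne _ hne, slope_def_field, logRatio_zero, sub_zero, sub_zero, logRatio,
      ← Real.log_div (by linarith [h.2]) (by linarith [h.1]), inv_div]
    congr 2
    rw [div_eq_div_iff h.1.ne' (by linarith [h.1])]
    ring

lemma continuousAt_dslope_logRatio {x : ℝ} (hx : x ∈ Ioo (-1 : ℝ) 1) :
    ContinuousAt (dslope logRatio 0) x := by
  rcases eq_or_ne x 0 with rfl | h
  · exact continuousAt_dslope_same.2 hasDerivAt_logRatio_zero.differentiableAt
  · rw [continuousAt_dslope_of_ne h]
    have h1 : 1 + x ≠ 0 := by linarith [hx.1]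
    have h2 : 1 - x ≠ 0 := by linarith [hx.2]
    unfold logRatio
    fun_prop (disch := assumption)

lemma weight_one_sub (lam : ℝ) : weight (1 - lam) = weight lam := by
  by_cases h : lam ∈ Ioo (0 : ℝ) 1
  · have h' : 1 - lam ∈ Ioo (0 : ℝ) 1 := ⟨by linarith [h.2], by linarith [h.1]⟩
    rw [weight, weight, if_pos (show 0 < lam ∧ lam < 1 from h),
      if_pos (show 0 < 1 - lam ∧ 1 - lam < 1 from h')]
    have : 1 - lam = 1 / 2 ↔ lam = 1 / 2 := ⟨fun h => by linarith, fun h => by linarith⟩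
    simp only [this]
    congr 1
    rw [sub_sub_cancel, ← inv_div (1 - lam) lam, Real.log_inv, div_neg, ← neg_div]
    ring
  · rw [weight_of_notMem h, weight_of_notMem]
    rintro ⟨h1, h2⟩
    exact h ⟨by linarith, by linarith⟩

/-- Partial sums of the power series of `artanh` bound the inverse of the weight from below. -/
lemma sum_le_dslope_logRatio {x : ℝ} (h0 : 0 ≤ x) (h1 : x < 1) (N : ℕ) :
    ∑ k ∈ Finset.range (N + 1), 2 * (1 / (2 * (k : ℝ) + 1)) * x ^ (2 * k) ≤
      dslope logRatio 0 x := by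
  rcases h0.eq_or_lt with rfl | h0
  · rw [dslope_same, hasDerivAt_logRatio_zero.deriv, Finset.sum_range_succ']
    simp
  · rw [dslope_of_ne _ h0.ne', slope_def_field, logRatio_zero, sub_zero, sub_zero,
      le_div_iff₀ h0, Finset.sum_mul]
    have hs := Real.hasSum_log_sub_log_of_abs_lt_one (x := x) (by rwa [abs_of_pos h0])
    refine le_trans (le_of_eq (Finset.sum_congr rfl fun k _ => ?_))
      (sum_le_hasSum (Finset.range (N + 1)) (fun k _ => by positivity) hs)
    rw [pow_succ, mul_assoc _ _ x]

lemma two_le_dslope_logRatio {x : ℝ} (h0 : 0 ≤ x) (h1 : x < 1) : 2 ≤ dslope logRatio 0 x := by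
  simpa using sum_le_dslope_logRatio h0 h1 0

lemma weight_pos_and_le (h : lam ∈ Ioo (0 : ℝ) 1) : 0 < weight lam ∧ weight lam ≤ 1 / 2 := by
  wlog hle : lam ≤ 1 / 2 generalizing lam
  · have := this (lam := 1 - lam) ⟨by linarith [h.2], by linarith [h.1]⟩ (by linarith)
    rwa [weight_one_sub] at this
  have h2 := two_le_dslope_logRatio (x := 1 - 2 * lam) (by linarith) (by linarith [h.1])
  rw [weight_eq_inv_dslope h, one_div]
  exact ⟨inv_pos.2 (by linarith), inv_anti₀ (by norm_num) h2⟩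

lemma weight_pos (h : lam ∈ Ioo (0 : ℝ) 1) : 0 < weight lam := (weight_pos_and_le h).1

lemma weight_le (lam : ℝ) : weight lam ≤ 1 / 2 := by
  by_cases h : lam ∈ Ioo (0 : ℝ) 1
  · exact (weight_pos_and_le h).2
  · rw [weight_of_notMem h]; norm_num

lemma weight_nonneg (lam : ℝ) : 0 ≤ weight lam := by
  by_cases h : lam ∈ Ioo (0 : ℝ) 1
  · exact (weight_pos h).le
  · rw [weight_of_notMem h]

lemma continuousOn_weight : ContinuousOn weight (Ioo 0 1) := by
  have : ContinuousOn (fun lam : ℝ => (dslope logRatio 0 (1 - 2 * lam))⁻¹) (Ioo 0 1) := by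
    intro lam h
    refine ContinuousAt.continuousWithinAt (ContinuousAt.inv₀ ?_ ?_)
    · exact ContinuousAt.comp (f := fun lam : ℝ => 1 - 2 * lam)
        (continuousAt_dslope_logRatio ⟨by linarith [h.2], by linarith [h.1]⟩) (by fun_prop)
    · intro h0
      have := weight_pos h
      rw [weight_eq_inv_dslope h, h0, inv_zero] at this
      exact this.false
  exact this.congr fun lam h => weight_eq_inv_dslope h

/-- The weight is small near the end points of the interval. -/
lemma exists_weight_lt {r : ℝ} (hr : 0 < r) : ∃ δ ∈ Ioo (0 : ℝ) (1 / 2),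
    ∀ lam, weight lam ≥ r → lam ∈ Icc δ (1 - δ) := by
  have key : ∃ δ ∈ Ioo (0 : ℝ) (1 / 2), ∀ lam ∈ Ioo (0 : ℝ) δ, weight lam < r := by
    have ht : Filter.Tendsto (fun lam : ℝ => Real.log ((1 - lam) / lam))
        (nhdsWithin 0 (Ioi 0)) Filter.atTop := by
      refine Real.tendsto_log_atTop.comp ?_
      have h1 : Filter.Tendsto (fun lam : ℝ => lam⁻¹ - 1) (nhdsWithin 0 (Ioi 0)) Filter.atTop :=
        Filter.tendsto_atTop_add_const_right _ _ tendsto_inv_nhdsGT_zero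
      refine h1.congr' ?_
      filter_upwards [self_mem_nhdsWithin] with x hx
      field_simp [(show (0 : ℝ) < x from hx).ne']
    have hev := (ht.eventually_gt_atTop (1 / r))
    obtain ⟨δ, hδ, hδ'⟩ := (mem_nhdsGT_iff_exists_Ioo_subset).1 hev
    refine ⟨min δ (1 / 4), ⟨lt_min hδ (by norm_num), (min_le_right _ _).trans_lt (by norm_num)⟩,
      fun lam hl => ?_⟩
    have hl1 : lam < δ := hl.2.trans_le (min_le_left _ _)
    have hl2 : lam < 1 / 4 := hl.2.trans_le (min_le_right _ _)
    have h3 : 1 / r < Real.log ((1 - lam) / lam) := hδ' ⟨hl.1, hl1⟩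
    have h4 : 0 < 1 / r := by positivity
    rw [weight, if_pos ⟨hl.1, by linarith⟩, if_neg (by linarith), div_lt_iff₀ (h4.trans h3)]
    have h5 : r * (1 / r) < r * Real.log ((1 - lam) / lam) := mul_lt_mul_of_pos_left h3 hr
    rw [mul_one_div_cancel hr.ne'] at h5
    linarith [hl.1]
  obtain ⟨δ, hδ, h⟩ := key
  refine ⟨δ, hδ, fun lam hw => ?_⟩
  have hmem : lam ∈ Ioo (0 : ℝ) 1 := by
    by_contra hn
    rw [weight_of_notMem hn] at hw
    linarith
  constructor
  · by_contra! hl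
    exact (h lam ⟨hmem.1, hl⟩).not_ge hw
  · by_contra! hl
    have := h (1 - lam) ⟨by linarith [hmem.2], by linarith⟩
    rw [weight_one_sub] at this
    exact this.not_ge hw

end

/-! ### The maximum of the rate -/

section

variable {n : ℕ} {lam : ℝ}

lemma resolventRate_of_notMem (h : lam ∉ Ioo (0 : ℝ) 1) : resolventRate n lam = 0 := by
  rw [resolventRate, weight_of_notMem h, zero_mul]

lemma weight_mul_le_resolventRate (hn : 1 ≤ n) (hlam : lam ∈ Ioo (0 : ℝ) 1) {t : ℝ}
    (ht : t ∈ Icc (-1 : ℝ) 1) :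
    weight lam * kernelRatio n lam t ^ (1 / ((n : ℝ) + 1)) ≤ resolventRate n lam :=
  mul_le_mul_of_nonneg_left (Real.rpow_le_rpow (kernelRatio_pos hlam t).le
    ((isGreatest_ratioS hn hlam).2 ⟨t, ht, rfl⟩) (by positivity)) (weight_nonneg lam)

lemma exists_resolventRate_eq (hn : 1 ≤ n) (hlam : lam ∈ Ioo (0 : ℝ) 1) :
    ∃ t ∈ Icc (-1 : ℝ) 1,
      resolventRate n lam = weight lam * kernelRatio n lam t ^ (1 / ((n : ℝ) + 1)) := by
  obtain ⟨t, ht, h⟩ := (isGreatest_ratioS hn hlam).1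
  exact ⟨t, ht, by rw [h, resolventRate]⟩

lemma resolventRate_pos (hn : 1 ≤ n) (hlam : lam ∈ Ioo (0 : ℝ) 1) : 0 < resolventRate n lam := by
  obtain ⟨t, -, h⟩ := exists_resolventRate_eq hn hlam
  rw [h]
  exact mul_pos (weight_pos hlam) (Real.rpow_pos_of_pos (kernelRatio_pos hlam t) _)

lemma resolventRate_le_weight (hn : 1 ≤ n) (hlam : lam ∈ Ioo (0 : ℝ) 1) :
    resolventRate n lam ≤ weight lam := by
  obtain ⟨t, -, h⟩ := exists_resolventRate_eq hn hlam
  rw [h]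
  exact mul_le_of_le_one_right (weight_nonneg lam)
    (Real.rpow_le_one (kernelRatio_pos hlam t).le (kernelRatio_le_one hlam t) (by positivity))

lemma exists_isGreatest_resolventRate (hn : 1 ≤ n) :
    ∃ lam ∈ Ioo (0 : ℝ) 1, IsGreatest (resolventRate n '' Icc 0 1) (resolventRate n lam) := by
  have hhalf : (1 / 2 : ℝ) ∈ Ioo (0 : ℝ) 1 := by norm_num
  obtain ⟨δ, hδ, hw⟩ := exists_weight_lt (resolventRate_pos hn hhalf)
  have hsub : Icc δ (1 - δ) ⊆ Ioo 0 1 := fun x hx => ⟨by linarith [hδ.1, hx.1],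
    by linarith [hδ.1, hx.2]⟩
  have hc : ContinuousOn (fun p : ℝ × ℝ => weight p.1 * kernelRatio n p.1 p.2 ^
      (1 / ((n : ℝ) + 1))) (Icc δ (1 - δ) ×ˢ Icc (-1) 1) := by
    refine ContinuousOn.mul ?_ ?_
    · exact continuousOn_weight.comp continuousOn_fst fun p hp => hsub hp.1
    · exact ((continuousOn_kernelRatio hn).mono fun p hp => hsub hp.1).rpow_const
        fun p hp => Or.inr (by positivity)
  obtain ⟨⟨lam, t⟩, ⟨hl, ht⟩, hmax⟩ := (isCompact_Icc.prod isCompact_Icc).exists_isMaxOn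
    ⟨((1 / 2 : ℝ), (0 : ℝ)), ⟨by linarith [hδ.2], by linarith [hδ.2]⟩, by norm_num, by norm_num⟩ hc
  refine ⟨lam, hsub hl, ⟨lam, Ioo_subset_Icc_self (hsub hl), rfl⟩, ?_⟩
  have hle : ∀ x ∈ Icc δ (1 - δ), resolventRate n x ≤ resolventRate n lam := by
    intro x hx
    obtain ⟨s, hs, h⟩ := exists_resolventRate_eq hn (hsub hx)
    rw [h]
    exact (hmax (show (x, s) ∈ _ from ⟨hx, hs⟩)).trans
      (weight_mul_le_resolventRate hn (hsub hl) ht)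
  rintro _ ⟨x, hx, rfl⟩
  by_cases hx' : x ∈ Icc δ (1 - δ)
  · exact hle x hx'
  · refine le_trans ?_ (hle (1 / 2) ⟨by linarith [hδ.2], by linarith [hδ.2]⟩)
    by_cases hx0 : x ∈ Ioo (0 : ℝ) 1
    · refine (resolventRate_le_weight hn hx0).trans ?_
      by_contra! h
      exact hx' (hw x h.le)
    · rw [resolventRate_of_notMem hx0]
      exact (resolventRate_pos hn hhalf).le

lemma resolventRate_lt_half (hn : 2 ≤ n) (hlam : lam ∈ Ioo (0 : ℝ) 1) :
    resolventRate n lam < 1 / 2 := by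
  obtain ⟨t, -, h⟩ := exists_resolventRate_eq (one_le_two.trans hn) hlam
  have h1 : kernelRatio n lam t ^ (1 / ((n : ℝ) + 1)) < 1 :=
    Real.rpow_lt_one (kernelRatio_pos hlam t).le (kernelRatio_lt_one hn hlam t) (by positivity)
  rw [h]
  exact (mul_lt_of_lt_one_right (weight_pos hlam) h1).trans_le (weight_le lam)

/-- A bound of the rate is a bound of the kernels. -/
lemma lt_one_div_resolventRate (hn : 1 ≤ n) (hlam : lam ∈ Ioo (0 : ℝ) 1) {a : ℝ} (ha : 0 < a)
    (h : ∀ t ∈ Icc (-1 : ℝ) 1,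
      kernelLie n lam t * (a * weight lam) ^ (n + 1) < kernel n lam t) :
    a < 1 / resolventRate n lam := by
  obtain ⟨t, ht, he⟩ := exists_resolventRate_eq hn hlam
  have hw := weight_pos hlam
  have hr := kernelRatio_pos (n := n) hlam t
  rw [lt_one_div ha (resolventRate_pos hn hlam), lt_div_iff₀ ha, he]
  have h1 : (weight lam * kernelRatio n lam t ^ (1 / ((n : ℝ) + 1)) * a) ^ (n + 1) < 1 := by
    have e : (kernelRatio n lam t ^ (1 / ((n : ℝ) + 1))) ^ (n + 1) = kernelRatio n lam t := by
      rw [← Real.rpow_natCast, ← Real.rpow_mul hr.le]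
      push_cast
      rw [one_div_mul_cancel (by positivity), Real.rpow_one]
    have h2 := h t ht
    rw [mul_right_comm, mul_pow, e, kernelRatio, mul_div_assoc', div_lt_one (kernel_pos hlam t)]
    rwa [mul_comm, mul_comm (weight lam)]
  by_contra! hge
  exact h1.not_ge (one_le_pow₀ hge)

end

/-! ### Coefficients of words -/

section

variable {n : ℕ}

/-- The coefficient of the word with letters `l`. -/
def wordCoeff (l : List (Fin n)) : NCPoly n →ₗ[ℝ] ℝ where
  toFun x := x.coeff (FreeMonoid.ofList l)
  map_add' _ _ := rfl
  map_smul' _ _ := rfl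

lemma wordCoeff_wordOf (l l' : List (Fin n)) :
    wordCoeff l' (wordOf l) = if l = l' then 1 else 0 := coeff_wordOf l l'

lemma wordCoeff_one (l : List (Fin n)) : wordCoeff l 1 = if l = [] then 1 else 0 := by
  rw [← wordOf_nil, wordCoeff_wordOf]
  exact if_congr eq_comm rfl rfl

lemma ncPoly_induction {motive : NCPoly n → Prop} (x : NCPoly n) (zero : motive 0)
    (add : ∀ x y, motive x → motive y → motive (x + y))
    (smul : ∀ (r : ℝ) x, motive x → motive (r • x)) (word : ∀ l, motive (wordOf l)) : motive x := by
  induction x using MonoidAlgebra.induction_linear with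
  | zero => exact zero
  | add x y hx hy => exact add x y hx hy
  | single w r =>
    have : MonoidAlgebra.single w r = r • wordOf (n := n) (FreeMonoid.toList w) := by
      simp [wordOf]
    rw [this]
    exact smul _ _ (word _)

/-- The coefficients of a product, in terms of the ways to cut a word in two. -/
lemma wordCoeff_mul (x y : NCPoly n) (l : List (Fin n)) :
    wordCoeff l (x * y) =
      ∑ i ∈ Finset.range (l.length + 1), wordCoeff (l.take i) x * wordCoeff (l.drop i) y := by
  induction x using ncPoly_induction with
  | zero => simp
  | add x x' hx hx' => simp [add_mul, hx, hx', Finset.sum_add_distrib]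
  | smul r x hx => simp [hx, Finset.mul_sum, mul_assoc]
  | word u =>
    induction y using ncPoly_induction with
    | zero => simp
    | add x x' hx hx' => simp [mul_add, hx, hx', Finset.sum_add_distrib]
    | smul r x hx => simp [hx, Finset.mul_sum, mul_left_comm]
    | word v =>
      rw [← wordOf_append]
      simp only [wordCoeff_wordOf]
      by_cases h : u ++ v = l
      · subst h
        rw [Finset.sum_eq_single u.length]
        · simp
        · intro i _ hi
          rw [if_neg, zero_mul]
          intro hu
          have := congrArg List.length hu
          rw [List.length_take] at this
          rename_i hmem
          rw [Finset.mem_range, List.length_append] at hmem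
          rw [List.length_append] at this
          omega
        · intro hmem
          rw [Finset.mem_range, List.length_append] at hmem
          omega
      · rw [if_neg h]
        refine (Finset.sum_eq_zero fun i _ => ?_).symm
        by_cases h1 : u = l.take i
        · rw [if_neg (c := v = l.drop i), mul_zero]
          rintro rfl
          exact h (by rw [h1, List.take_append_drop])
        · rw [if_neg h1, zero_mul]

lemma wordCoeff_cons_mul (x y : NCPoly n) (a : Fin n) (l : List (Fin n)) :
    wordCoeff (a :: l) (x * y) = ∑ i ∈ Finset.range (l.length + 1),
      wordCoeff (a :: l.take i) x * wordCoeff (l.drop i) y +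
        wordCoeff [] x * wordCoeff (a :: l) y := by
  rw [wordCoeff_mul, List.length_cons, Finset.sum_range_succ']
  rfl

lemma wordCoeff_gen_mul_nil (i : Fin n) (x : NCPoly n) : wordCoeff [] (gen i * x) = 0 := by
  rw [wordCoeff_mul, ← wordOf_singleton]
  simp [wordCoeff_wordOf]

lemma wordCoeff_gen_mul_cons (i a : Fin n) (l : List (Fin n)) (x : NCPoly n) :
    wordCoeff (a :: l) (gen i * x) = if i = a then wordCoeff l x else 0 := by
  rw [wordCoeff_mul, ← wordOf_singleton, Finset.sum_eq_single 1]
  · simp [wordCoeff_wordOf]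
  · intro j hj hj1
    rw [wordCoeff_wordOf, if_neg, zero_mul]
    intro h
    have := congrArg List.length h
    simp only [List.length_nil, List.length_take, List.length_cons] at this
    rw [Finset.mem_range, List.length_cons] at hj
    omega
  · intro h; simp at h

/-- The words occurring in `x` have length at least `d`. -/
def OrderGE (d : ℕ) (x : NCPoly n) : Prop := ∀ l : List (Fin n), l.length < d → wordCoeff l x = 0

lemma OrderGE.add {d : ℕ} {x y : NCPoly n} (hx : OrderGE d x) (hy : OrderGE d y) :
    OrderGE d (x + y) := fun l hl => by rw [map_add, hx l hl, hy l hl, add_zero]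

lemma OrderGE.mul {d e : ℕ} {x y : NCPoly n} (hx : OrderGE d x) (hy : OrderGE e y) :
    OrderGE (d + e) (x * y) := by
  intro l hl
  rw [wordCoeff_mul]
  refine Finset.sum_eq_zero fun i hi => ?_
  rw [Finset.mem_range] at hi
  by_cases h : (l.take i).length < d
  · rw [hx _ h, zero_mul]
  · rw [hy _, mul_zero]
    rw [List.length_take] at h
    rw [List.length_drop]
    omega

lemma orderGE_zero (x : NCPoly n) : OrderGE 0 x := fun _ h => absurd h (Nat.not_lt_zero _)

lemma OrderGE.pow {x : NCPoly n} (hx : OrderGE 1 x) : ∀ j, OrderGE j (x ^ j)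
  | 0 => orderGE_zero _
  | j + 1 => by rw [pow_succ]; exact (hx.pow j).mul hx

lemma orderGE_gen (i : Fin n) : OrderGE 1 (gen i) := by
  intro l hl
  rw [← wordOf_singleton, wordCoeff_wordOf, if_neg]
  rintro rfl
  simp at hl

/-- A product of factors without constant term, apart from `1`, has constant term `1`. -/
lemma orderGE_prod_sub_one {L : List (NCPoly n)} (h : ∀ x ∈ L, OrderGE 1 (x - 1)) :
    OrderGE 1 (L.prod - 1) := by
  induction L with
  | nil => intro l _; simp
  | cons a L ih =>
    have e : (a :: L).prod - 1 = (a - 1) * L.prod + (L.prod - 1) := by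
      rw [List.prod_cons]; noncomm_ring
    rw [e]
    refine OrderGE.add ?_ (ih fun x hx => h x (List.mem_cons_of_mem _ hx))
    exact (h a (by simp)).mul (orderGE_zero _)

/-! ### Calculation modulo words with repeated letters -/

/-- Two noncommutative polynomials are congruent if they have the same coefficients at the words
without repeated letters. -/
def nodupCon (n : ℕ) : RingCon (NCPoly n) where
  r x y := ∀ l : List (Fin n), l.Nodup → wordCoeff l x = wordCoeff l y
  iseqv := ⟨fun _ _ _ => rfl, fun h l hl => (h l hl).symm, fun h h' l hl => (h l hl).trans (h' l hl)⟩
  add' h h' l hl := by rw [map_add, map_add, h l hl, h' l hl]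
  mul' h h' l hl := by
    rw [wordCoeff_mul, wordCoeff_mul]
    refine Finset.sum_congr rfl fun i _ => ?_
    rw [h _ (hl.sublist (List.take_sublist _ _)), h' _ (hl.sublist (List.drop_sublist _ _))]

/-- The algebra of noncommutative polynomials modulo words with repeated letters. -/
abbrev NodupAlg (n : ℕ) : Type := (nodupCon n).Quotient

/-- The projection to the algebra of noncommutative polynomials modulo words with repeated
letters. -/
abbrev toNodup (n : ℕ) : NCPoly n →ₐ[ℝ] NodupAlg n := (nodupCon n).mkₐ ℝ

lemma toNodup_eq_iff {x y : NCPoly n} :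
    toNodup n x = toNodup n y ↔ ∀ l : List (Fin n), l.Nodup → wordCoeff l x = wordCoeff l y :=
  RingCon.eq _

lemma toNodup_surjective (n : ℕ) : Function.Surjective (toNodup n) :=
  RingCon.mkₐ_surjective _

lemma toNodup_eq_zero_of_orderGE {x : NCPoly n} (hx : OrderGE (n + 1) x) : toNodup n x = 0 := by
  rw [← map_zero (toNodup n), toNodup_eq_iff]
  intro l hl
  rw [map_zero]
  refine hx l ?_
  have := hl.length_le_card
  rw [Fintype.card_fin] at this
  omega

lemma toNodup_wordOf_eq_zero {l : List (Fin n)} (h : ¬ l.Nodup) : toNodup n (wordOf l) = 0 := by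
  rw [← map_zero (toNodup n), toNodup_eq_iff]
  intro l' hl'
  rw [map_zero, wordCoeff_wordOf, if_neg]
  rintro rfl
  exact h hl'

lemma toNodup_gen_mul_gen (i : Fin n) (b : NodupAlg n) :
    toNodup n (gen i) * b * toNodup n (gen i) = 0 := by
  obtain ⟨x, rfl⟩ := toNodup_surjective n b
  rw [← map_mul, ← map_mul]
  induction x using ncPoly_induction with
  | zero => simp
  | add x y hx hy => rw [mul_add, add_mul, map_add, hx, hy, add_zero]
  | smul r x hx => rw [mul_smul_comm, smul_mul_assoc, map_smul, hx, smul_zero]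
  | word l =>
    rw [← wordOf_singleton, ← wordOf_append, ← wordOf_append]
    refine toNodup_wordOf_eq_zero fun h => ?_
    simp [List.nodup_append] at h

lemma toNodup_expTrunc {k : ℕ} (hk : 1 ≤ k) (i : Fin n) :
    toNodup n (expTrunc k (gen i)) = toNodup n (1 + gen i) := by
  obtain ⟨k, rfl⟩ : ∃ m, k = m + 1 := ⟨k - 1, by omega⟩
  rw [expTrunc, Finset.sum_range_succ', Finset.sum_range_succ', map_add, map_add, map_sum]
  rw [Finset.sum_eq_zero]
  · simp [add_comm]
  · intro j _
    have : toNodup n (gen i ^ (j + 1 + 1)) = 0 := by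
      have h := toNodup_gen_mul_gen i (toNodup n (gen i ^ j))
      rw [← map_mul, ← map_mul, ← pow_succ', ← pow_succ] at h
      exact h
    rw [map_smul, this, smul_zero]

/-- The product `(1 + Y_{i_1}) ⋯ (1 + Y_{i_r})`, congruent to a product of exponentials. -/
def onePlusProd (L : List (Fin n)) : NCPoly n := (L.map fun i => 1 + gen i).prod

lemma map_logTrunc {R : Type*} [Ring R] [Algebra ℝ R] (f : NCPoly n →ₐ[ℝ] R) (k : ℕ)
    (y : NCPoly n) : f (logTrunc k y) =
      ∑ j ∈ Finset.range k, ((-1 : ℝ) ^ j / ((j : ℝ) + 1)) • (f y - 1) ^ (j + 1) := by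
  simp [logTrunc, map_sum]

lemma toNodup_logProdExp {k : ℕ} (hk : 1 ≤ k) :
    toNodup k (logProdExp k) = toNodup k (logTrunc k (onePlusProd (List.finRange k))) := by
  rw [logProdExp, map_logTrunc, map_logTrunc]
  congr! 3
  congr 1
  rw [onePlusProd, map_list_prod, map_list_prod, List.ofFn_eq_map, List.map_map, List.map_map]
  congr 1
  exact List.map_congr_left fun i _ => toNodup_expTrunc hk i

lemma wordCoeff_onePlusProd {L : List (Fin n)} (hL : L.Nodup) (l : List (Fin n)) :
    wordCoeff l (onePlusProd L) = if l.Sublist L then 1 else 0 := by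
  classical
  induction L generalizing l with
  | nil => simp [onePlusProd, wordCoeff_one]
  | cons a L ih =>
    rw [List.nodup_cons] at hL
    have e : onePlusProd (a :: L) = onePlusProd L + gen a * onePlusProd L := by
      simp [onePlusProd, add_mul]
    rw [e, map_add, ih hL.2]
    cases l with
    | nil => simp [wordCoeff_gen_mul_nil]
    | cons b l =>
      rw [wordCoeff_gen_mul_cons, ih hL.2]
      by_cases hab : a = b
      · subst hab
        have h1 : ¬ (a :: l).Sublist L := fun h => hL.1 (h.subset (by simp))
        simp [h1, List.cons_sublist_cons]
      · have : (b :: l).Sublist (a :: L) ↔ (b :: l).Sublist L := by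
          rw [List.sublist_cons_iff]
          constructor
          · rintro (h | ⟨r, h, -⟩)
            · exact h
            · exact absurd (List.cons.inj h).1.symm hab
          · exact Or.inl
        simp [this, hab]

lemma sublist_finRange_iff {l : List (Fin n)} :
    l.Sublist (List.finRange n) ↔ l.Pairwise (· < ·) := by
  constructor
  · intro h
    exact (List.pairwise_lt_finRange n).sublist h
  · intro h
    have hp : (List.finRange n).Pairwise (· < ·) := List.pairwise_lt_finRange n
    refine List.sublist_of_subperm_of_pairwise (r := fun a b => a ≤ b) ?_ (h.imp fun h => h.le)
      (hp.imp fun h => h.le)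
    exact List.Nodup.subperm (h.imp fun h => h.ne) fun i _ => List.mem_finRange i

/-! ### The coefficients of the Magnus commutators -/

/-- The product of exponentials, without the constant term. -/
def expProdTail (k : ℕ) : NCPoly k := onePlusProd (List.finRange k) - 1

lemma wordCoeff_expProdTail {k : ℕ} (l : List (Fin k)) :
    wordCoeff l (expProdTail k) = if l ≠ [] ∧ l.Pairwise (· < ·) then 1 else 0 := by
  classical
  rw [expProdTail, map_sub, wordCoeff_onePlusProd (List.nodup_finRange k), wordCoeff_one]
  simp only [sublist_finRange_iff]
  by_cases h : l = []
  · subst h; simp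
  · simp [h]

lemma wordCoeff_expProdTail_mul_singleton {k : ℕ} (x : NCPoly k) (a : Fin k) :
    wordCoeff [a] (expProdTail k * x) = wordCoeff [] x := by
  simp [wordCoeff_mul, Finset.sum_range_succ, wordCoeff_expProdTail]

lemma wordCoeff_expProdTail_mul {k : ℕ} (x : NCPoly k) (a b : Fin k) (l : List (Fin k)) :
    wordCoeff (a :: b :: l) (expProdTail k * x) =
      wordCoeff (b :: l) x + if a < b then wordCoeff (b :: l) (expProdTail k * x) else 0 := by
  have h0 : wordCoeff [] (expProdTail k) = 0 := by simp [wordCoeff_expProdTail]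
  have h1 : wordCoeff [a] (expProdTail k) = 1 := by simp [wordCoeff_expProdTail]
  rw [wordCoeff_cons_mul, wordCoeff_cons_mul, List.length_cons, Finset.sum_range_succ']
  simp only [List.take_zero, h0, h1, zero_mul, one_mul, add_zero, List.drop_zero,
    List.take_succ_cons, List.drop_succ_cons]
  rw [add_comm]
  congr 1
  by_cases hab : a < b
  · rw [if_pos hab]
    refine Finset.sum_congr rfl fun i _ => ?_
    congr 1
    rw [wordCoeff_expProdTail, wordCoeff_expProdTail]
    refine if_congr ?_ rfl rfl
    simp only [ne_eq, reduceCtorEq, not_false_eq_true, true_and]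
    constructor
    · exact fun h => (List.pairwise_cons.1 h).2
    · refine fun h => List.pairwise_cons.2 ⟨fun c hc => ?_, h⟩
      rcases List.mem_cons.1 hc with rfl | hc
      · exact hab
      · exact hab.trans ((List.pairwise_cons.1 h).1 c hc)
  · rw [if_neg hab]
    refine Finset.sum_eq_zero fun i _ => ?_
    rw [wordCoeff_expProdTail, if_neg, zero_mul]
    exact fun h => hab ((List.pairwise_cons.1 h.2).1 b (by simp))

/-- The generating function of the coefficients of the powers of `exp Y_0 ⋯ exp Y_{k-1} - 1` at a
word counts ascents and descents. -/
lemma sum_wordCoeff_pow_mul {k : ℕ} (z : ℝ) {l : List (Fin k)} (hl : l ≠ []) (hn : l.Nodup)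
    {N : ℕ} (hN : l.length ≤ N) :
    ∑ j ∈ Finset.range N, wordCoeff l (expProdTail k ^ (j + 1)) * z ^ j =
      listWeight (z + 1) l := by
  induction l generalizing N with
  | nil => exact absurd rfl hl
  | cons a l ih =>
    obtain ⟨N, rfl⟩ : ∃ m, N = m + 1 := ⟨N - 1, by rw [List.length_cons] at hN; omega⟩
    cases l with
    | nil =>
      rw [Finset.sum_range_succ', Finset.sum_eq_zero]
      · simp [wordCoeff_expProdTail, listWeight]
      · intro j _
        rw [pow_succ', wordCoeff_expProdTail_mul_singleton,
          (show OrderGE 1 (expProdTail k) from fun l hl => by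
            rw [List.length_eq_zero_iff.1 (Nat.lt_one_iff.1 hl)]
            simp [wordCoeff_expProdTail]).pow (j + 1) [] (by simp), zero_mul]
    | cons b l =>
      have hnb : (b :: l).Nodup := (List.nodup_cons.1 hn).2
      have hab : a ≠ b := fun h => (List.nodup_cons.1 hn).1 (by simp [h])
      rw [List.length_cons] at hN
      have e1 : ∑ j ∈ Finset.range (N + 1), wordCoeff (b :: l) (expProdTail k ^ j) * z ^ j =
          z * listWeight (z + 1) (b :: l) := by
        rw [Finset.sum_range_succ', pow_zero, wordCoeff_one, if_neg (by simp), zero_mul, add_zero,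
          ← ih (by simp) hnb (N := N) (by omega), Finset.mul_sum]
        exact Finset.sum_congr rfl fun j _ => by ring
      have e2 := ih (by simp) hnb (N := N + 1) (by omega)
      have e3 : ∀ j, wordCoeff (a :: b :: l) (expProdTail k ^ (j + 1)) * z ^ j =
          wordCoeff (b :: l) (expProdTail k ^ j) * z ^ j +
            if a < b then wordCoeff (b :: l) (expProdTail k ^ (j + 1)) * z ^ j else 0 := by
        intro j
        rw [pow_succ', wordCoeff_expProdTail_mul, add_mul, ite_mul, zero_mul]
      simp only [e3]
      rw [Finset.sum_add_distrib, e1, listWeight_cons_cons, stepWeight]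
      rcases hab.lt_or_gt with h | h
      · simp only [h, if_true]
        rw [e2]; ring
      · simp only [h.not_gt, h, if_true, if_false]
        simp

/-- The coefficient of a word with distinct letters in `log (exp Y_0 ⋯ exp Y_{k-1})`. -/
lemma wordCoeff_logProdExp {k : ℕ} {l : List (Fin k)} (hl : l ≠ []) (hn : l.Nodup) :
    wordCoeff l (logProdExp k) = ∫ lam in (0 : ℝ)..1, listWeight lam l := by
  have hk : 1 ≤ k := by
    have := hn.length_le_card
    rw [Fintype.card_fin] at this
    have := List.length_pos_of_ne_nil hl
    omega
  have hlen : l.length ≤ k := by simpa using hn.length_le_card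
  rw [toNodup_eq_iff.1 (toNodup_logProdExp hk) l hn]
  have e1 : ∀ lam : ℝ, listWeight lam l =
      ∑ j ∈ Finset.range k, wordCoeff l (expProdTail k ^ (j + 1)) * (lam - 1) ^ j := fun lam => by
    rw [sum_wordCoeff_pow_mul _ hl hn hlen, sub_add_cancel]
  simp only [e1]
  rw [intervalIntegral.integral_finsetSum, logTrunc, map_sum]
  · refine Finset.sum_congr rfl fun j _ => ?_
    rw [intervalIntegral.integral_const_mul, map_smul, smul_eq_mul, mul_comm]
    congr 1
    rw [intervalIntegral.integral_comp_sub_right (fun x => x ^ j) 1, integral_pow]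
    rw [sub_self, zero_sub, zero_pow (by omega), pow_succ]
    ring
  · intro j _
    exact (by fun_prop : Continuous fun lam : ℝ =>
      wordCoeff l (expProdTail k ^ (j + 1)) * (lam - 1) ^ j).intervalIntegrable _ _

/-- The Magnus commutator is the integral of the resolvent polynomials. -/
lemma magnus_eq_symPoly {k : ℕ} (hk : 1 ≤ k) :
    magnus k = symPoly fun σ => ∫ lam in (0 : ℝ)..1, listWeight lam (List.ofFn σ) := by
  rw [magnus, symPoly]
  refine Finset.sum_congr rfl fun σ _ => ?_
  rw [single_permWord]
  congr 1
  refine wordCoeff_logProdExp ?_ (ofFn_perm_nodup σ)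
  intro h
  have := congrArg List.length h
  rw [List.length_ofFn, List.length_nil] at this
  omega

end

/-! ### Powers and the logarithm -/

section

open Polynomial

/-- The binomial coefficient `x choose j` as a polynomial in `x`. -/
def binomPoly (j : ℕ) : ℝ[X] := C ((j.factorial : ℝ)⁻¹) * descPochhammer ℝ j

lemma binomPoly_eval (j N : ℕ) : (binomPoly j).eval (N : ℝ) = N.choose j := by
  rw [binomPoly, eval_mul, eval_C, descPochhammer_eval_eq_descFactorial,
    Nat.descFactorial_eq_factorial_mul_choose, Nat.cast_mul, inv_mul_cancel_left₀]
  exact_mod_cast j.factorial_ne_zero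

lemma binomPoly_coeff_zero (j : ℕ) : (binomPoly j).coeff 0 = if j = 0 then 1 else 0 := by
  have := binomPoly_eval j 0
  rw [Nat.cast_zero, ← coeff_zero_eq_eval_zero] at this
  rw [this]
  cases j <;> simp

lemma descPochhammer_eval_neg_one (j : ℕ) :
    (descPochhammer ℝ j).eval (-1) = (-1) ^ j * j.factorial := by
  induction j with
  | zero => simp
  | succ j ih =>
    rw [descPochhammer_succ_right, eval_mul, ih, Nat.factorial_succ]
    simp only [eval_sub, eval_X, eval_natCast]
    push_cast
    ring

lemma binomPoly_coeff_one_zero : (binomPoly 0).coeff 1 = 0 := by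
  simp [binomPoly, coeff_one]

lemma binomPoly_coeff_one_succ (j : ℕ) :
    (binomPoly (j + 1)).coeff 1 = (-1) ^ j / ((j : ℝ) + 1) := by
  rw [binomPoly, coeff_C_mul, descPochhammer_succ_left, coeff_X_mul, coeff_zero_eq_eval_zero,
    eval_comp]
  simp only [eval_sub, eval_X, eval_one, zero_sub]
  rw [descPochhammer_eval_neg_one, Nat.factorial_succ]
  have : (j.factorial : ℝ) ≠ 0 := by exact_mod_cast j.factorial_ne_zero
  push_cast
  field_simp

variable {B : Type*} [Ring B] [Algebra ℝ B]

/-- The polynomial which takes the values `∑_j (N choose j) b_j` at natural numbers `N`. -/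
def newtonPoly (b : ℕ → B) (K : ℕ) : B[X] :=
  ∑ j ∈ Finset.range K, C (b j) * (binomPoly j).map (algebraMap ℝ B)

lemma newtonPoly_eval (b : ℕ → B) (K N : ℕ) : (newtonPoly b K).eval (N : B) =
    ∑ j ∈ Finset.range K, (N.choose j : ℝ) • b j := by
  rw [newtonPoly, eval_finsetSum]
  refine Finset.sum_congr rfl fun j _ => ?_
  rw [eval_C_mul, eval_natCast_map, binomPoly_eval, ← Algebra.commutes, ← Algebra.smul_def]

lemma newtonPoly_coeff (b : ℕ → B) (K i : ℕ) : (newtonPoly b K).coeff i =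
    ∑ j ∈ Finset.range K, (binomPoly j).coeff i • b j := by
  rw [newtonPoly, finsetSum_coeff]
  refine Finset.sum_congr rfl fun j _ => ?_
  rw [coeff_C_mul, coeff_map, ← Algebra.commutes, ← Algebra.smul_def]

lemma newtonPoly_coeff_one (b : ℕ → B) (K : ℕ) : (newtonPoly b (K + 1)).coeff 1 =
    ∑ j ∈ Finset.range K, ((-1 : ℝ) ^ j / ((j : ℝ) + 1)) • b (j + 1) := by
  rw [newtonPoly_coeff, Finset.sum_range_succ', binomPoly_coeff_one_zero, zero_smul, add_zero]
  simp only [binomPoly_coeff_one_succ]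

/-- A polynomial over a real algebra which vanishes at all natural numbers is zero. -/
lemma polynomial_eq_of_eval_natCast {p q : B[X]} (h : ∀ N : ℕ, p.eval (N : B) = q.eval (N : B)) :
    p = q := by
  rw [← sub_eq_zero]
  set r := p - q with hr
  have hr0 : ∀ N : ℕ, r.eval (N : B) = 0 := fun N => by rw [hr, eval_sub, h, sub_self]
  ext i
  rw [coeff_zero]
  refine (Module.forall_dual_apply_eq_zero_iff ℝ _).1 fun φ => ?_
  let s : ℝ[X] := ∑ i ∈ Finset.range (r.natDegree + 1), monomial i (φ (r.coeff i))
  have hs : s = 0 := by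
    refine Polynomial.eq_zero_of_infinite_isRoot _ (Set.infinite_of_injective_forall_mem
      (f := fun N : ℕ => (N : ℝ)) Nat.cast_injective fun N => ?_)
    have h1 := congrArg φ (hr0 N)
    rw [eval_eq_sum_range, map_sum, map_zero] at h1
    simp only [s, Set.mem_ofPred_eq, IsRoot.def, eval_finsetSum, eval_monomial]
    refine Eq.trans (Finset.sum_congr rfl fun i _ => ?_) h1
    have : r.coeff i * (N : B) ^ i = ((N : ℝ) ^ i) • r.coeff i := by
      rw [Algebra.smul_def, Algebra.commutes]; simp
    rw [this, map_smul, smul_eq_mul, mul_comm]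
  have h2 := congrArg (fun t => t.coeff i) hs
  simp only [s, finsetSum_coeff, coeff_monomial, coeff_zero] at h2
  rw [Finset.sum_ite_eq'] at h2
  by_cases hi : i < r.natDegree + 1
  · simpa [hi] using h2
  · rw [coeff_eq_zero_of_natDegree_lt (by omega), map_zero]

lemma end_pow_apply_eq_sum_choose {V : Type*} [AddCommGroup V] [Module ℝ V] (T : Module.End ℝ V)
    (x : V) {K : ℕ} (h : ∀ j ≥ K, ((T - 1) ^ j) x = 0) (N : ℕ) :
    (T ^ N) x = ∑ j ∈ Finset.range K, (N.choose j : ℝ) • ((T - 1) ^ j) x := by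
  have h1 : (T ^ N) x = ∑ j ∈ Finset.range (N + 1), (N.choose j : ℝ) • ((T - 1) ^ j) x := by
    conv_lhs => rw [← sub_add_cancel T 1, (Commute.one_right (T - 1)).add_pow]
    rw [LinearMap.sum_apply]
    refine Finset.sum_congr rfl fun j _ => ?_
    rw [one_pow, mul_one, ← Nat.cast_comm, ← nsmul_eq_mul, LinearMap.smul_apply,
      Nat.cast_smul_eq_nsmul]
  rw [h1]
  rcases le_total K (N + 1) with hK | hK
  · refine (Finset.sum_subset (Finset.range_subset_range.2 hK) fun j _ hj => ?_).symm
    rw [h j (by simpa using hj), smul_zero]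
  · refine Finset.sum_subset (Finset.range_subset_range.2 hK) fun j _ hj => ?_
    rw [Nat.choose_eq_zero_of_lt (by simpa using hj), Nat.cast_zero, zero_smul]

lemma pow_eq_newtonPoly_eval {g : B} {K : ℕ} (h : (g - 1) ^ K = 0) (N : ℕ) :
    g ^ N = (newtonPoly (fun j => (g - 1) ^ j) K).eval (N : B) := by
  have e : ∀ j, ((LinearMap.mulLeft ℝ g - 1) ^ j) 1 = (g - 1) ^ j := fun j => by
    have : LinearMap.mulLeft ℝ g - 1 = LinearMap.mulLeft ℝ (g - 1) := by ext; simp [sub_mul]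
    rw [this, LinearMap.pow_mulLeft, LinearMap.mulLeft_apply, mul_one]
  have := end_pow_apply_eq_sum_choose (LinearMap.mulLeft ℝ g) 1 (K := K) (fun j hj => by
    rw [e, ← Nat.sub_add_cancel hj, pow_add, h, mul_zero]) N
  rw [LinearMap.pow_mulLeft, LinearMap.mulLeft_apply, mul_one] at this
  rw [this, newtonPoly_eval]
  simp only [e]

/-- The logarithm series truncated after degree `K`. -/
def logSeries (K : ℕ) (g : B) : B :=
  ∑ j ∈ Finset.range K, ((-1 : ℝ) ^ j / ((j : ℝ) + 1)) • (g - 1) ^ (j + 1)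

lemma sum_range_choose_eq (N i : ℕ) :
    ∑ j ∈ Finset.range N, j.choose i = N.choose (i + 1) := by
  induction N with
  | zero => simp
  | succ N ih => rw [Finset.sum_range_succ, ih, Nat.choose_succ_succ, add_comm]

/-- The variable `Y` enters the logarithm of `G (1 + Y)` linearly, through powers of the
conjugation by `G` applied to `Y`, when `Y` is nilpotent in the strong sense `Y b Y = 0`. The proof
compares the parts linear in `N` of `(G (1 + Y))^N = G^N + ∑_{j=1}^N G^j Y G^{-j} G^N`, which
depends polynomially on `N`. -/
lemma logSeries_mul_one_add {G G' Y : B} {K : ℕ} (h2 : G' * G = 1)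
    (hY : ∀ b, Y * b * Y = 0) (hg : (G + G * Y - 1) ^ (K + 1) = 0) (hG : (G - 1) ^ (K + 1) = 0)
    (T : Module.End ℝ B) (hT : ∀ b, T b = G * b * G') (hM : ∀ j ≥ K, ((T - 1) ^ j) Y = 0) :
    logSeries K (G + G * Y) = logSeries K G +
      ∑ j ∈ Finset.range K, ((-1 : ℝ) ^ j / ((j : ℝ) + 1)) • T (((T - 1) ^ j) Y) := by
  set S : ℕ → B := fun N => ∑ j ∈ Finset.range N, T ((T ^ j) Y) with hS
  have hS1 : ∀ N, S (N + 1) = T (Y + S N) := by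
    intro N
    simp only [hS]
    rw [Finset.sum_range_succ', map_add, map_sum, add_comm]
    simp only [pow_succ', Module.End.mul_apply, pow_zero, Module.End.one_apply]
  have hTY : ∀ j, ∃ b b', (T ^ j) Y = b * Y * b' := by
    intro j
    induction j with
    | zero => exact ⟨1, 1, by simp⟩
    | succ j ih =>
      obtain ⟨b, b', e⟩ := ih
      exact ⟨G * b, b' * G', by rw [pow_succ', Module.End.mul_apply, e, hT]; noncomm_ring⟩
  have hYS : ∀ N, Y * S N = 0 := by
    intro N
    simp only [hS]
    rw [Finset.mul_sum]
    refine Finset.sum_eq_zero fun j _ => ?_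
    obtain ⟨b, b', e⟩ := hTY j
    rw [e, hT]
    have := hY (G * b)
    calc Y * (G * (b * Y * b') * G') = Y * (G * b) * Y * (b' * G') := by noncomm_ring
      _ = 0 := by rw [this, zero_mul]
  have hpow : ∀ N, (G + G * Y) ^ N = G ^ N + S N * G ^ N := by
    intro N
    induction N with
    | zero => simp [hS]
    | succ N ih =>
      rw [pow_succ', ih, hS1, hT]
      have e1 : G * Y * (S N * G ^ N) = 0 := by
        rw [mul_assoc, ← mul_assoc Y, hYS, zero_mul, mul_zero]
      have e2 : G * (Y + S N) * G' * G ^ (N + 1) = G * (Y + S N) * G ^ N := by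
        rw [pow_succ', mul_assoc _ G', ← mul_assoc G' G, h2, one_mul]
      rw [e2, add_mul, mul_add, mul_add, e1, pow_succ']
      noncomm_ring
  have hSN : ∀ N : ℕ, S N = ∑ j ∈ Finset.range K, (N.choose (j + 1) : ℝ) • T (((T - 1) ^ j) Y) := by
    intro N
    simp only [hS, ← map_sum]
    simp only [end_pow_apply_eq_sum_choose T Y hM]
    rw [Finset.sum_comm, map_sum]
    refine Finset.sum_congr rfl fun i _ => ?_
    rw [← Finset.sum_smul, map_smul, ← sum_range_choose_eq]
    push_cast
    rfl
  let s : ℕ → B := fun j => if j = 0 then 0 else T (((T - 1) ^ (j - 1)) Y)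
  have hs : ∀ N : ℕ, (newtonPoly s (K + 1)).eval (N : B) = S N := by
    intro N
    rw [newtonPoly_eval, Finset.sum_range_succ', hSN]
    simp [s]
  have key : newtonPoly (fun j => (G + G * Y - 1) ^ j) (K + 1) =
      newtonPoly (fun j => (G - 1) ^ j) (K + 1) +
        newtonPoly s (K + 1) * newtonPoly (fun j => (G - 1) ^ j) (K + 1) := by
    refine polynomial_eq_of_eval_natCast fun N => ?_
    rw [eval_add, ← pow_eq_newtonPoly_eval hg, ← pow_eq_newtonPoly_eval hG, hpow]
    congr 1
    rw [eval, eval₂_mul_noncomm]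
    · change _ = (newtonPoly s (K + 1)).eval (N : B) *
        (newtonPoly (fun j => (G - 1) ^ j) (K + 1)).eval (N : B)
      rw [hs, ← pow_eq_newtonPoly_eval hG]
    · exact fun k => Nat.commute_cast _ _
  have h := congrArg (fun p => p.coeff 1) key
  simp only [coeff_add, mul_coeff_one, newtonPoly_coeff_one] at h
  have c0 : (newtonPoly s (K + 1)).coeff 0 = 0 := by
    rw [newtonPoly_coeff]
    refine Finset.sum_eq_zero fun j _ => ?_
    rw [binomPoly_coeff_zero]
    by_cases hj : j = 0 <;> simp [hj, s]
  have c1 : (newtonPoly (fun j => (G - 1) ^ j) (K + 1)).coeff 0 = 1 := by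
    rw [newtonPoly_coeff, Finset.sum_range_succ']
    simp [binomPoly_coeff_zero]
  rw [c0, c1, zero_mul, zero_add, mul_one] at h
  simpa [logSeries, s] using h

end

/-! ### The Magnus commutators are Lie polynomials -/

section

variable {n : ℕ}

/-- The span of the commutator monomials in which no variable occurs twice. -/
def lieSpan (n : ℕ) : Submodule ℝ (NCPoly n) :=
  Submodule.span ℝ {x | ∃ s M, IsLieMonomial s M ∧ toAssoc n M = x}

lemma gen_mem_lieSpan (i : Fin n) : gen i ∈ lieSpan n :=
  Submodule.subset_span ⟨{i}, _, .of i, toAssoc_of i⟩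

lemma IsLieMonomial.toNodup_eq_zero {s : Finset (Fin n)} {M : FreeLieAlgebra ℝ (Fin n)}
    (h : IsLieMonomial s M) {i : Fin n} (hi : i ∈ s) :
    toNodup n (gen i * toAssoc n M) = 0 ∧ toNodup n (toAssoc n M * gen i) = 0 := by
  have : ∀ (x : NCPoly n) (c : ℝ), Pres (multWords s) x c →
      toNodup n (gen i * x) = 0 ∧ toNodup n (x * gen i) = 0 := by
    intro x c hx
    induction hx with
    | zero _ => simp
    | step r _ hQ ih =>
      obtain ⟨l, -, rfl, rfl⟩ := hQ
      rw [List.mem_toFinset] at hi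
      rw [mul_add, add_mul, map_add, map_add, ih.1, ih.2, mul_smul_comm, smul_mul_assoc, map_smul,
        map_smul, ← wordOf_singleton, ← wordOf_append, ← wordOf_append, toNodup_wordOf_eq_zero,
        toNodup_wordOf_eq_zero]
      · simp
      · simp [List.nodup_append, hi]
      · simp [hi]
  exact this _ _ h.pres_multWords

/-- Modulo words with repeated letters, the span of the commutator monomials is stable under
commutators with the variables. -/
lemma commutator_mem_map_lieSpan (i : Fin n) {b : NodupAlg n}
    (hb : b ∈ (lieSpan n).map (toNodup n).toLinearMap) :
    toNodup n (gen i) * b - b * toNodup n (gen i) ∈ (lieSpan n).map (toNodup n).toLinearMap := by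
  obtain ⟨x, hx, rfl⟩ := hb
  induction hx using Submodule.span_induction with
  | mem x h =>
    obtain ⟨s, M, hM, rfl⟩ := h
    by_cases hi : i ∈ s
    · have h := hM.toNodup_eq_zero hi
      rw [AlgHom.toLinearMap_apply, ← map_mul, ← map_mul, h.1, h.2, sub_zero]
      exact zero_mem _
    · refine ⟨toAssoc n ⁅FreeLieAlgebra.of ℝ i, M⁆, Submodule.subset_span
        ⟨{i} ∪ s, _, .bracket (.of i) hM (by simpa using hi), rfl⟩, ?_⟩
      rw [toAssoc_bracket, toAssoc_of]
      simp
  | zero => simp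
  | add x y _ _ hx hy =>
    convert add_mem hx hy using 1
    simp only [AlgHom.toLinearMap_apply, map_add]
    noncomm_ring
  | smul r x _ hx =>
    convert Submodule.smul_mem _ r hx using 1
    simp [smul_sub]

/-- The inverse of `(1 + Y_{i_1}) ⋯ (1 + Y_{i_r})` modulo words with repeated letters. -/
def onePlusProdInv (L : List (Fin n)) : NCPoly n := (L.map fun i => 1 - gen i).reverse.prod

lemma onePlusProdInv_cons (a : Fin n) (L : List (Fin n)) :
    onePlusProdInv (a :: L) = onePlusProdInv L * (1 - gen a) := by
  simp [onePlusProdInv]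

lemma onePlusProd_cons (a : Fin n) (L : List (Fin n)) :
    onePlusProd (a :: L) = (1 + gen a) * onePlusProd L := by
  simp [onePlusProd]

lemma toNodup_gen_sq (a : Fin n) : toNodup n (gen a) * toNodup n (gen a) = 0 := by
  simpa using toNodup_gen_mul_gen a 1

lemma toNodup_onePlusProdInv_mul (L : List (Fin n)) :
    toNodup n (onePlusProdInv L) * toNodup n (onePlusProd L) = 1 := by
  induction L with
  | nil => simp [onePlusProd, onePlusProdInv]
  | cons a L ih =>
    have : toNodup n (1 - gen a) * toNodup n (1 + gen a) = 1 := by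
      rw [map_add, map_sub, map_one, mul_add, mul_one, sub_mul, one_mul, toNodup_gen_sq]
      noncomm_ring
    rw [onePlusProd_cons, onePlusProdInv_cons, map_mul, map_mul, mul_assoc,
      ← mul_assoc (toNodup n (1 - gen a)), this, one_mul, ih]

/-- Conjugation with products `(1 + Y_{i_1}) ⋯ (1 + Y_{i_r})`. -/
def conjEnd (L : List (Fin n)) : Module.End ℝ (NCPoly n) :=
  LinearMap.mulLeft ℝ (onePlusProd L) * LinearMap.mulRight ℝ (onePlusProdInv L)

/-- Conjugation with products `(1 + Y_{i_1}) ⋯ (1 + Y_{i_r})`, modulo words with repeated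
letters. -/
def conjNodup (L : List (Fin n)) : Module.End ℝ (NodupAlg n) :=
  LinearMap.mulLeft ℝ (toNodup n (onePlusProd L)) *
    LinearMap.mulRight ℝ (toNodup n (onePlusProdInv L))

lemma conjNodup_apply (L : List (Fin n)) (b : NodupAlg n) :
    conjNodup L b = toNodup n (onePlusProd L) * b * toNodup n (onePlusProdInv L) := by
  simp [conjNodup, mul_assoc]

lemma conjNodup_mem (L : List (Fin n)) {b : NodupAlg n}
    (hb : b ∈ (lieSpan n).map (toNodup n).toLinearMap) :
    conjNodup L b ∈ (lieSpan n).map (toNodup n).toLinearMap := by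
  induction L with
  | nil => simpa [conjNodup_apply, onePlusProd, onePlusProdInv] using hb
  | cons a L ih =>
    have e : conjNodup (a :: L) b = conjNodup L b +
        (toNodup n (gen a) * conjNodup L b - conjNodup L b * toNodup n (gen a)) := by
      have h := toNodup_gen_mul_gen a (conjNodup L b)
      rw [conjNodup_apply (a :: L), onePlusProd_cons, onePlusProdInv_cons, map_mul, map_mul]
      have : toNodup n (1 + gen a) * toNodup n (onePlusProd L) * b *
          (toNodup n (onePlusProdInv L) * toNodup n (1 - gen a)) =
          (1 + toNodup n (gen a)) * conjNodup L b * (1 - toNodup n (gen a)) := by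
        rw [conjNodup_apply, map_add, map_sub, map_one]
        simp only [mul_assoc]
      rw [this, add_mul, one_mul, mul_sub, add_mul, add_mul, h]
      noncomm_ring
    rw [e]
    exact add_mem ih (commutator_mem_map_lieSpan a ih)

lemma orderGE_conjEnd_sub {d : ℕ} {x : NCPoly n} (hx : OrderGE d x) (L : List (Fin n)) :
    OrderGE (d + 1) ((conjEnd L - 1) x) := by
  have e : (conjEnd L - 1) x = (onePlusProd L - 1) * (x * onePlusProdInv L) +
      x * (onePlusProdInv L - 1) := by
    simp [conjEnd]; noncomm_ring
  have h1 : OrderGE 1 (onePlusProd L - 1) := by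
    refine orderGE_prod_sub_one fun y hy => ?_
    obtain ⟨i, -, rfl⟩ := List.mem_map.1 hy
    simpa using orderGE_gen i
  have h2 : OrderGE 1 (onePlusProdInv L - 1) := by
    refine orderGE_prod_sub_one fun y hy => ?_
    rw [List.mem_reverse] at hy
    obtain ⟨i, -, rfl⟩ := List.mem_map.1 hy
    intro l hl
    simpa using orderGE_gen i l hl
  rw [e]
  refine OrderGE.add ?_ (hx.mul h2)
  rw [add_comm]
  exact h1.mul (by simpa using hx.mul (orderGE_zero (onePlusProdInv L)))

lemma orderGE_conjEnd_sub_pow (i : Fin n) (L : List (Fin n)) (j : ℕ) :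
    OrderGE (j + 1) (((conjEnd L - 1) ^ j) (gen i)) := by
  induction j with
  | zero => simpa using orderGE_gen i
  | succ j ih => rw [pow_succ', Module.End.mul_apply]; exact orderGE_conjEnd_sub ih L

lemma conjNodup_sub_pow (L : List (Fin n)) (j : ℕ) (x : NCPoly n) :
    ((conjNodup L - 1) ^ j) (toNodup n x) = toNodup n (((conjEnd L - 1) ^ j) x) := by
  induction j with
  | zero => simp
  | succ j ih =>
    rw [pow_succ', pow_succ', Module.End.mul_apply, Module.End.mul_apply, ih, LinearMap.sub_apply,
      LinearMap.sub_apply, conjNodup_apply, map_sub]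
    simp [conjEnd, mul_assoc]

lemma toNodup_onePlusProd_sub_one_pow (L : List (Fin n)) :
    (toNodup n (onePlusProd L) - 1) ^ (n + 1) = 0 := by
  rw [← map_one (toNodup n), ← map_sub, ← map_pow]
  refine toNodup_eq_zero_of_orderGE (OrderGE.pow (orderGE_prod_sub_one fun y hy => ?_) _)
  obtain ⟨i, -, rfl⟩ := List.mem_map.1 hy
  simpa using orderGE_gen i

/-- Modulo words with repeated letters, the logarithm of a product of exponentials is the
logarithm of the product of all but the last factor, and a Lie polynomial. -/
lemma exists_lieSpan_log (L : List (Fin n)) (i : Fin n) : ∃ v ∈ lieSpan n,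
    toNodup n (logTrunc n (onePlusProd (L ++ [i]))) =
      toNodup n (logTrunc n (onePlusProd L)) + toNodup n v := by
  have e : toNodup n (onePlusProd (L ++ [i])) =
      toNodup n (onePlusProd L) + toNodup n (onePlusProd L) * toNodup n (gen i) := by
    simp [onePlusProd, mul_add]
  have hY : toNodup n (gen i) ∈ (lieSpan n).map (toNodup n).toLinearMap :=
    ⟨_, gen_mem_lieSpan i, rfl⟩
  have hM : ∀ j, ((conjNodup L - 1) ^ j : Module.End ℝ (NodupAlg n)) (toNodup n (gen i)) ∈
      (lieSpan n).map (toNodup n).toLinearMap := by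
    intro j
    induction j with
    | zero => simpa using hY
    | succ j ih =>
      rw [pow_succ', Module.End.mul_apply, LinearMap.sub_apply]
      exact sub_mem (conjNodup_mem L ih) ih
  have key := logSeries_mul_one_add (K := n)
    (toNodup_onePlusProdInv_mul L) (toNodup_gen_mul_gen i)
    (by rw [← e]; exact toNodup_onePlusProd_sub_one_pow _)
    (toNodup_onePlusProd_sub_one_pow L) (conjNodup L) (conjNodup_apply L) (fun j hj => by
      rw [conjNodup_sub_pow]
      refine toNodup_eq_zero_of_orderGE fun l hl => orderGE_conjEnd_sub_pow i L j l ?_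
      omega)
  have hv : ∑ j ∈ Finset.range n, ((-1 : ℝ) ^ j / ((j : ℝ) + 1)) •
      conjNodup L (((conjNodup L - 1) ^ j) (toNodup n (gen i))) ∈
        (lieSpan n).map (toNodup n).toLinearMap :=
    Submodule.sum_mem _ fun j _ => Submodule.smul_mem _ _ (conjNodup_mem L (hM j))
  obtain ⟨v, hv, hv'⟩ := hv
  refine ⟨v, hv, ?_⟩
  rw [map_logTrunc, map_logTrunc, e]
  rw [← hv'] at key
  exact key

/-- The letter `i` does not occur in the words without repeated letters occurring in `x`. -/
def Avoids (i : Fin n) (x : NCPoly n) : Prop := ∀ l : List (Fin n), i ∈ l → wordCoeff l x = 0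

lemma Avoids.mul {i : Fin n} {x y : NCPoly n} (hx : Avoids i x) (hy : Avoids i y) :
    Avoids i (x * y) := by
  intro l hl
  rw [wordCoeff_mul]
  refine Finset.sum_eq_zero fun j _ => ?_
  rw [← List.take_append_drop j l, List.mem_append] at hl
  rcases hl with h | h
  · rw [hx _ h, zero_mul]
  · rw [hy _ h, mul_zero]

lemma avoids_one (i : Fin n) : Avoids i (1 : NCPoly n) := by
  intro l hl
  rw [wordCoeff_one, if_neg]
  rintro rfl
  simp at hl

lemma Avoids.add {i : Fin n} {x y : NCPoly n} (hx : Avoids i x) (hy : Avoids i y) :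
    Avoids i (x + y) := fun l hl => by rw [map_add, hx l hl, hy l hl, add_zero]

lemma Avoids.sub {i : Fin n} {x y : NCPoly n} (hx : Avoids i x) (hy : Avoids i y) :
    Avoids i (x - y) := fun l hl => by rw [map_sub, hx l hl, hy l hl, sub_zero]

lemma Avoids.pow {i : Fin n} {x : NCPoly n} (hx : Avoids i x) : ∀ j, Avoids i (x ^ j)
  | 0 => by simpa using avoids_one i
  | j + 1 => by rw [pow_succ]; exact (hx.pow j).mul hx

lemma avoids_onePlusProd {i : Fin n} {L : List (Fin n)} (h : i ∉ L) :
    Avoids i (onePlusProd L) := by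
  induction L with
  | nil => simpa [onePlusProd] using avoids_one i
  | cons a L ih =>
    rw [List.mem_cons, not_or] at h
    rw [onePlusProd_cons]
    refine Avoids.mul ((avoids_one i).add fun l hl => ?_) (ih h.2)
    rw [← wordOf_singleton, wordCoeff_wordOf, if_neg]
    rintro rfl
    simp only [List.mem_singleton] at hl
    exact h.1 hl

lemma Avoids.logTrunc {i : Fin n} {x : NCPoly n} (hx : Avoids i x) (k : ℕ) :
    Avoids i (MagnusLie.logTrunc k x) := by
  intro l hl
  rw [MagnusLie.logTrunc, map_sum]
  refine Finset.sum_eq_zero fun j _ => ?_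
  rw [map_smul, (hx.sub (avoids_one i)).pow _ l hl, smul_zero]

/-- The part of a noncommutative polynomial in which every variable has multiplicity one. -/
def multPart (x : NCPoly n) : NCPoly n := symPoly fun σ => wordCoeff (List.ofFn σ) x

lemma IsLieMonomial.multPart {s : Finset (Fin n)} {M : FreeLieAlgebra ℝ (Fin n)}
    (h : IsLieMonomial s M) :
    MagnusLie.multPart (toAssoc n M) = if s = Finset.univ then toAssoc n M else 0 := by
  split_ifs with hs
  · subst hs
    exact (h.pres_multWords.eq_symPoly.1).symm
  · have : ∀ (x : NCPoly n) (c : ℝ), Pres (multWords s) x c → ∀ σ : Equiv.Perm (Fin n),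
        wordCoeff (List.ofFn σ) x = 0 := by
      intro x c hx σ
      induction hx with
      | zero _ => simp
      | step r _ hQ ih =>
        obtain ⟨l, -, rfl, rfl⟩ := hQ
        rw [map_add, ih, map_smul, wordCoeff_wordOf, if_neg]
        · simp
        · rintro rfl
          exact hs (ofFn_perm_toFinset σ)
    rw [MagnusLie.multPart, symPoly]
    exact Finset.sum_eq_zero fun σ _ => by rw [this _ _ h.pres_multWords, zero_smul]

lemma magnus_eq_multPart (k : ℕ) : magnus k = multPart (logProdExp k) := by
  rw [magnus, multPart, symPoly]
  exact Finset.sum_congr rfl fun σ _ => single_permWord _ _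

/-- The Magnus commutators are linear combinations of commutator monomials. -/
theorem magnus_mem_span {k : ℕ} (hk : 1 ≤ k) :
    magnus k ∈ Submodule.span ℝ {x | ∃ M, IsLieMonomial Finset.univ M ∧ toAssoc k M = x} := by
  obtain ⟨m, rfl⟩ : ∃ m, k = m + 1 := ⟨k - 1, by omega⟩
  obtain ⟨v, hv, h⟩ := exists_lieSpan_log ((List.finRange m).map Fin.castSucc) (Fin.last m)
  have e : (List.finRange m).map Fin.castSucc ++ [Fin.last m] = List.finRange (m + 1) :=
    (List.finRange_succ_last).symm
  rw [e, ← toNodup_logProdExp hk, ← map_add, toNodup_eq_iff] at h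
  have hcoeff : magnus (m + 1) = multPart v := by
    rw [magnus_eq_multPart, multPart, multPart]
    congr 1
    funext σ
    rw [h _ (ofFn_perm_nodup σ), map_add,
      (avoids_onePlusProd (i := Fin.last m) (by simp [Fin.castSucc_ne_last])).logTrunc, zero_add]
    rw [← List.mem_toFinset, ofFn_perm_toFinset]
    exact Finset.mem_univ _
  rw [hcoeff]
  clear h hcoeff
  induction hv using Submodule.span_induction with
  | mem x hx =>
    obtain ⟨s, M, hM, rfl⟩ := hx
    rw [hM.multPart]
    split_ifs with hs
    · subst hs
      exact Submodule.subset_span ⟨M, hM, rfl⟩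
    · exact zero_mem _
  | zero => simp [multPart, symPoly]
  | add x y _ _ hx hy =>
    convert add_mem hx hy using 1
    simp [multPart, symPoly, add_smul, Finset.sum_add_distrib]
  | smul r x _ hx =>
    convert Submodule.smul_mem _ r hx using 1
    simp [multPart, symPoly, Finset.smul_sum, smul_smul]

end

/-! ### From commutator products to Lie monomials -/

section

variable {k : ℕ}

/-- The action of the variable `Y_i` on pairs: commutation on the first component, and sending
the second basis vector to `Y_{i₀}` if `i = i₀`. -/
def bracketEnd (i₀ i : Fin k) : Module.End ℝ (FreeLieAlgebra ℝ (Fin k) × ℝ) :=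
  LinearMap.inl ℝ _ _ ∘ₗ ((LieAlgebra.ad ℝ _ (FreeLieAlgebra.of ℝ i)).coprod
    (LinearMap.toSpanSingleton ℝ _ (if i = i₀ then FreeLieAlgebra.of ℝ i₀ else 0)))

/-- The action of noncommutative polynomials generated by `bracketEnd`. The first component of the
image of `(0, 1)` under the action of the word `Y_{i_1} ⋯ Y_{i_r} Y_{i₀}` is the left normed
commutator `[Y_{i_1}, …, [Y_{i_r}, Y_{i₀}]]`. -/
def bracketHom (i₀ : Fin k) : NCPoly k →ₐ[ℝ] Module.End ℝ (FreeLieAlgebra ℝ (Fin k) × ℝ) :=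
  MonoidAlgebra.lift ℝ _ _ (FreeMonoid.lift (bracketEnd i₀))

lemma bracketHom_gen (i₀ i : Fin k) : bracketHom i₀ (gen i) = bracketEnd i₀ i := by
  simp [bracketHom, gen]

lemma IsLieMonomial.nonempty {s : Finset (Fin k)} {M : FreeLieAlgebra ℝ (Fin k)}
    (h : IsLieMonomial s M) : s.Nonempty := by
  induction h with
  | of i => simp
  | bracket _ _ _ ih _ => exact ih.mono Finset.subset_union_left

lemma IsLieMonomial.bracketHom_apply (i₀ : Fin k) {s : Finset (Fin k)}
    {M : FreeLieAlgebra ℝ (Fin k)} (h : IsLieMonomial s M) :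
    (∀ x, bracketHom i₀ (toAssoc k M) (x, 0) = (⁅M, x⁆, 0)) ∧
      bracketHom i₀ (toAssoc k M) (0, 1) = (if i₀ ∈ s then M else 0, 0) := by
  induction h with
  | of i =>
    rw [toAssoc_of, bracketHom_gen]
    refine ⟨fun x => by simp [bracketEnd], ?_⟩
    simp only [bracketEnd, Finset.mem_singleton, eq_comm (a := i₀)]
    by_cases h : i = i₀ <;> simp [h]
  | bracket hM hN hst ih1 ih2 =>
    rename_i s t M N
    rw [toAssoc_bracket, map_sub, map_mul, map_mul]
    simp only [LinearMap.sub_apply, Module.End.mul_apply]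
    constructor
    · intro x
      rw [ih2.1, ih1.1, ih1.1, ih2.1, lie_lie]
      simp
    · rw [ih1.2, ih2.2, ih1.1, ih2.1]
      have hd : i₀ ∈ s → i₀ ∉ t := fun h => Finset.disjoint_left.1 hst h
      by_cases h1 : i₀ ∈ s
      · simp [h1, hd h1]
      · by_cases h2 : i₀ ∈ t <;> simp [h1, h2, Prod.zero_eq_mk]

lemma IsCommProduct.bracketHom_apply (i₀ : Fin k) {s : Finset (Fin k)} {Q : NCPoly k}
    (h : IsCommProduct s Q) : (s = ∅ ∧ Q = 1) ∨ (s.Nonempty ∧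
      ∃ P, bracketHom i₀ Q (0, 1) = (P, 0) ∧ (P = 0 ∨ IsLieMonomial s P)) := by
  induction h with
  | one => exact Or.inl ⟨rfl, rfl⟩
  | mul hM hQ hst ih =>
    rename_i s t M Q
    right
    refine ⟨hM.nonempty.mono Finset.subset_union_left, ?_⟩
    rcases ih with ⟨rfl, rfl⟩ | ⟨-, P, hP, hP'⟩
    · rw [mul_one, (hM.bracketHom_apply i₀).2, Finset.union_empty]
      refine ⟨_, rfl, ?_⟩
      split_ifs
      · exact Or.inr hM
      · exact Or.inl rfl
    · rw [map_mul, Module.End.mul_apply, hP, (hM.bracketHom_apply i₀).1]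
      refine ⟨_, rfl, ?_⟩
      rcases hP' with rfl | hP'
      · exact Or.inl (lie_zero _)
      · exact Or.inr (.bracket hM hP' hst)

/-- The projection to Lie polynomials which sends `Y_{i_1} ⋯ Y_{i_r} Y_{i₀}` to the left normed
commutator `[Y_{i_1}, …, [Y_{i_r}, Y_{i₀}]]`, and other words to zero. -/
def bracketProj (i₀ : Fin k) : NCPoly k →ₗ[ℝ] FreeLieAlgebra ℝ (Fin k) :=
  LinearMap.fst ℝ _ _ ∘ₗ LinearMap.applyₗ (0, 1) ∘ₗ (bracketHom i₀).toLinearMap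

lemma IsLieMonomial.bracketProj_eq (i₀ : Fin k) {M : FreeLieAlgebra ℝ (Fin k)}
    (h : IsLieMonomial Finset.univ M) : bracketProj i₀ (toAssoc k M) = M := by
  simp [bracketProj, (h.bracketHom_apply i₀).2]

/-- The multilinear Lie monomials, and zero. -/
def lieMonomials (k : ℕ) : Set (FreeLieAlgebra ℝ (Fin k)) :=
  {M | M = 0 ∨ IsLieMonomial Finset.univ M}

lemma Pres.bracketProj (i₀ : Fin k) {x : NCPoly k} {c : ℝ}
    (h : Pres (commProducts Finset.univ) x c) :
    Pres (lieMonomials k) (MagnusLie.bracketProj i₀ x) c := by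
  have := h.bind (T := lieMonomials k) (MagnusLie.bracketProj i₀) (K := 1) (fun Q hQ => ?_)
    zero_le_one
  · simpa using this
  · rcases IsCommProduct.bracketHom_apply i₀ hQ with ⟨h, -⟩ | ⟨-, P, hP, hP'⟩
    · exact absurd h (Finset.univ_nonempty_iff.2 ⟨i₀⟩).ne_empty
    · have : MagnusLie.bracketProj i₀ Q = P := by simp [MagnusLie.bracketProj, hP]
      rw [this]
      exact Pres.of_mem hP'

lemma Pres.exists_finsupp {x : FreeLieAlgebra ℝ (Fin k)} {c : ℝ}
    (h : Pres (lieMonomials k) x c) : ∃ θ : FreeLieAlgebra ℝ (Fin k) →₀ ℝ,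
      (∀ M ∈ θ.support, IsLieMonomial Finset.univ M) ∧
      (θ.sum fun M r => r • M) = x ∧ (θ.sum fun _ r => |r|) ≤ c := by
  classical
  induction h with
  | zero h0 => exact ⟨0, by simp, by simp, by simpa using h0⟩
  | step r _ hQ ih =>
    rename_i x Q c _
    obtain ⟨θ, h1, h2, h3⟩ := ih
    rcases hQ with rfl | hQ
    · exact ⟨θ, h1, by simp [h2], h3.trans (by simp)⟩
    · refine ⟨θ + Finsupp.single Q r, fun M hM => ?_, ?_, ?_⟩
      · rcases Finset.mem_union.1 (Finsupp.support_add hM) with h | h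
        · exact h1 M h
        · have := Finsupp.support_single_subset h
          rw [Finset.mem_singleton] at this
          exact this ▸ hQ
      · rw [Finsupp.sum_add_index' (by simp) (by simp [add_smul]), h2,
          Finsupp.sum_single_index (by simp)]
      · have e : ∀ θ' : FreeLieAlgebra ℝ (Fin k) →₀ ℝ, θ'.support ⊆ θ.support ∪ {Q} →
            (θ'.sum fun _ r => |r|) = ∑ M ∈ θ.support ∪ {Q}, |θ' M| := fun θ' h =>
          Finsupp.sum_of_support_subset _ h _ (by simp)
        rw [e _ (Finsupp.support_add.trans (Finset.union_subset_union_right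
          Finsupp.support_single_subset))]
        rw [e _ Finset.subset_union_left] at h3
        have : ∑ M ∈ θ.support ∪ {Q}, |(Finsupp.single Q r) M| = |r| := by
          rw [Finset.sum_eq_single Q]
          · simp
          · intro M _ hM; simp [Finsupp.single_eq_of_ne hM]
          · intro h; simp at h
        calc ∑ M ∈ θ.support ∪ {Q}, |(θ + Finsupp.single Q r) M|
            ≤ ∑ M ∈ θ.support ∪ {Q}, (|θ M| + |(Finsupp.single Q r) M|) :=
              Finset.sum_le_sum fun M _ => abs_add_le _ _
          _ ≤ c + |r| := by rw [Finset.sum_add_distrib, this]; linarith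

/-- The projection `bracketProj` turns presentations by commutator products into presentations
by Lie monomials of no larger cost. -/
theorem thetaLie_le_of_pres (hk : 1 ≤ k) {c : ℝ}
    (h : Pres (commProducts Finset.univ) (magnus k) c) :
    thetaLie k ≤ 1 / (k.factorial : ℝ) * c := by
  have i₀ : Fin k := ⟨0, hk⟩
  have hfix : toAssoc k (bracketProj i₀ (magnus k)) = magnus k := by
    have hm := magnus_mem_span hk
    generalize magnus k = y at hm
    induction hm using Submodule.span_induction with
    | mem x hx =>
      obtain ⟨M, hM, rfl⟩ := hx
      rw [hM.bracketProj_eq]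
    | zero => simp
    | add x y _ _ hx hy => rw [map_add, map_add, hx, hy]
    | smul r x _ hx => rw [map_smul, map_smul, hx]
  obtain ⟨θ, h1, h2, h3⟩ := (h.bracketProj i₀).exists_finsupp
  refine mul_le_mul_of_nonneg_left ?_ (by positivity)
  refine le_trans (csInf_le ⟨0, ?_⟩ ?_) h3
  swap
  · exact ⟨θ, h1, by rw [h2, hfix], rfl⟩
  rintro _ ⟨θ, -, -, rfl⟩
  exact Finset.sum_nonneg fun _ _ => abs_nonneg _

lemma thetaLie_nonneg (k : ℕ) : 0 ≤ thetaLie k := by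
  refine mul_nonneg (by positivity) (Real.sInf_nonneg ?_)
  rintro _ ⟨θ, -, -, rfl⟩
  exact Finset.sum_nonneg fun _ _ => abs_nonneg _

theorem thetaLie_le_symNorm (hk : 1 ≤ k) : thetaLie k ≤ 1 / (k.factorial : ℝ) *
    symNorm fun σ : Equiv.Perm (Fin k) => ∫ lam in (0 : ℝ)..1, listWeight lam (List.ofFn σ) := by
  refine le_of_forall_pos_le_add fun ε hε => ?_
  have h := thetaLie_le_of_pres hk (c := symNorm (fun σ : Equiv.Perm (Fin k) =>
    ∫ lam in (0 : ℝ)..1, listWeight lam (List.ofFn σ)) + ε) (by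
      rw [magnus_eq_symPoly hk]; exact pres_of_symNorm_lt (lt_add_of_pos_right _ hε))
  refine h.trans ?_
  rw [mul_add]
  have : 1 / (k.factorial : ℝ) ≤ 1 :=
    div_le_one_of_le₀ (by exact_mod_cast k.factorial_pos) (by positivity)
  nlinarith

/-- Bounds of the norm of the resolvent polynomials which are uniform in the parameter carry over
to the Magnus commutators. -/
theorem thetaLie_le_of_symNorm_le (hk : 1 ≤ k) {c : ℝ}
    (h : ∀ lam ∈ Ioo (0 : ℝ) 1,
      symNorm (fun σ : Equiv.Perm (Fin k) => listWeight lam (List.ofFn σ)) ≤ c) :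
    thetaLie k ≤ 1 / (k.factorial : ℝ) * c := by
  refine (thetaLie_le_symNorm hk).trans (mul_le_mul_of_nonneg_left ?_ (by positivity))
  have hconv : Convex ℝ {x : Equiv.Perm (Fin k) → ℝ | symNorm x ≤ c} := by
    intro x hx y hy a b ha hb hab
    have h1 := symNorm_add_le (a • x) (b • y)
    have h2 := symNorm_smul_le a x
    have h3 := symNorm_smul_le b y
    rw [abs_of_nonneg ha] at h2
    rw [abs_of_nonneg hb] at h3
    have h4 : a * symNorm x ≤ a * c := mul_le_mul_of_nonneg_left hx ha
    have h5 : b * symNorm y ≤ b * c := mul_le_mul_of_nonneg_left hy hb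
    have h6 : a * c + b * c = c := by rw [← add_mul, hab, one_mul]
    change symNorm (a • x + b • y) ≤ c
    linarith
  have hclosed : IsClosed {x : Equiv.Perm (Fin k) → ℝ | symNorm x ≤ c} :=
    isClosed_le continuous_symNorm continuous_const
  have hcont : Continuous fun (lam : ℝ) (σ : Equiv.Perm (Fin k)) =>
      listWeight lam (List.ofFn σ) := by
    unfold listWeight; fun_prop
  have : IsProbabilityMeasure (volume.restrict (Ioo (0 : ℝ) 1)) := ⟨by simp⟩
  have hint : Integrable (fun (lam : ℝ) (σ : Equiv.Perm (Fin k)) => listWeight lam (List.ofFn σ))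
      (volume.restrict (Ioo (0 : ℝ) 1)) :=
    (hcont.continuousOn.integrableOn_compact isCompact_Icc).mono_set Ioo_subset_Icc_self
  have key := hconv.integral_mem hclosed
    (ae_restrict_of_forall_mem measurableSet_Ioo fun lam hl => h lam hl) hint
  change symNorm _ ≤ c at key
  refine le_trans (le_of_eq (congrArg symNorm ?_)) key
  funext σ
  rw [intervalIntegral.integral_of_le zero_le_one, ← integral_Ioc_eq_integral_Ioo.symm,
    eval_integral (fun σ => hint.eval σ)]

end

/-! ### Cutting words into blocks -/

section

variable {n l : ℕ}

/-- The permutation of the positions of a word which permutes the first `n` and the last `l`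
positions, and fixes the position between them. -/
def blockPerm (π : Equiv.Perm (Fin n)) (ρ : Equiv.Perm (Fin l)) :
    Equiv.Perm (Fin (n + (l + 1))) :=
  finSumFinEquiv.permCongr (Equiv.Perm.sumCongr π (Equiv.Perm.decomposeFin.symm (0, ρ)))

lemma blockPerm_left (π : Equiv.Perm (Fin n)) (ρ : Equiv.Perm (Fin l)) (i : Fin n) :
    blockPerm π ρ (Fin.castAdd (l + 1) i) = Fin.castAdd (l + 1) (π i) := by
  simp [blockPerm, Equiv.permCongr_apply]

lemma blockPerm_mid (π : Equiv.Perm (Fin n)) (ρ : Equiv.Perm (Fin l)) :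
    blockPerm π ρ (Fin.natAdd n 0) = Fin.natAdd n 0 := by
  simp [blockPerm, Equiv.permCongr_apply]

lemma blockPerm_right (π : Equiv.Perm (Fin n)) (ρ : Equiv.Perm (Fin l)) (i : Fin l) :
    blockPerm π ρ (Fin.natAdd n i.succ) = Fin.natAdd n (ρ i).succ := by
  simp [blockPerm, Equiv.permCongr_apply]

lemma ofFn_block {α : Type*} (y : Fin (n + (l + 1)) → α) :
    List.ofFn y = (List.ofFn fun i => y (Fin.castAdd (l + 1) i)) ++ y (Fin.natAdd n 0) ::
      List.ofFn fun i : Fin l => y (Fin.natAdd n i.succ) := by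
  rw [List.ofFn_add, List.ofFn_succ]
  rfl

lemma permPoly_mul_blockPerm (σ : Equiv.Perm (Fin (n + (l + 1)))) (π : Equiv.Perm (Fin n))
    (ρ : Equiv.Perm (Fin l)) : permPoly (σ * blockPerm π ρ) =
      relabel (fun i => σ (Fin.castAdd (l + 1) i)) (permPoly π) *
        (gen (σ (Fin.natAdd n 0)) * relabel (fun i => σ (Fin.natAdd n i.succ)) (permPoly ρ)) := by
  rw [permPoly, permPoly, permPoly, relabel_wordOf, relabel_wordOf, ofFn_block, wordOf_append,
    wordOf_cons, List.map_ofFn, List.map_ofFn]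
  simp only [Equiv.Perm.mul_apply, blockPerm_left, blockPerm_mid, blockPerm_right]
  rfl

/-- A multilinear polynomial whose coefficients factor with respect to the cutting of words into
blocks is a sum of products. -/
lemma symPoly_block {c : Equiv.Perm (Fin (n + (l + 1))) → ℝ}
    {u : Equiv.Perm (Fin (n + (l + 1))) → Equiv.Perm (Fin n) → ℝ}
    {v : Equiv.Perm (Fin (n + (l + 1))) → Equiv.Perm (Fin l) → ℝ}
    (h : ∀ σ π ρ, c (σ * blockPerm π ρ) = u σ π * v σ ρ) :
    ((n.factorial : ℝ) * l.factorial) • symPoly c =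
      ∑ σ, relabel (fun i => σ (Fin.castAdd (l + 1) i)) (symPoly (u σ)) *
        (gen (σ (Fin.natAdd n 0)) *
          relabel (fun i => σ (Fin.natAdd n i.succ)) (symPoly (v σ))) := by
  have e : ∀ σ, relabel (fun i => σ (Fin.castAdd (l + 1) i)) (symPoly (u σ)) *
      (gen (σ (Fin.natAdd n 0)) *
        relabel (fun i => σ (Fin.natAdd n i.succ)) (symPoly (v σ))) =
      ∑ π, ∑ ρ, c (σ * blockPerm π ρ) • permPoly (σ * blockPerm π ρ) := by
    intro σ
    rw [symPoly, symPoly, map_sum, map_sum, Finset.mul_sum, Finset.sum_mul_sum]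
    refine Finset.sum_congr rfl fun π _ => Finset.sum_congr rfl fun ρ _ => ?_
    rw [permPoly_mul_blockPerm, h, map_smul, map_smul, mul_smul_comm, smul_mul_smul_comm]
  simp only [e]
  rw [Finset.sum_comm]
  simp only [Finset.sum_comm (s := Finset.univ (α := Equiv.Perm (Fin (n + (l + 1)))))]
  have e2 : ∀ π ρ, ∑ σ, c (σ * blockPerm π ρ) • permPoly (σ * blockPerm π ρ) = symPoly c :=
    fun π ρ => Equiv.sum_comp (Equiv.mulRight (blockPerm π ρ)) fun σ => c σ • permPoly σ
  simp only [e2]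
  simp [Finset.card_univ, Fintype.card_perm, smul_smul, ← Nat.cast_smul_eq_nsmul ℝ]

lemma symNorm_block_le {c : Equiv.Perm (Fin (n + (l + 1))) → ℝ}
    {u : Equiv.Perm (Fin (n + (l + 1))) → Equiv.Perm (Fin n) → ℝ}
    {v : Equiv.Perm (Fin (n + (l + 1))) → Equiv.Perm (Fin l) → ℝ}
    (h : ∀ σ π ρ, c (σ * blockPerm π ρ) = u σ π * v σ ρ) :
    (n.factorial : ℝ) * l.factorial * symNorm c ≤ ∑ σ, symNorm (u σ) * symNorm (v σ) := by
  have hpos : (0 : ℝ) < (n.factorial : ℝ) * l.factorial := by positivity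
  have key : ∀ ε > 0, (n.factorial : ℝ) * l.factorial * symNorm c ≤
      ∑ σ, (symNorm (u σ) + ε) * (symNorm (v σ) + ε) := by
    intro ε hε
    rw [← le_div_iff₀' hpos, div_eq_inv_mul]
    have hp : Pres (commProducts Finset.univ) (((n.factorial : ℝ) * l.factorial) • symPoly c)
        (∑ σ, (symNorm (u σ) + ε) * (symNorm (v σ) + ε)) := by
      rw [symPoly_block h]
      refine Pres.sum _ fun σ _ => ?_
      have i1 : Function.Injective fun i => σ (Fin.castAdd (l + 1) i) :=
        σ.injective.comp (Fin.castAdd_injective _ _)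
      have i3 : Function.Injective fun i : Fin l => σ (Fin.natAdd n i.succ) :=
        σ.injective.comp ((Fin.natAdd_injective _ _).comp (Fin.succ_injective _))
      have h1 := (pres_of_symNorm_lt (lt_add_of_pos_right (symNorm (u σ)) hε)).relabel i1
      have h3 := (pres_of_symNorm_lt (lt_add_of_pos_right (symNorm (v σ)) hε)).relabel i3
      have h2 : Pres (commProducts {σ (Fin.natAdd n 0)}) (gen (σ (Fin.natAdd n 0))) 1 :=
        Pres.of_mem (by
          have := IsCommProduct.of_isLieMonomial (IsLieMonomial.of (σ (Fin.natAdd n 0)))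
          rwa [toAssoc_of] at this)
      have d2 : Disjoint {σ (Fin.natAdd n 0)}
          (Finset.univ.image fun i : Fin l => σ (Fin.natAdd n i.succ)) := by
        simp [Fin.ext_iff]
      have d1 : Disjoint (Finset.univ.image fun i => σ (Fin.castAdd (l + 1) i))
          ({σ (Fin.natAdd n 0)} ∪
            Finset.univ.image fun i : Fin l => σ (Fin.natAdd n i.succ)) := by
        rw [Finset.disjoint_left]
        intro x hx hx'
        simp only [Finset.mem_image, Finset.mem_univ, true_and, Finset.mem_union,
          Finset.mem_singleton] at hx hx'
        obtain ⟨i, rfl⟩ := hx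
        rcases hx' with hx' | ⟨j, hx'⟩
        · have := congrArg Fin.val (σ.injective hx')
          simp at this; omega
        · have := congrArg Fin.val (σ.injective hx')
          simp at this; omega
      have h4 := h1.mul (commProducts_mul d1) (h2.mul (commProducts_mul d2) h3)
      rw [one_mul] at h4
      have hun : (Finset.univ.image fun i => σ (Fin.castAdd (l + 1) i)) ∪
          ({σ (Fin.natAdd n 0)} ∪ Finset.univ.image fun i : Fin l => σ (Fin.natAdd n i.succ)) =
            Finset.univ := ?_
      · rw [hun] at h4
        exact h4
      rw [Finset.eq_univ_iff_forall]
      intro x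
      obtain ⟨x, rfl⟩ := σ.surjective x
      simp only [Finset.mem_image, Finset.mem_univ, true_and, Finset.mem_union,
        Finset.mem_singleton, EmbeddingLike.apply_eq_iff_eq]
      induction x using Fin.addCases with
      | left i => exact Or.inl ⟨i, rfl⟩
      | right j =>
        right
        cases j using Fin.cases with
        | zero => exact Or.inl rfl
        | succ j => exact Or.inr ⟨j, rfl⟩
    refine symNorm_le ?_
    have := hp.smul ((n.factorial : ℝ) * l.factorial)⁻¹
    rwa [smul_smul, inv_mul_cancel₀ hpos.ne', one_smul, abs_of_pos (inv_pos.2 hpos)] at this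
  have ht : Filter.Tendsto (fun ε : ℝ => ∑ σ, (symNorm (u σ) + ε) * (symNorm (v σ) + ε))
      (nhdsWithin 0 (Ioi 0)) (nhds (∑ σ, symNorm (u σ) * symNorm (v σ))) := by
    have hc : Continuous fun ε : ℝ => ∑ σ, (symNorm (u σ) + ε) * (symNorm (v σ) + ε) := by
      fun_prop
    simpa using (hc.tendsto 0).mono_left nhdsWithin_le_nhds
  exact ge_of_tendsto ht (Filter.eventually_of_mem self_mem_nhdsWithin key)

/-! ### The averaged norms of resolvent polynomials with a fixed start -/

/-- The weight of a sequence with prescribed first entry. -/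
def startWeight (l : ℕ) (lam s : ℝ) (y : Fin l → ℝ) : ℝ := listWeight lam (s :: List.ofFn y)

/-- The Lie norm of the noncommutative integral with density `startWeight`. -/
def startNorm (l : ℕ) (lam s : ℝ) : ℝ := lieAvg (startWeight l lam s)

lemma startWeight_block (lam s : ℝ) (y : Fin (n + (l + 1)) → ℝ) :
    startWeight (n + (l + 1)) lam s y =
      resolventWeight n lam s (y (Fin.natAdd n 0)) (fun i => y (Fin.castAdd (l + 1) i)) *
        startWeight l lam (y (Fin.natAdd n 0)) fun i => y (Fin.natAdd n i.succ) := by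
  rw [startWeight, startWeight, resolventWeight_eq, ofFn_block, ← List.cons_append,
    listWeight_append, List.cons_append]

lemma measurable_startWeight' (lam : ℝ) {Ω : Type*} [MeasurableSpace Ω]
    {s : Ω → ℝ} {v : Ω → Fin l → ℝ} (hs : Measurable s) (hv : ∀ i, Measurable fun ω => v ω i) :
    Measurable fun ω => startWeight l lam (s ω) (v ω) := by
  have h : ∀ ω, startWeight l lam (s ω) (v ω) =
      listWeight lam (List.ofFn (Fin.cons (s ω) (v ω) : Fin (l + 1) → ℝ)) := fun ω => by
    rw [startWeight, List.ofFn_succ]; rfl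
  simp only [h]
  refine measurable_listWeight_ofFn lam fun i => ?_
  cases i using Fin.cases with
  | zero => exact hs
  | succ i => exact hv i

lemma measurable_symNorm_orbit_startWeight (lam : ℝ) {Ω : Type*} [MeasurableSpace Ω]
    {s : Ω → ℝ} {v : Ω → Fin l → ℝ} (hs : Measurable s) (hv : ∀ i, Measurable fun ω => v ω i) :
    Measurable fun ω => symNorm (orbit (startWeight l lam (s ω)) (v ω)) :=
  continuous_symNorm.measurable.comp
    (measurable_pi_lambda _ fun π => measurable_startWeight' lam hs fun i => hv (π i))

lemma measurable_symNorm_orbit_resolventWeight (lam : ℝ) {Ω : Type*} [MeasurableSpace Ω]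
    {s s' : Ω → ℝ} {v : Ω → Fin n → ℝ} (hs : Measurable s) (hs' : Measurable s')
    (hv : ∀ i, Measurable fun ω => v ω i) :
    Measurable fun ω => symNorm (orbit (resolventWeight n lam (s ω) (s' ω)) (v ω)) :=
  continuous_symNorm.measurable.comp
    (measurable_pi_lambda _ fun π => measurable_resolventWeight' lam hs hs' fun i => hv (π i))

lemma symNorm_orbit_le_factorial {f : (Fin n → ℝ) → ℝ} (hf : ∀ y, |f y| ≤ 1) (b : Fin n → ℝ) :
    symNorm (orbit f b) ≤ n.factorial := by
  refine (symNorm_le_l1 _).trans ((Finset.sum_le_sum fun σ _ => hf _).trans ?_)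
  simp [Finset.card_univ, Fintype.card_perm]

lemma symNorm_orbit_startWeight_le {lam : ℝ} (h : lam ∈ Icc (0 : ℝ) 1) (s : ℝ) (b : Fin l → ℝ) :
    symNorm (orbit (startWeight l lam s) b) ≤ l.factorial :=
  symNorm_orbit_le_factorial (fun _ => abs_listWeight_le_one h.1 h.2 _) b

lemma symNorm_orbit_resolventWeight_le {lam : ℝ} (h : lam ∈ Icc (0 : ℝ) 1) (s s' : ℝ)
    (b : Fin n → ℝ) : symNorm (orbit (resolventWeight n lam s s') b) ≤ n.factorial :=
  symNorm_orbit_le_factorial (fun _ => abs_resolventWeight_le_one h _ _ _) b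

lemma startNorm_nonneg (l : ℕ) (lam s : ℝ) : 0 ≤ startNorm l lam s :=
  mul_nonneg (by positivity) (integral_nonneg fun _ => symNorm_nonneg _)

lemma startNorm_le_one {lam : ℝ} (h : lam ∈ Icc (0 : ℝ) 1) (s : ℝ) : startNorm l lam s ≤ 1 := by
  have h1 : ∫ b, symNorm (orbit (startWeight l lam s) b) ∂cubeMeasure l ≤ l.factorial := by
    refine (integral_mono_of_nonneg (ae_of_all _ fun _ => symNorm_nonneg _) (integrable_const _)
      (ae_of_all _ fun b => symNorm_orbit_startWeight_le h s b)).trans ?_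
    simp
  rw [startNorm, lieAvg, one_div, inv_mul_le_iff₀ (by positivity), mul_one]
  exact h1

/-- The joining of three blocks, the second of length one. -/
def joinBlocks (p : ℝ × (Fin n → ℝ) × (Fin l → ℝ)) : Fin (n + (l + 1)) → ℝ :=
  Fin.append p.2.1 (Fin.cons p.1 p.2.2)

lemma measurable_joinBlocks : Measurable (joinBlocks (n := n) (l := l)) := by
  refine measurable_pi_lambda _ fun i => ?_
  induction i using Fin.addCases with
  | left i => simp only [joinBlocks, Fin.append_left]; fun_prop
  | right j =>
    simp only [joinBlocks, Fin.append_right]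
    cases j using Fin.cases with
    | zero => simp only [Fin.cons_zero]; fun_prop
    | succ j => simp only [Fin.cons_succ]; fun_prop

lemma map_joinBlocks : ((volume.restrict (Icc (0 : ℝ) 1)).prod
    ((cubeMeasure n).prod (cubeMeasure l))).map joinBlocks = cubeMeasure (n + (l + 1)) := by
  conv_rhs => rw [cubeMeasure]
  refine (Measure.pi_eq fun B hB => ?_).symm
  rw [Measure.map_apply measurable_joinBlocks (MeasurableSet.univ_pi hB)]
  have : joinBlocks ⁻¹' (Set.pi univ B) = B (Fin.natAdd n 0) ×ˢ
      ((Set.pi univ fun i => B (Fin.castAdd (l + 1) i)) ×ˢ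
        Set.pi univ fun i : Fin l => B (Fin.natAdd n i.succ)) := by
    ext p
    simp only [mem_preimage, mem_univ_pi, mem_prod, Fin.forall_fin_add, Fin.forall_fin_succ,
      joinBlocks, Fin.append_left, Fin.append_right, Fin.cons_zero, Fin.cons_succ]
    tauto
  rw [this, Measure.prod_prod, Measure.prod_prod, cubeMeasure, cubeMeasure, Measure.pi_pi,
    Measure.pi_pi, Fin.prod_univ_add, Fin.prod_univ_succ]
  ring

/-- The submultiplicativity of the averaged norms with respect to blocks. -/
lemma startNorm_block_le {lam : ℝ} (h : lam ∈ Icc (0 : ℝ) 1) (t : ℝ) :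
    startNorm (n + (l + 1)) lam t ≤
      ∫ s in Icc (0 : ℝ) 1, kernelLie₂ n lam t s * startNorm l lam s := by
  set Φ : (Fin (n + (l + 1)) → ℝ) → ℝ := fun b =>
    symNorm (orbit (resolventWeight n lam t (b (Fin.natAdd n 0)))
      fun i => b (Fin.castAdd (l + 1) i)) *
    symNorm (orbit (startWeight l lam (b (Fin.natAdd n 0))) fun i => b (Fin.natAdd n i.succ))
    with hΦ
  have hΦm : Measurable Φ :=
    (measurable_symNorm_orbit_resolventWeight lam measurable_const (measurable_pi_apply _)
      fun i => measurable_pi_apply _).mul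
    (measurable_symNorm_orbit_startWeight lam (measurable_pi_apply _) fun i => measurable_pi_apply _)
  have hΦ0 : ∀ b, 0 ≤ Φ b := fun b => mul_nonneg (symNorm_nonneg _) (symNorm_nonneg _)
  have hΦb : ∀ b, ‖Φ b‖ ≤ (n.factorial : ℝ) * l.factorial := fun b => by
    rw [Real.norm_of_nonneg (hΦ0 b)]
    exact mul_le_mul (symNorm_orbit_resolventWeight_le h _ _ _) (symNorm_orbit_startWeight_le h _ _)
      (symNorm_nonneg _) (by positivity)
  have hpt : ∀ b, (n.factorial : ℝ) * l.factorial *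
      symNorm (orbit (startWeight (n + (l + 1)) lam t) b) ≤ ∑ σ : Equiv.Perm _, Φ fun i => b (σ i) := by
    intro b
    refine symNorm_block_le (u := fun σ => orbit (resolventWeight n lam t (b (σ (Fin.natAdd n 0))))
      fun i => b (σ (Fin.castAdd (l + 1) i)))
      (v := fun σ => orbit (startWeight l lam (b (σ (Fin.natAdd n 0))))
        fun i => b (σ (Fin.natAdd n i.succ))) fun σ π ρ => ?_
    rw [orbit, startWeight_block]
    simp only [Equiv.Perm.mul_apply, blockPerm_left, blockPerm_mid, blockPerm_right]
    rfl
  clear_value Φ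
  have hmeas : Measurable fun b =>
      symNorm (orbit (startWeight (n + (l + 1)) lam t) b) :=
    measurable_symNorm_orbit_startWeight lam measurable_const fun i => measurable_pi_apply i
  have hint : Integrable (fun b => symNorm (orbit (startWeight (n + (l + 1)) lam t) b))
      (cubeMeasure (n + (l + 1))) := by
    refine Integrable.of_bound hmeas.aestronglyMeasurable ((n + (l + 1)).factorial : ℝ)
      (ae_of_all _ fun b => ?_)
    rw [Real.norm_of_nonneg (symNorm_nonneg _)]
    exact symNorm_orbit_startWeight_le h _ _
  have hΦi : ∀ σ : Equiv.Perm (Fin (n + (l + 1))), Integrable (fun b => Φ fun i => b (σ i))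
      (cubeMeasure (n + (l + 1))) := fun σ =>
    (measurePreserving_perm σ).integrable_comp_of_integrable
      (Integrable.of_bound hΦm.aestronglyMeasurable _ (ae_of_all _ hΦb))
  have h1 : (n.factorial : ℝ) * l.factorial * ∫ b,
      symNorm (orbit (startWeight (n + (l + 1)) lam t) b) ∂cubeMeasure (n + (l + 1)) ≤
        (n + (l + 1)).factorial * ∫ b, Φ b ∂cubeMeasure (n + (l + 1)) := by
    rw [← integral_const_mul]
    refine (integral_mono (hint.const_mul _) (integrable_finsetSum _ fun σ _ => hΦi σ)
      hpt).trans (le_of_eq ?_)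
    rw [integral_finsetSum _ fun σ _ => hΦi σ]
    simp only [integral_comp_perm _ hΦm.aestronglyMeasurable]
    simp [Finset.card_univ, Fintype.card_perm]
  have h2 : ∫ b, Φ b ∂cubeMeasure (n + (l + 1)) = (n.factorial : ℝ) * l.factorial *
      ∫ s in Icc (0 : ℝ) 1, kernelLie₂ n lam t s * startNorm l lam s := by
    rw [← map_joinBlocks, integral_map measurable_joinBlocks.aemeasurable hΦm.aestronglyMeasurable,
      integral_prod, ← integral_const_mul]
    · refine integral_congr_ae (ae_of_all _ fun s => ?_)
      simp only [hΦ, joinBlocks, Fin.append_left, Fin.append_right, Fin.cons_zero, Fin.cons_succ]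
      rw [integral_prod_mul (μ := cubeMeasure n) (ν := cubeMeasure l)
        (fun x : Fin n → ℝ => symNorm (orbit (resolventWeight n lam t s) x))
        (fun y : Fin l → ℝ => symNorm (orbit (startWeight l lam s) y)), kernelLie₂_eq, startNorm,
        lieAvg, orbitAvg]
      have := n.factorial_ne_zero
      have := l.factorial_ne_zero
      field_simp
    · exact Integrable.of_bound (hΦm.comp measurable_joinBlocks).aestronglyMeasurable _
        (ae_of_all _ fun p => hΦb _)
  rw [h2] at h1
  rw [startNorm, lieAvg, one_div, inv_mul_le_iff₀ (by positivity)]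
  refine le_of_mul_le_mul_left (h1.trans (le_of_eq ?_))
    (by positivity : (0 : ℝ) < (n.factorial : ℝ) * l.factorial)
  ring

end

/-! ### The associative kernels as iterated transfer operators -/

section

variable {n l : ℕ} {lam : ℝ}

lemma measurable_finCons : Measurable fun p : ℝ × (Fin n → ℝ) =>
    (Fin.cons p.1 p.2 : Fin (n + 1) → ℝ) := by
  refine measurable_pi_lambda _ fun i => ?_
  cases i using Fin.cases with
  | zero => simp only [Fin.cons_zero]; fun_prop
  | succ j => simp only [Fin.cons_succ]; fun_prop

lemma map_finCons : ((volume.restrict (Icc (0 : ℝ) 1)).prod (cubeMeasure n)).map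
    (fun p => (Fin.cons p.1 p.2 : Fin (n + 1) → ℝ)) = cubeMeasure (n + 1) := by
  conv_rhs => rw [cubeMeasure]
  refine (Measure.pi_eq fun B hB => ?_).symm
  rw [Measure.map_apply measurable_finCons (MeasurableSet.univ_pi hB)]
  have : (fun p : ℝ × (Fin n → ℝ) => (Fin.cons p.1 p.2 : Fin (n + 1) → ℝ)) ⁻¹' (Set.pi univ B) =
      B 0 ×ˢ (Set.pi univ fun i : Fin n => B i.succ) := by
    ext p
    simp only [mem_preimage, mem_univ_pi, mem_prod, Fin.forall_fin_succ, Fin.cons_zero,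
      Fin.cons_succ]
  rw [this, Measure.prod_prod, cubeMeasure, Measure.pi_pi, Fin.prod_univ_succ]

lemma resolventWeight_cons (lam t s u : ℝ) (y : Fin n → ℝ) :
    resolventWeight (n + 1) lam t s (Fin.cons u y) =
      stepWeight lam t u * resolventWeight n lam u s y := by
  rw [resolventWeight_eq, resolventWeight_eq, List.ofFn_succ, List.cons_append,
    listWeight_cons_cons]
  simp

lemma measurable_stepWeight (lam : ℝ) {Ω : Type*} [MeasurableSpace Ω] {f g : Ω → ℝ}
    (hf : Measurable f) (hg : Measurable g) : Measurable fun ω => stepWeight lam (f ω) (g ω) :=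
  Measurable.ite (measurableSet_lt hf hg) measurable_const
    (Measurable.ite (measurableSet_lt hg hf) measurable_const measurable_const)

lemma abs_stepWeight_le_one (h : lam ∈ Icc (0 : ℝ) 1) (t u : ℝ) : |stepWeight lam t u| ≤ 1 := by
  have h1 := h.1
  have h2 := h.2
  unfold stepWeight
  split_ifs
  · rwa [abs_of_nonneg h1]
  · rw [abs_of_nonpos (by linarith)]; linarith
  · simp

lemma kernel₂_nonneg (n : ℕ) (lam t s : ℝ) : 0 ≤ kernel₂ n lam t s := by
  rw [kernel₂, assocNorm_eq]
  exact integral_nonneg fun _ => abs_nonneg _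

lemma kernel₂_le_one (h : lam ∈ Icc (0 : ℝ) 1) (t s : ℝ) : kernel₂ n lam t s ≤ 1 := by
  rw [kernel₂, assocNorm_eq]
  refine (integral_mono_of_nonneg (ae_of_all _ fun _ => abs_nonneg _) (integrable_const 1)
    (ae_of_all _ fun b => abs_resolventWeight_le_one h _ _ _)).trans ?_
  simp

lemma kernel₂_zero (lam t s : ℝ) : kernel₂ 0 lam t s = |stepWeight lam t s| := by
  have : ∀ y : Fin 0 → ℝ, resolventWeight 0 lam t s y = stepWeight lam t s := fun y => by
    rw [resolventWeight_eq, List.ofFn_zero, List.nil_append, listWeight_cons_cons]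
    simp [listWeight]
  rw [kernel₂, assocNorm_eq]
  simp [this]

lemma kernel₂_succ (h : lam ∈ Icc (0 : ℝ) 1) (t s : ℝ) : kernel₂ (n + 1) lam t s =
    ∫ u in Icc (0 : ℝ) 1, |stepWeight lam t u| * kernel₂ n lam u s := by
  have hm : Measurable fun b => |resolventWeight (n + 1) lam t s b| :=
    continuous_abs.measurable.comp (measurable_resolventWeight _ _ _ _)
  rw [kernel₂, assocNorm_eq, ← map_finCons, integral_map measurable_finCons.aemeasurable
    hm.aestronglyMeasurable, integral_prod]
  · refine integral_congr_ae (ae_of_all _ fun u => ?_)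
    simp only [resolventWeight_cons, abs_mul]
    rw [integral_const_mul, kernel₂, assocNorm_eq]
  · exact Integrable.of_bound (hm.comp measurable_finCons).aestronglyMeasurable 1
      (ae_of_all _ fun p => by simpa using abs_resolventWeight_le_one h _ _ _)

lemma measurable_kernel₂ (n : ℕ) (lam : ℝ) :
    Measurable fun p : ℝ × ℝ => kernel₂ n lam p.1 p.2 := by
  simp only [kernel₂, assocNorm_eq]
  refine (StronglyMeasurable.integral_prod_right (f := fun (p : ℝ × ℝ) (y : Fin n → ℝ) =>
    |resolventWeight n lam p.1 p.2 y|) ?_).measurable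
  exact (continuous_abs.measurable.comp (measurable_resolventWeight' lam (by fun_prop)
    (by fun_prop) fun i => by fun_prop)).stronglyMeasurable

lemma measurable_kernelLie₂ (n : ℕ) (lam : ℝ) :
    Measurable fun p : ℝ × ℝ => kernelLie₂ n lam p.1 p.2 := by
  simp only [kernelLie₂_eq, orbitAvg]
  refine measurable_const.mul (StronglyMeasurable.integral_prod_right
    (f := fun (p : ℝ × ℝ) (y : Fin n → ℝ) =>
      symNorm (orbit (resolventWeight n lam p.1 p.2) y)) ?_).measurable
  exact (measurable_symNorm_orbit_resolventWeight lam (by fun_prop) (by fun_prop)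
    fun i => by fun_prop).stronglyMeasurable

lemma integrableOn_kernel₂_mul (h : lam ∈ Icc (0 : ℝ) 1) (t : ℝ) {f : ℝ → ℝ} {H : ℝ}
    (hf : Measurable f) (hH : ∀ s, |f s| ≤ H) :
    IntegrableOn (fun s => kernel₂ n lam t s * f s) (Icc 0 1) := by
  refine Integrable.of_bound (((measurable_kernel₂ n lam).comp
    (measurable_const.prodMk measurable_id)).mul hf).aestronglyMeasurable H
    (ae_of_all _ fun s => ?_)
  rw [norm_mul, Real.norm_of_nonneg (kernel₂_nonneg _ _ _ _)]
  exact (mul_le_of_le_one_left (abs_nonneg _) (kernel₂_le_one h _ _)).trans (hH s)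

lemma integrableOn_kernelLie₂_mul (h : lam ∈ Icc (0 : ℝ) 1) (t : ℝ) {f : ℝ → ℝ} {H : ℝ}
    (hf : Measurable f) (hH : ∀ s, |f s| ≤ H) :
    IntegrableOn (fun s => kernelLie₂ n lam t s * f s) (Icc 0 1) := by
  refine Integrable.of_bound (((measurable_kernelLie₂ n lam).comp
    (measurable_const.prodMk measurable_id)).mul hf).aestronglyMeasurable H
    (ae_of_all _ fun s => ?_)
  rw [norm_mul, Real.norm_of_nonneg (kernelLie₂_nonneg _ _ _ _)]
  exact (mul_le_of_le_one_left (abs_nonneg _)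
    ((kernelLie₂_le_kernel₂ _ _ _ _).trans (kernel₂_le_one h _ _))).trans (hH s)

/-- A function which is reproduced up to the factor `w` by the transfer operator with the kernel
`|stepWeight|` is reproduced up to the factor `w ^ (n + 1)` by the associative kernel. -/
lemma integral_kernel₂_mul_le (h : lam ∈ Icc (0 : ℝ) 1) {f : ℝ → ℝ} {H w : ℝ}
    (hf : Measurable f) (hH : ∀ s, |f s| ≤ H) (hw : 0 ≤ w)
    (hT : ∀ t ∈ Icc (0 : ℝ) 1, ∫ u in Icc (0 : ℝ) 1, |stepWeight lam t u| * f u ≤ w * f t)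
    (n : ℕ) : ∀ t ∈ Icc (0 : ℝ) 1,
      ∫ s in Icc (0 : ℝ) 1, kernel₂ n lam t s * f s ≤ w ^ (n + 1) * f t := by
  induction n with
  | zero => simpa only [kernel₂_zero, zero_add, pow_one] using hT
  | succ n ih =>
    intro t ht
    have hsw : Measurable fun u => |stepWeight lam t u| :=
      continuous_abs.measurable.comp (measurable_stepWeight lam measurable_const measurable_id)
    have hint : Integrable (fun p : ℝ × ℝ => |stepWeight lam t p.2| * kernel₂ n lam p.2 p.1 * f p.1)
        ((volume.restrict (Icc (0 : ℝ) 1)).prod (volume.restrict (Icc (0 : ℝ) 1))) := by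
      refine Integrable.of_bound (Measurable.aestronglyMeasurable ?_) H (ae_of_all _ fun p => ?_)
      · exact ((hsw.comp measurable_snd).mul ((measurable_kernel₂ n lam).comp
          (measurable_snd.prodMk measurable_fst))).mul (hf.comp measurable_fst)
      · rw [norm_mul, norm_mul, Real.norm_of_nonneg (kernel₂_nonneg _ _ _ _), norm_abs_eq_norm]
        refine (mul_le_of_le_one_left (abs_nonneg _) ?_).trans (hH _)
        exact mul_le_one₀ (abs_stepWeight_le_one h _ _) (kernel₂_nonneg _ _ _ _)
          (kernel₂_le_one h _ _)
    have hi : IntegrableOn (fun u => |stepWeight lam t u| * (w ^ (n + 1) * f u)) (Icc 0 1) := by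
      refine Integrable.of_bound (hsw.mul (hf.const_mul _)).aestronglyMeasurable (w ^ (n + 1) * H)
        (ae_of_all _ fun u => ?_)
      rw [norm_mul, norm_mul, norm_abs_eq_norm, Real.norm_of_nonneg (pow_nonneg hw _)]
      refine (mul_le_of_le_one_left (by positivity) (abs_stepWeight_le_one h _ _)).trans ?_
      exact mul_le_mul_of_nonneg_left (hH u) (by positivity)
    calc ∫ s in Icc (0 : ℝ) 1, kernel₂ (n + 1) lam t s * f s
        = ∫ s in Icc (0 : ℝ) 1, ∫ u in Icc (0 : ℝ) 1,
            |stepWeight lam t u| * kernel₂ n lam u s * f s := by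
          simp only [kernel₂_succ h, integral_mul_const]
      _ = ∫ u in Icc (0 : ℝ) 1, ∫ s in Icc (0 : ℝ) 1,
            |stepWeight lam t u| * kernel₂ n lam u s * f s := integral_integral_swap hint
      _ = ∫ u in Icc (0 : ℝ) 1, |stepWeight lam t u| *
            ∫ s in Icc (0 : ℝ) 1, kernel₂ n lam u s * f s := by
          simp only [mul_assoc, integral_const_mul]
      _ ≤ ∫ u in Icc (0 : ℝ) 1, |stepWeight lam t u| * (w ^ (n + 1) * f u) := by
          refine setIntegral_mono_on ?_ hi measurableSet_Icc fun u hu =>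
            mul_le_mul_of_nonneg_left (ih u hu) (abs_nonneg _)
          have := hint.integral_prod_right
          simpa only [mul_assoc, integral_const_mul, IntegrableOn] using this
      _ = w ^ (n + 1) * ∫ u in Icc (0 : ℝ) 1, |stepWeight lam t u| * f u := by
          rw [← integral_const_mul]
          simp only [mul_left_comm]
      _ ≤ w ^ (n + 1) * (w * f t) := mul_le_mul_of_nonneg_left (hT t ht) (by positivity)
      _ = w ^ (n + 1 + 1) * f t := by ring

/-- The averaged norms of long words are controlled by the Lie kernel. -/
lemma startNorm_le_pow (h : lam ∈ Icc (0 : ℝ) 1) {f : ℝ → ℝ} {H κ : ℝ}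
    (hf : Measurable f) (h1 : ∀ s, 1 ≤ f s) (hH : ∀ s, f s ≤ H) (hκ : 0 ≤ κ)
    (hK : ∀ t ∈ Icc (0 : ℝ) 1, ∫ s in Icc (0 : ℝ) 1, kernelLie₂ n lam t s * f s ≤ κ * f t)
    (q r : ℕ) : ∀ t ∈ Icc (0 : ℝ) 1, startNorm (q * (n + 1) + r) lam t ≤ κ ^ q * f t := by
  induction q with
  | zero =>
    intro t _
    rw [pow_zero, one_mul]
    exact (startNorm_le_one h t).trans (h1 t)
  | succ q ih =>
    intro t ht
    have e : (q + 1) * (n + 1) + r = n + (q * (n + 1) + r + 1) := by ring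
    rw [e]
    refine (startNorm_block_le h t).trans ?_
    have hi : IntegrableOn (fun s => kernelLie₂ n lam t s * (κ ^ q * f s)) (Icc 0 1) := by
      refine integrableOn_kernelLie₂_mul h t (hf.const_mul _) (H := κ ^ q * H) fun s => ?_
      rw [abs_of_nonneg (mul_nonneg (by positivity) (zero_le_one.trans (h1 s)))]
      exact mul_le_mul_of_nonneg_left (hH s) (by positivity)
    refine (integral_mono_of_nonneg (ae_of_all _ fun s => mul_nonneg (kernelLie₂_nonneg _ _ _ _)
      (startNorm_nonneg _ _ _)) hi (ae_restrict_of_forall_mem measurableSet_Icc fun s hs =>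
        mul_le_mul_of_nonneg_left (ih s hs) (kernelLie₂_nonneg _ _ _ _))).trans ?_
    simp only [mul_left_comm _ (κ ^ q)]
    rw [integral_const_mul, pow_succ, mul_assoc]
    exact mul_le_mul_of_nonneg_left (hK t ht) (by positivity)

/-! ### Exponential functions and the transfer operator -/

/-- The exponential function with rate `c` on the unit interval, extended by constants. -/
def clampExp (c s : ℝ) : ℝ := Real.exp (c * max 0 (min 1 s))

lemma measurable_clampExp (c : ℝ) : Measurable (clampExp c) := by
  unfold clampExp; fun_prop

lemma clampExp_of_mem {c s : ℝ} (hs : s ∈ Icc (0 : ℝ) 1) : clampExp c s = Real.exp (c * s) := by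
  rw [clampExp, min_eq_right hs.2, max_eq_right hs.1]

lemma clampExp_pos (c s : ℝ) : 0 < clampExp c s := Real.exp_pos _

lemma exp_neg_le_clampExp {c a : ℝ} (hc : |c| ≤ a) (s : ℝ) : Real.exp (-a) ≤ clampExp c s := by
  refine Real.exp_le_exp.2 ?_
  have h0 : 0 ≤ max 0 (min 1 s) := le_max_left _ _
  have h1 : max 0 (min 1 s) ≤ 1 := max_le zero_le_one (min_le_left _ _)
  have := (abs_le.1 hc).1
  have : 0 ≤ a := (abs_nonneg c).trans hc
  nlinarith

lemma clampExp_le {c a : ℝ} (hc : |c| ≤ a) (s : ℝ) : clampExp c s ≤ Real.exp a := by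
  refine Real.exp_le_exp.2 ?_
  have h0 : 0 ≤ max 0 (min 1 s) := le_max_left _ _
  have h1 : max 0 (min 1 s) ≤ 1 := max_le zero_le_one (min_le_left _ _)
  have := (abs_le.1 hc).2
  have : 0 ≤ a := (abs_nonneg c).trans hc
  nlinarith

lemma transfer_clampExp (h : lam ∈ Icc (0 : ℝ) 1) (c : ℝ) {t : ℝ} (ht : t ∈ Icc (0 : ℝ) 1) :
    ∫ u in Icc (0 : ℝ) 1, |stepWeight lam t u| * clampExp c u =
      (1 - lam) * (∫ u in (0 : ℝ)..t, Real.exp (c * u)) +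
        lam * ∫ u in t..(1 : ℝ), Real.exp (c * u) := by
  have hi : IntegrableOn (fun u => |stepWeight lam t u| * clampExp c u) (Icc 0 1) := by
    simpa only [kernel₂_zero] using integrableOn_kernel₂_mul (n := 0) h t (measurable_clampExp c)
      (H := Real.exp |c|) fun s => by
        rw [clampExp, abs_of_nonneg (Real.exp_pos _).le]; exact clampExp_le le_rfl s
  rw [integral_Icc_eq_integral_Ioc, ← intervalIntegral.integral_of_le zero_le_one,
    ← intervalIntegral.integral_add_adjacent_intervals (b := t)]
  · congr 1
    · rw [intervalIntegral.integral_of_le ht.1, intervalIntegral.integral_of_le ht.1,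
        integral_Ioc_eq_integral_Ioo, integral_Ioc_eq_integral_Ioo, ← integral_const_mul]
      refine setIntegral_congr_fun measurableSet_Ioo fun u hu => ?_
      rw [clampExp_of_mem ⟨hu.1.le, hu.2.le.trans ht.2⟩, stepWeight, if_neg hu.2.not_gt,
        if_pos hu.2, abs_of_nonpos (by linarith [h.2]), neg_sub]
    · rw [intervalIntegral.integral_of_le ht.2, intervalIntegral.integral_of_le ht.2,
        ← integral_const_mul]
      refine setIntegral_congr_fun measurableSet_Ioc fun u hu => ?_
      rw [clampExp_of_mem ⟨ht.1.trans hu.1.le, hu.2⟩, stepWeight, if_pos hu.1,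
        abs_of_nonneg h.1]
  · rw [intervalIntegrable_iff_integrableOn_Icc_of_le ht.1]
    exact hi.mono_set (Icc_subset_Icc_right ht.2)
  · rw [intervalIntegrable_iff_integrableOn_Icc_of_le ht.2]
    exact hi.mono_set (Icc_subset_Icc_left ht.1)

lemma integral_exp_mul {c : ℝ} (hc : c ≠ 0) (a b : ℝ) :
    ∫ u in a..b, Real.exp (c * u) = (Real.exp (c * b) - Real.exp (c * a)) / c := by
  rw [intervalIntegral.integral_comp_mul_left _ hc, integral_exp, smul_eq_mul, inv_mul_eq_div]

/-- The exponential function with rate `log ((1 - λ) / λ)` is an eigenfunction of the transfer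
operator with eigenvalue `w(λ)`. -/
lemma transfer_clampExp_log (h : lam ∈ Ioo (0 : ℝ) 1) {t : ℝ} (ht : t ∈ Icc (0 : ℝ) 1) :
    ∫ u in Icc (0 : ℝ) 1, |stepWeight lam t u| * clampExp (Real.log ((1 - lam) / lam)) u =
      weight lam * clampExp (Real.log ((1 - lam) / lam)) t := by
  rw [transfer_clampExp (Ioo_subset_Icc_self h) _ ht, clampExp_of_mem ht, weight,
    if_pos (show 0 < lam ∧ lam < 1 from h)]
  split_ifs with h2
  · subst h2
    norm_num
    ring
  · have hpos : 0 < (1 - lam) / lam := div_pos (by linarith [h.2]) h.1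
    have hc : Real.log ((1 - lam) / lam) ≠ 0 := by
      refine Real.log_ne_zero_of_pos_of_ne_one hpos fun h1 => h2 ?_
      rw [div_eq_one_iff_eq h.1.ne'] at h1
      linarith
    rw [integral_exp_mul hc, integral_exp_mul hc, mul_zero, Real.exp_zero, mul_one,
      Real.exp_log hpos]
    have := h.1.ne'
    field_simp
    ring

/-- Near the left end point of the parameter interval, exponential functions with a positive rate
are almost reproduced by the transfer operator. -/
lemma transfer_clampExp_le (h : lam ∈ Ioo (0 : ℝ) 1) {c : ℝ} (hc : 0 < c)
    (hlam : lam ≤ Real.exp (-c)) {t : ℝ} (ht : t ∈ Icc (0 : ℝ) 1) :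
    ∫ u in Icc (0 : ℝ) 1, |stepWeight lam t u| * clampExp c u ≤ 2 / c * clampExp c t := by
  rw [transfer_clampExp (Ioo_subset_Icc_self h) _ ht, clampExp_of_mem ht,
    integral_exp_mul hc.ne', integral_exp_mul hc.ne', mul_zero, Real.exp_zero, mul_one,
    mul_div_assoc', mul_div_assoc', ← add_div, div_mul_eq_mul_div]
  refine div_le_div_of_nonneg_right ?_ hc.le
  have h1 : 1 ≤ Real.exp (c * t) := Real.one_le_exp (mul_nonneg hc.le ht.1)
  have h2 : lam * Real.exp c ≤ 1 := by
    rw [Real.exp_neg, ← one_div, le_div_iff₀ (Real.exp_pos c)] at hlam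
    exact hlam
  nlinarith [h.1, h.2]

/-- Near the right end point of the parameter interval, exponential functions with a negative
rate are almost reproduced by the transfer operator. -/
lemma transfer_clampExp_neg_le (h : lam ∈ Ioo (0 : ℝ) 1) {c : ℝ} (hc : 0 < c)
    (hlam : 1 - lam ≤ Real.exp (-c)) {t : ℝ} (ht : t ∈ Icc (0 : ℝ) 1) :
    ∫ u in Icc (0 : ℝ) 1, |stepWeight lam t u| * clampExp (-c) u ≤ 2 / c * clampExp (-c) t := by
  rw [transfer_clampExp (Ioo_subset_Icc_self h) _ ht, clampExp_of_mem ht,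
    integral_exp_mul (neg_ne_zero.2 hc.ne'), integral_exp_mul (neg_ne_zero.2 hc.ne'), mul_zero,
    Real.exp_zero, mul_one, mul_div_assoc', mul_div_assoc', ← add_div, div_neg, ← neg_div,
    div_mul_eq_mul_div]
  refine div_le_div_of_nonneg_right ?_ hc.le
  have h1 : Real.exp (-c) ≤ Real.exp (-c * t) := Real.exp_le_exp.2 (by nlinarith [ht.2])
  have h2 := Real.exp_pos (-c)
  nlinarith [h.1, h.2]

end

/-! ### The convergence radius -/

section

variable {n : ℕ} {lam : ℝ}

lemma kernelLie₂_eq_kernelLie (hn : 1 ≤ n) (lam : ℝ) {t₀ t' : ℝ} (h₀ : t₀ ∈ Icc (0 : ℝ) 1)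
    (h' : t' ∈ Icc (0 : ℝ) 1) : kernelLie₂ n lam t₀ t' = kernelLie n lam (t' - t₀) := by
  rw [kernelLie, kernelLie₂_eq, kernelLie₂_eq,
    orbitAvg_sub continuous_symNorm symNorm_smul hn lam h₀ h']

lemma kernel₂_eq_kernel (hn : 1 ≤ n) (lam : ℝ) {t₀ t' : ℝ} (h₀ : t₀ ∈ Icc (0 : ℝ) 1)
    (h' : t' ∈ Icc (0 : ℝ) 1) : kernel₂ n lam t₀ t' = kernel n lam (t' - t₀) := by
  rw [kernel, kernel₂_eq, kernel₂_eq,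
    orbitAvg_sub continuous_l1Norm l1Norm_smul hn lam h₀ h']

lemma kernelLie₂_le_ratioS_mul (hn : 1 ≤ n) (hlam : lam ∈ Ioo (0 : ℝ) 1) {t s : ℝ}
    (ht : t ∈ Icc (0 : ℝ) 1) (hs : s ∈ Icc (0 : ℝ) 1) :
    kernelLie₂ n lam t s ≤ ratioS n lam * kernel₂ n lam t s := by
  rw [kernelLie₂_eq_kernelLie hn lam ht hs, kernel₂_eq_kernel hn lam ht hs,
    ← div_le_iff₀ (kernel_pos hlam _)]
  exact (isGreatest_ratioS hn hlam).2
    ⟨s - t, ⟨by linarith [hs.1, ht.2], by linarith [hs.2, ht.1]⟩, rfl⟩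

lemma ratioS_nonneg (hn : 1 ≤ n) (hlam : lam ∈ Ioo (0 : ℝ) 1) : 0 ≤ ratioS n lam :=
  (kernelRatio_pos hlam 0).le.trans
    ((isGreatest_ratioS hn hlam).2 ⟨0, by norm_num, rfl⟩)

lemma resolventRate_pow (hn : 1 ≤ n) (hlam : lam ∈ Ioo (0 : ℝ) 1) :
    resolventRate n lam ^ (n + 1) = ratioS n lam * weight lam ^ (n + 1) := by
  have hr := ratioS_nonneg hn hlam
  rw [resolventRate, mul_pow, mul_comm]
  congr 1
  rw [← Real.rpow_natCast, ← Real.rpow_mul hr]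
  push_cast
  rw [one_div_mul_cancel (by positivity), Real.rpow_one]

lemma integral_kernelLie₂_le_of_transfer (hlam : lam ∈ Ioo (0 : ℝ) 1) {c w a : ℝ}
    (hw : 0 ≤ w) (hT : ∀ t ∈ Icc (0 : ℝ) 1,
      ∫ u in Icc (0 : ℝ) 1, |stepWeight lam t u| * clampExp c u ≤ w * clampExp c t)
    (ha : |c| ≤ a) {t : ℝ} (ht : t ∈ Icc (0 : ℝ) 1) :
    ∫ s in Icc (0 : ℝ) 1, kernel₂ n lam t s * (Real.exp a * clampExp c s) ≤
      w ^ (n + 1) * (Real.exp a * clampExp c t) := by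
  have h1 := integral_kernel₂_mul_le (Ioo_subset_Icc_self hlam) (measurable_clampExp c)
    (H := Real.exp a) (fun s => by
      rw [abs_of_pos (clampExp_pos _ _)]; exact clampExp_le ha s) hw hT n t ht
  have h2 : ∫ s in Icc (0 : ℝ) 1, kernel₂ n lam t s * (Real.exp a * clampExp c s) =
      Real.exp a * ∫ s in Icc (0 : ℝ) 1, kernel₂ n lam t s * clampExp c s := by
    rw [← integral_const_mul]
    simp only [mul_left_comm]
  rw [h2, mul_left_comm]
  exact mul_le_mul_of_nonneg_left h1 (Real.exp_pos a).le

/-- For every parameter there is a test function, bounded independently of the parameter, which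
is reproduced by the Lie kernel up to the maximal rate. -/
lemma exists_testFunction (hn : 1 ≤ n) {m : ℝ} (hm : 0 < m) (hlam : lam ∈ Ioo (0 : ℝ) 1)
    (hrate : resolventRate n lam ≤ m) : ∃ f : ℝ → ℝ, Measurable f ∧ (∀ s, 1 ≤ f s) ∧
      (∀ s, f s ≤ Real.exp (2 / m) * Real.exp (2 / m)) ∧ ∀ t ∈ Icc (0 : ℝ) 1,
        ∫ s in Icc (0 : ℝ) 1, kernelLie₂ n lam t s * f s ≤ m ^ (n + 1) * f t := by
  have hc : 0 < 2 / m := by positivity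
  have hcm : 2 / (2 / m) = m := by field_simp
  -- It suffices to find a suitable exponential function.
  suffices ∃ c : ℝ, |c| ≤ 2 / m ∧ ∀ t ∈ Icc (0 : ℝ) 1, ∫ s in Icc (0 : ℝ) 1,
      kernelLie₂ n lam t s * (Real.exp (2 / m) * clampExp c s) ≤
        m ^ (n + 1) * (Real.exp (2 / m) * clampExp c t) by
    obtain ⟨c, h1, h2⟩ := this
    refine ⟨fun s => Real.exp (2 / m) * clampExp c s, (measurable_clampExp c).const_mul _,
      fun s => ?_, fun s => ?_, h2⟩
    · have := mul_le_mul_of_nonneg_left (exp_neg_le_clampExp h1 s) (Real.exp_pos (2 / m)).le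
      rwa [← Real.exp_add, add_neg_cancel, Real.exp_zero] at this
    · exact mul_le_mul_of_nonneg_left (clampExp_le h1 s) (Real.exp_pos _).le
  have hlam' := Ioo_subset_Icc_self hlam
  have hbd : ∀ c : ℝ, |c| ≤ 2 / m → ∀ s,
      |Real.exp (2 / m) * clampExp c s| ≤ Real.exp (2 / m) * Real.exp (2 / m) := by
    intro c hc s
    rw [abs_of_pos (mul_pos (Real.exp_pos _) (clampExp_pos _ _))]
    exact mul_le_mul_of_nonneg_left (clampExp_le hc s) (Real.exp_pos _).le
  have hpos : ∀ c s, 0 ≤ Real.exp (2 / m) * clampExp c s := fun c s =>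
    (mul_pos (Real.exp_pos _) (clampExp_pos _ _)).le
  -- Near the end points the associative kernel is already small enough.
  have hend : ∀ c : ℝ, |c| ≤ 2 / m → (∀ t ∈ Icc (0 : ℝ) 1,
      ∫ u in Icc (0 : ℝ) 1, |stepWeight lam t u| * clampExp c u ≤ m * clampExp c t) →
      ∀ t ∈ Icc (0 : ℝ) 1, ∫ s in Icc (0 : ℝ) 1,
        kernelLie₂ n lam t s * (Real.exp (2 / m) * clampExp c s) ≤
          m ^ (n + 1) * (Real.exp (2 / m) * clampExp c t) := by
    intro c h1 hT t ht
    refine le_trans (setIntegral_mono_on ?_ ?_ measurableSet_Icc fun s _ =>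
      mul_le_mul_of_nonneg_right (kernelLie₂_le_kernel₂ n lam t s) (hpos c s))
      (integral_kernelLie₂_le_of_transfer hlam hm.le hT h1 ht)
    · exact integrableOn_kernelLie₂_mul hlam' t ((measurable_clampExp c).const_mul _) (hbd c h1)
    · exact integrableOn_kernel₂_mul hlam' t ((measurable_clampExp c).const_mul _) (hbd c h1)
  by_cases hl : lam ≤ Real.exp (-(2 / m))
  · refine ⟨2 / m, (abs_of_pos hc).le, hend _ (abs_of_pos hc).le fun t ht => ?_⟩
    have := transfer_clampExp_le hlam hc hl ht
    rwa [hcm] at this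
  by_cases hr : 1 - lam ≤ Real.exp (-(2 / m))
  · have habs : |-(2 / m)| ≤ 2 / m := by rw [abs_neg, abs_of_pos hc]
    refine ⟨-(2 / m), habs, hend _ habs fun t ht => ?_⟩
    have := transfer_clampExp_neg_le hlam hc hr ht
    rwa [hcm] at this
  push Not at hl hr
  have h1 : 0 < 1 - lam := by linarith [hlam.2]
  have habs : |Real.log ((1 - lam) / lam)| ≤ 2 / m := by
    have e1 := Real.log_lt_log (Real.exp_pos _) hl
    have e2 := Real.log_lt_log (Real.exp_pos _) hr
    rw [Real.log_exp] at e1 e2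
    have e3 : Real.log lam < 0 := Real.log_neg hlam.1 hlam.2
    have e4 : Real.log (1 - lam) < 0 := Real.log_neg h1 (by linarith [hlam.1])
    rw [Real.log_div h1.ne' hlam.1.ne', abs_le]
    constructor <;> linarith
  refine ⟨_, habs, fun t ht => ?_⟩
  have hS := ratioS_nonneg hn hlam
  have e1 : ∫ s in Icc (0 : ℝ) 1, kernelLie₂ n lam t s *
      (Real.exp (2 / m) * clampExp (Real.log ((1 - lam) / lam)) s) ≤
      ∫ s in Icc (0 : ℝ) 1, ratioS n lam * (kernel₂ n lam t s *
        (Real.exp (2 / m) * clampExp (Real.log ((1 - lam) / lam)) s)) := by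
    refine setIntegral_mono_on ?_ ?_ measurableSet_Icc fun s hs => ?_
    · exact integrableOn_kernelLie₂_mul hlam' t ((measurable_clampExp _).const_mul _) (hbd _ habs)
    · exact (integrableOn_kernel₂_mul hlam' t ((measurable_clampExp _).const_mul _)
        (hbd _ habs)).const_mul _
    · rw [← mul_assoc (ratioS n lam)]
      exact mul_le_mul_of_nonneg_right (kernelLie₂_le_ratioS_mul hn hlam ht hs) (hpos _ _)
  refine e1.trans ?_
  rw [integral_const_mul]
  refine (mul_le_mul_of_nonneg_left (integral_kernelLie₂_le_of_transfer (n := n) hlam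
    (weight_nonneg lam) (fun t ht => (transfer_clampExp_log hlam ht).le) habs ht) hS).trans ?_
  rw [← mul_assoc, ← resolventRate_pow hn hlam]
  exact mul_le_mul_of_nonneg_right (pow_le_pow_left₀ (resolventRate_pos hn hlam).le hrate _)
    (hpos _ _)

/-- Every injective family becomes increasing after a permutation. -/
lemma exists_strictMono_comp {b : Fin n → ℝ} (hb : Function.Injective b) :
    ∃ τ : Equiv.Perm (Fin n), StrictMono fun i => b (τ i) :=
  ⟨Tuple.sort b, (Tuple.monotone_sort b).strictMono_of_injective
    (hb.comp (Tuple.sort b).injective)⟩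

lemma symNorm_orbit_perm (f : (Fin n → ℝ) → ℝ) (b : Fin n → ℝ) (τ : Equiv.Perm (Fin n)) :
    symNorm (orbit f fun i => b (τ i)) = symNorm (orbit f b) :=
  symNorm_comp_mul_left τ (orbit f b)

lemma lieAvg_eq_of_strictMono {f : (Fin n → ℝ) → ℝ} {C : ℝ}
    (h : ∀ b : Fin n → ℝ, StrictMono b → (∀ i, b i ∈ Ioo (0 : ℝ) 1) → symNorm (orbit f b) = C) :
    lieAvg f = 1 / (n.factorial : ℝ) * C := by
  rw [lieAvg]
  congr 1
  have : ∀ᵐ b ∂cubeMeasure n, symNorm (orbit f b) = C := by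
    filter_upwards [ae_injective n, ae_mem_Ioo n] with b h1 h2
    obtain ⟨τ, hτ⟩ := exists_strictMono_comp h1
    rw [← symNorm_orbit_perm f b τ]
    exact h _ hτ fun i => h2 _
  rw [integral_congr_ae this]
  simp

lemma startNorm_eq (k : ℕ) {lam s a : ℝ}
    (ha : ∀ x ∈ Ioo (0 : ℝ) 1, stepWeight lam s x = a) :
    startNorm (k + 1) lam s = 1 / ((k + 1).factorial : ℝ) *
      (|a| * symNorm fun σ : Equiv.Perm (Fin (k + 1)) => listWeight lam (List.ofFn σ)) := by
  refine lieAvg_eq_of_strictMono fun b hb hb' => ?_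
  rw [← symNorm_smul]
  congr 1
  funext σ
  have e : List.ofFn (fun i => b (σ i)) = (List.ofFn σ).map b := by rw [List.map_ofFn]; rfl
  have e2 : listWeight lam (List.ofFn fun i => b (σ i)) = listWeight lam (List.ofFn σ) := by
    rw [e]
    exact listWeight_map lam fun x _ y _ => hb.lt_iff_lt
  rw [Pi.smul_apply, smul_eq_mul, ← e2, orbit, startWeight, List.ofFn_succ, listWeight_cons_cons,
    ha _ (hb' _)]

/-- Uniform exponential bounds of the norms of the resolvent polynomials. -/
lemma symNorm_listWeight_le (hn : 1 ≤ n) {m : ℝ} (hm : 0 < m) (hlam : lam ∈ Ioo (0 : ℝ) 1)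
    (hrate : resolventRate n lam ≤ m) (q r k : ℕ) (hk : q * (n + 1) + r = k + 1) :
    symNorm (fun σ : Equiv.Perm (Fin (k + 1)) => listWeight lam (List.ofFn σ)) ≤
      (k + 1).factorial *
        (2 * (Real.exp (2 / m) * Real.exp (2 / m)) * (m ^ (n + 1)) ^ q) := by
  obtain ⟨f, hf, h1, hH, hK⟩ := exists_testFunction hn hm hlam hrate
  have key := startNorm_le_pow (Ioo_subset_Icc_self hlam) hf h1 hH (by positivity) hK q r
  rw [hk] at key
  have hF := symNorm_nonneg fun σ : Equiv.Perm (Fin (k + 1)) => listWeight lam (List.ofFn σ)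
  have main : ∀ s ∈ Icc (0 : ℝ) 1, ∀ a : ℝ, (∀ x ∈ Ioo (0 : ℝ) 1, stepWeight lam s x = a) →
      1 / 2 ≤ |a| → symNorm (fun σ : Equiv.Perm (Fin (k + 1)) => listWeight lam (List.ofFn σ)) ≤
      (k + 1).factorial *
        (2 * (Real.exp (2 / m) * Real.exp (2 / m)) * (m ^ (n + 1)) ^ q) := by
    intro s hs a ha h2
    have h3 := (key s hs).trans (mul_le_mul_of_nonneg_left (hH s) (by positivity))
    rw [startNorm_eq k ha, one_div, inv_mul_le_iff₀ (by positivity)] at h3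
    have h4 := mul_le_mul_of_nonneg_right h2 hF
    linarith
  rcases le_total lam (1 / 2) with h | h
  · refine main 1 (by norm_num) (lam - 1) (fun x hx => ?_) ?_
    · rw [stepWeight, if_neg hx.2.not_gt, if_pos hx.2]
    · rw [abs_of_nonpos (by linarith)]; linarith
  · refine main 0 (by norm_num) lam (fun x hx => ?_) ?_
    · rw [stepWeight, if_pos hx.1]
    · rw [abs_of_nonneg hlam.1.le]; exact h

/-- The maximal rate bounds the convergence radius from below. -/
theorem le_convRadiusLie (hn : 1 ≤ n) {m : ℝ} (hm : 0 < m) (hm1 : m ≤ 1)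
    (hrate : ∀ lam ∈ Ioo (0 : ℝ) 1, resolventRate n lam ≤ m) :
    ENNReal.ofReal (1 / m) ≤ convRadiusLie := by
  have hbound : ∀ k, 1 ≤ k → thetaLie k * (1 / m) ^ k ≤
      2 * (Real.exp (2 / m) * Real.exp (2 / m)) * (1 / m) ^ n := by
    intro k hk
    obtain ⟨j, rfl⟩ : ∃ j, k = j + 1 := ⟨k - 1, by omega⟩
    have hdiv : (j + 1) / (n + 1) * (n + 1) + (j + 1) % (n + 1) = j + 1 :=
      Nat.div_add_mod' _ _
    have h1 := thetaLie_le_of_symNorm_le hk fun lam hlam =>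
      symNorm_listWeight_le hn hm hlam (hrate lam hlam) _ _ j hdiv
    rw [one_div, inv_mul_cancel_left₀ (by positivity)] at h1
    refine (mul_le_mul_of_nonneg_right h1 (by positivity)).trans ?_
    rw [mul_assoc]
    refine mul_le_mul_of_nonneg_left ?_ (by positivity)
    have hmod : (j + 1) % (n + 1) ≤ n := Nat.lt_succ_iff.1 (Nat.mod_lt _ (Nat.succ_pos n))
    have h2 : 1 ≤ 1 / m := (one_le_div hm).2 hm1
    calc (m ^ (n + 1)) ^ ((j + 1) / (n + 1)) * (1 / m) ^ (j + 1)
        = (1 / m) ^ ((j + 1) % (n + 1)) := by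
          rw [← pow_mul, mul_comm (n + 1)]
          generalize (j + 1) / (n + 1) * (n + 1) = a at hdiv
          rw [← hdiv, pow_add, ← mul_assoc, ← mul_pow, mul_one_div_cancel hm.ne', one_pow, one_mul,
            hdiv]
      _ ≤ (1 / m) ^ n := pow_le_pow_right₀ h2 hmod
  rw [convRadiusLie, ENNReal.ofReal]
  refine FormalMultilinearSeries.le_radius_of_eventually_le _
    (C := 2 * (Real.exp (2 / m) * Real.exp (2 / m)) * (1 / m) ^ n) ?_
  filter_upwards [Filter.eventually_ge_atTop 1] with k hk
  rw [FormalMultilinearSeries.ofScalars_norm, Real.norm_of_nonneg (thetaLie_nonneg k),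
    Real.coe_toNNReal _ (by positivity)]
  exact hbound k hk

end

/-! ### Polynomials with integer coefficients, as lists -/

/-- The value at `y` of the polynomial with the list of coefficients `p`, constant term first. -/
def evalL (p : List ℤ) (y : ℝ) : ℝ := p.foldr (fun c v => c + y * v) 0

/-- The sum of polynomials. -/
def addL : List ℤ → List ℤ → List ℤ
  | [], q => q
  | p, [] => p
  | a :: p, b :: q => (a + b) :: addL p q

/-- A multiple of a polynomial. -/
def smulL (c : ℤ) (p : List ℤ) : List ℤ := p.map fun a => c * a

/-- The product of polynomials. -/
def mulL : List ℤ → List ℤ → List ℤ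
  | [], _ => []
  | a :: p, q => addL (smulL a q) (0 :: mulL p q)

/-- A power of a polynomial. -/
def powL (p : List ℤ) : ℕ → List ℤ
  | 0 => [1]
  | k + 1 => mulL p (powL p k)

/-- The polynomial whose coefficients are the absolute values. -/
def absL (p : List ℤ) : List ℤ := p.map fun a => (a.natAbs : ℤ)

/-- The coefficients are nonnegative. -/
def nonnegL (p : List ℤ) : Bool := p.all fun a => decide (0 ≤ a)

/-- The coefficients are nonnegative, and the constant term is positive. -/
def posL : List ℤ → Bool
  | [] => false
  | a :: p => decide (0 < a) && nonnegL p

/-- A linear combination of polynomials. -/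
def combL : List ℤ → List (List ℤ) → List ℤ
  | c :: v, p :: P => addL (smulL c p) (combL v P)
  | _, _ => []

/-- The sum of a list of polynomials. -/
def sumL (P : List (List ℤ)) : List ℤ := P.foldr addL []

@[simp] lemma evalL_nil (y : ℝ) : evalL [] y = 0 := rfl

@[simp] lemma evalL_cons (a : ℤ) (p : List ℤ) (y : ℝ) :
    evalL (a :: p) y = a + y * evalL p y := rfl

@[simp] lemma evalL_addL (p q : List ℤ) (y : ℝ) :
    evalL (addL p q) y = evalL p y + evalL q y := by
  induction p generalizing q with
  | nil => simp [addL]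
  | cons a p ih =>
    cases q with
    | nil => simp [addL]
    | cons b q => simp only [addL, evalL_cons, ih]; push_cast; ring

@[simp] lemma evalL_smulL (c : ℤ) (p : List ℤ) (y : ℝ) :
    evalL (smulL c p) y = c * evalL p y := by
  induction p with
  | nil => simp [smulL]
  | cons a p ih =>
    simp only [smulL, List.map_cons, evalL_cons] at ih ⊢
    rw [ih]; push_cast; ring

@[simp] lemma evalL_mulL (p q : List ℤ) (y : ℝ) :
    evalL (mulL p q) y = evalL p y * evalL q y := by
  induction p with
  | nil => simp [mulL]
  | cons a p ih => simp only [mulL, evalL_addL, evalL_smulL, evalL_cons, ih]; push_cast; ring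

@[simp] lemma evalL_powL (p : List ℤ) (k : ℕ) (y : ℝ) : evalL (powL p k) y = evalL p y ^ k := by
  induction k with
  | zero => simp [powL]
  | succ k ih => rw [powL, evalL_mulL, ih, pow_succ']

lemma evalL_sumL (P : List (List ℤ)) (y : ℝ) :
    evalL (sumL P) y = (P.map fun p => evalL p y).sum := by
  induction P with
  | nil => simp [sumL]
  | cons p P ih =>
    rw [sumL, List.foldr_cons, ← sumL, evalL_addL, ih, List.map_cons, List.sum_cons]

lemma abs_evalL_le (p : List ℤ) {y : ℝ} (hy : 0 ≤ y) : |evalL p y| ≤ evalL (absL p) y := by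
  induction p with
  | nil => simp [absL]
  | cons a p ih =>
    simp only [absL, List.map_cons, evalL_cons] at ih ⊢
    refine (abs_add_le _ _).trans (add_le_add (le_of_eq ?_) ?_)
    · rw [Int.cast_natCast, Nat.cast_natAbs, Int.cast_abs]
    · rw [abs_mul, abs_of_nonneg hy]
      exact mul_le_mul_of_nonneg_left ih hy

lemma evalL_nonneg {p : List ℤ} (h : nonnegL p = true) {y : ℝ} (hy : 0 ≤ y) : 0 ≤ evalL p y := by
  induction p with
  | nil => simp
  | cons a p ih =>
    simp only [nonnegL, List.all_cons, Bool.and_eq_true, decide_eq_true_eq] at h ih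
    rw [evalL_cons]
    exact add_nonneg (Int.cast_nonneg h.1) (mul_nonneg hy (ih h.2))

lemma evalL_pos {p : List ℤ} (h : posL p = true) {y : ℝ} (hy : 0 ≤ y) : 0 < evalL p y := by
  cases p with
  | nil => simp [posL] at h
  | cons a p =>
    simp only [posL, Bool.and_eq_true, decide_eq_true_eq] at h
    rw [evalL_cons]
    exact add_pos_of_pos_of_nonneg (Int.cast_pos.2 h.1) (mul_nonneg hy (evalL_nonneg h.2 hy))

/-! ### Commutator products as trees -/

/-- The shapes of the Lie monomials: binary trees with letters at the leaves. -/
inductive BracketTree (n : ℕ)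
  | leaf (i : Fin n)
  | br (a b : BracketTree n)

namespace BracketTree

variable {n : ℕ}

/-- The Lie monomial of a tree. -/
def lieMonomial : BracketTree n → FreeLieAlgebra ℝ (Fin n)
  | leaf i => FreeLieAlgebra.of ℝ i
  | br a b => ⁅a.lieMonomial, b.lieMonomial⁆

/-- The letters of a tree, from left to right. -/
def letters : BracketTree n → List (Fin n)
  | leaf i => [i]
  | br a b => a.letters ++ b.letters

lemma isLieMonomial {t : BracketTree n} (h : t.letters.Nodup) :
    IsLieMonomial t.letters.toFinset t.lieMonomial := by
  induction t with
  | leaf i => simpa [letters, lieMonomial] using IsLieMonomial.of i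
  | br a b iha ihb =>
    rw [letters, List.nodup_append'] at h
    rw [letters, List.toFinset_append]
    exact .bracket (iha h.1) (ihb h.2.1) (by
      rw [Finset.disjoint_left]
      intro x hx hx'
      exact h.2.2 (List.mem_toFinset.1 hx) (List.mem_toFinset.1 hx'))

end BracketTree

/-- A noncommutative polynomial with integer coefficients, as a list of terms. -/
abbrev Terms (n : ℕ) : Type := List (ℤ × List (Fin n))

section Terms

variable {n : ℕ}

/-- The product of lists of terms. -/
def mulTerms (E E' : Terms n) : Terms n :=
  E.flatMap fun p => E'.map fun q => (p.1 * q.1, p.2 ++ q.2)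

/-- The terms with the opposite signs. -/
def negTerms (E : Terms n) : Terms n := E.map fun p => (-p.1, p.2)

/-- The expansion of a Lie monomial. -/
def BracketTree.terms : BracketTree n → Terms n
  | leaf i => [(1, [i])]
  | br a b => mulTerms a.terms b.terms ++ negTerms (mulTerms b.terms a.terms)

/-- The expansion of a product of commutator monomials. -/
def prodTerms : List (BracketTree n) → Terms n
  | [] => [(1, [])]
  | t :: Q => mulTerms t.terms (prodTerms Q)

/-- The product of the commutator monomials of a list of trees. -/
def commProduct (Q : List (BracketTree n)) : NCPoly n :=
  (Q.map fun t => toAssoc n t.lieMonomial).prod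

/-- The noncommutative polynomial with the given terms. -/
def ofTerms (E : Terms n) : NCPoly n := (E.map fun p => (p.1 : ℝ) • wordOf p.2).sum

/-- The coefficient of a word. -/
def termCoeff (E : Terms n) (l : List (Fin n)) : ℤ :=
  (E.map fun p => if p.2 = l then p.1 else 0).sum

lemma ofTerms_append (E E' : Terms n) : ofTerms (E ++ E') = ofTerms E + ofTerms E' := by
  simp [ofTerms]

lemma ofTerms_negTerms (E : Terms n) : ofTerms (negTerms E) = -ofTerms E := by
  induction E with
  | nil => simp [ofTerms, negTerms]
  | cons p E ih =>
    simp only [ofTerms, negTerms, List.map_cons, List.sum_cons] at ih ⊢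
    rw [ih]; push_cast; rw [neg_smul, neg_add]

lemma ofTerms_map_mul (c : ℤ) (l : List (Fin n)) (E : Terms n) :
    ofTerms (E.map fun q => (c * q.1, l ++ q.2)) = ((c : ℝ) • wordOf l) * ofTerms E := by
  induction E with
  | nil => simp [ofTerms]
  | cons q E ih =>
    simp only [ofTerms, List.map_cons, List.sum_cons, mul_add] at ih ⊢
    rw [ih, wordOf_append, smul_mul_smul_comm]
    push_cast; rfl

lemma ofTerms_mulTerms (E E' : Terms n) : ofTerms (mulTerms E E') = ofTerms E * ofTerms E' := by
  induction E with
  | nil => simp [ofTerms, mulTerms]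
  | cons p E ih =>
    rw [mulTerms, List.flatMap_cons, ofTerms_append, ofTerms_map_mul, ← mulTerms, ih]
    simp [ofTerms, add_mul]

lemma ofTerms_terms (t : BracketTree n) : ofTerms t.terms = toAssoc n t.lieMonomial := by
  induction t with
  | leaf i => simp [BracketTree.terms, BracketTree.lieMonomial, ofTerms, toAssoc_of,
      wordOf_singleton]
  | br a b iha ihb =>
    rw [BracketTree.terms, BracketTree.lieMonomial, toAssoc_bracket, ofTerms_append,
      ofTerms_negTerms, ofTerms_mulTerms, ofTerms_mulTerms, iha, ihb, sub_eq_add_neg]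

lemma ofTerms_prodTerms (Q : List (BracketTree n)) : ofTerms (prodTerms Q) = commProduct Q := by
  induction Q with
  | nil => simp [prodTerms, ofTerms, commProduct, wordOf_nil]
  | cons t Q ih =>
    rw [prodTerms, ofTerms_mulTerms, ofTerms_terms, ih, commProduct, commProduct, List.map_cons,
      List.prod_cons]

lemma coeff_ofTerms (E : Terms n) (l : List (Fin n)) :
    (ofTerms E).coeff (FreeMonoid.ofList l) = termCoeff E l := by
  change wordCoeff l (ofTerms E) = _
  induction E with
  | nil => simp [ofTerms, termCoeff]
  | cons p E ih =>
    simp only [ofTerms, termCoeff, List.map_cons, List.sum_cons, map_add, map_smul] at ih ⊢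
    rw [ih, wordCoeff_wordOf]
    split_ifs <;> simp

lemma isCommProduct_commProduct {Q : List (BracketTree n)}
    (h : (Q.flatMap BracketTree.letters).Nodup) :
    IsCommProduct (Q.flatMap BracketTree.letters).toFinset (commProduct Q) := by
  induction Q with
  | nil => simpa [commProduct] using IsCommProduct.one
  | cons t Q ih =>
    rw [List.flatMap_cons, List.nodup_append'] at h
    rw [List.flatMap_cons, List.toFinset_append, commProduct, List.map_cons, List.prod_cons]
    exact .mul (t.isLieMonomial h.1) (ih h.2.1) (by
      rw [Finset.disjoint_left]
      intro x hx hx'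
      exact h.2.2 (List.mem_toFinset.1 hx) (List.mem_toFinset.1 hx'))

/-- Each letter occurs exactly once in the product. -/
def isMultilinear (Q : List (BracketTree n)) : Bool :=
  decide (Q.flatMap BracketTree.letters).Nodup &&
    decide ((Q.flatMap BracketTree.letters).length = n)

lemma symNorm_termCoeff_le_one {Q : List (BracketTree n)} (h : isMultilinear Q = true) :
    symNorm (fun σ : Equiv.Perm (Fin n) => (termCoeff (prodTerms Q) (List.ofFn σ) : ℝ)) ≤ 1 := by
  simp only [isMultilinear, Bool.and_eq_true, decide_eq_true_eq] at h
  have hu : (Q.flatMap BracketTree.letters).toFinset = Finset.univ := by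
    rw [← Finset.card_eq_iff_eq_univ, List.toFinset_card_of_nodup h.1, h.2, Fintype.card_fin]
  have hQ := isCommProduct_commProduct h.1
  rw [hu] at hQ
  refine symNorm_le ?_
  have e : symPoly (fun σ : Equiv.Perm (Fin n) =>
      (termCoeff (prodTerms Q) (List.ofFn σ) : ℝ)) = commProduct Q := by
    rw [hQ.eq_symPoly]
    congr 1
    ext σ
    rw [← coeff_ofTerms, ofTerms_prodTerms]; rfl
  rw [e]
  exact Pres.of_mem hQ

end Terms

/-! ### Computable bounds of the Lie norm -/

section CostBound

variable {n : ℕ}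

lemma symNorm_le_of_presentation (θ : List (ℝ × (Equiv.Perm (Fin n) → ℝ)))
    (h : ∀ p ∈ θ, symNorm p.2 ≤ 1) (c : Equiv.Perm (Fin n) → ℝ) :
    symNorm c ≤ (θ.map fun p => |p.1|).sum +
      ∑ σ, |c σ - (θ.map fun p => p.1 * p.2 σ).sum| := by
  induction θ generalizing c with
  | nil => simpa using symNorm_le_l1 c
  | cons p θ ih =>
    have h1 := ih (fun q hq => h q (List.mem_cons_of_mem _ hq)) (c - p.1 • p.2)
    have h2 := symNorm_add_le (c - p.1 • p.2) (p.1 • p.2)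
    have h3 : symNorm (p.1 • p.2) ≤ |p.1| := by
      rw [symNorm_smul]
      exact mul_le_of_le_one_right (abs_nonneg _) (h p List.mem_cons_self)
    rw [sub_add_cancel] at h2
    simp only [List.map_cons, List.sum_cons]
    simp only [Pi.sub_apply, Pi.smul_apply, smul_eq_mul, sub_sub] at h1
    linarith

/-- The words in which each letter occurs exactly once. -/
def words (n : ℕ) : List (List (Fin n)) := (List.finRange n).permutations'

lemma sum_perm_eq_sum_words (g : List (Fin n) → ℝ) :
    ∑ σ : Equiv.Perm (Fin n), g (List.ofFn σ) = ((words n).map g).sum := by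
  have hnd : (words n).Nodup :=
    (List.permutations_perm_permutations' _).nodup_iff.1
      (List.nodup_permutations _ (List.nodup_finRange n))
  rw [← List.sum_toFinset g hnd]
  refine Finset.sum_bij (fun σ _ => List.ofFn σ) (fun σ _ => ?_) (fun σ _ τ _ h => ?_)
    (fun l hl => ?_) (fun _ _ => rfl)
  · rw [List.mem_toFinset, words, List.mem_permutations']
    refine (List.perm_ext_iff_of_nodup (ofFn_perm_nodup σ) (List.nodup_finRange n)).2 fun i => ?_
    simpa [List.mem_ofFn] using ⟨σ.symm i, by simp⟩
  · exact DFunLike.coe_injective (List.ofFn_injective h)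
  · rw [List.mem_toFinset, words, List.mem_permutations'] at hl
    obtain ⟨σ, rfl⟩ := exists_perm_of_nodup (hl.nodup_iff.2 (List.nodup_finRange n))
      (by ext i; simp [hl.mem_iff])
    exact ⟨σ, Finset.mem_univ _, rfl⟩

/-- Products of commutator monomials with the coefficients, with respect to some basic
quantities, of their coefficients in a presentation. -/
abbrev Presentation (n : ℕ) : Type := List (List (BracketTree n) × List ℤ)

/-- All products in the presentation are multilinear. -/
def Presentation.isValid (π : Presentation n) : Bool := π.all fun p => isMultilinear p.1

/-- The expanded products of a presentation, with the polynomials which are their coefficients,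
when the basic quantities are the polynomials in the list `P`. -/
def Presentation.expand (π : Presentation n) (P : List (List ℤ)) : List (Terms n × List ℤ) :=
  π.map fun p => (prodTerms p.1, combL p.2 P)

/-- The cost of presenting the polynomial with coefficients `c` by the given products and,
for the rest, by words. Polynomials are bounded coefficientwise. -/
def costL (c : List (Fin n) → List ℤ) (θ : List (Terms n × List ℤ)) : List ℤ :=
  addL (sumL (θ.map fun p => absL p.2)) (sumL ((words n).map fun w =>
    absL (addL (c w) (sumL (θ.map fun p => smulL (-termCoeff p.1 w) p.2)))))

lemma symNorm_le_costL {π : Presentation n} (hπ : π.isValid = true) (P : List (List ℤ))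
    (c : List (Fin n) → List ℤ) {y : ℝ} (hy : 0 ≤ y) :
    symNorm (fun σ : Equiv.Perm (Fin n) => evalL (c (List.ofFn σ)) y) ≤
      evalL (costL c (π.expand P)) y := by
  have h := symNorm_le_of_presentation (π.map fun p => (evalL (combL p.2 P) y,
    fun σ : Equiv.Perm (Fin n) => (termCoeff (prodTerms p.1) (List.ofFn σ) : ℝ)))
    (by
      intro q hq
      obtain ⟨p, hp, rfl⟩ := List.mem_map.1 hq
      exact symNorm_termCoeff_le_one (List.all_eq_true.1 hπ p hp))
    fun σ => evalL (c (List.ofFn σ)) y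
  refine h.trans ?_
  rw [costL, evalL_addL, evalL_sumL, evalL_sumL]
  refine add_le_add ?_ ?_
  · simp only [Presentation.expand, List.map_map, Function.comp_def]
    exact List.sum_le_sum fun p _ => abs_evalL_le _ hy
  · rw [List.map_map, ← sum_perm_eq_sum_words]
    refine Finset.sum_le_sum fun σ _ => ?_
    refine le_trans (le_of_eq ?_) (abs_evalL_le _ hy)
    rw [evalL_addL, evalL_sumL]
    simp only [Presentation.expand, List.map_map, Function.comp_def, evalL_smulL]
    congr 1
    rw [sub_eq_iff_eq_add, add_assoc, left_eq_add]
    clear h hπ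
    induction π with
    | nil => simp
    | cons p π ih =>
      simp only [List.map_cons, List.sum_cons]
      push_cast at ih ⊢
      linarith

end CostBound

/-! ### The kernels as binomial averages -/

section Binomial

variable {n : ℕ}

/-- The number of coordinates below `t`. -/
def countBelow (t : ℝ) (b : Fin n → ℝ) : ℕ := (Finset.univ.filter fun i => b i < t).card

lemma countBelow_le (t : ℝ) (b : Fin n → ℝ) : countBelow t b ≤ n :=
  (Finset.card_filter_le _ _).trans (by simp)

lemma countBelow_cons (t u : ℝ) (b : Fin n → ℝ) :
    countBelow t (Fin.cons u b : Fin (n + 1) → ℝ) =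
      countBelow t b + if u < t then 1 else 0 := by
  simp only [countBelow, Finset.card_filter]
  rw [Fin.sum_univ_succ, add_comm]
  rfl

lemma measurable_countBelow (t : ℝ) : Measurable (countBelow t : (Fin n → ℝ) → ℕ) := by
  have h : (countBelow t : (Fin n → ℝ) → ℕ) = fun b => ∑ i, if b i < t then 1 else 0 :=
    funext fun b => Finset.card_filter _ _
  rw [h]
  exact Finset.measurable_fun_sum _ fun i _ =>
    Measurable.ite (measurableSet_lt (measurable_pi_apply i) measurable_const)
      measurable_const measurable_const

lemma integrable_comp_countBelow (t : ℝ) (g : ℕ → ℝ) :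
    Integrable (fun b : Fin n → ℝ => g (countBelow t b)) (cubeMeasure n) := by
  refine Integrable.of_bound ((measurable_from_nat (f := g)).comp
    (measurable_countBelow t)).aestronglyMeasurable (∑ k ∈ Finset.range (n + 1), |g k|)
    (ae_of_all _ fun b => ?_)
  exact Finset.single_le_sum (f := fun k => |g k|) (fun _ _ => abs_nonneg _)
    (Finset.mem_range.2 (Nat.lt_succ_of_le (countBelow_le t b)))

/-- The number of coordinates below `t` is binomially distributed. -/
lemma integral_comp_countBelow {t : ℝ} (ht : t ∈ Icc (0 : ℝ) 1) (n : ℕ) (g : ℕ → ℝ) :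
    ∫ b, g (countBelow t b) ∂cubeMeasure n =
      ∑ m ∈ Finset.range (n + 1), (n.choose m : ℝ) * (t ^ m * (1 - t) ^ (n - m) * g m) := by
  induction n generalizing g with
  | zero => simp [countBelow]
  | succ n ih =>
    have hm : ∀ n, Measurable fun b : Fin n → ℝ => g (countBelow t b) := fun n =>
      (measurable_from_nat (f := g)).comp (measurable_countBelow t)
    have h1 : ∫ b, g (countBelow t b) ∂cubeMeasure (n + 1) =
        ∫ u in Icc (0 : ℝ) 1, ∫ b, g (countBelow t b + if u < t then 1 else 0) ∂cubeMeasure n := by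
      have hi := integrable_comp_countBelow (n := n + 1) t g
      rw [← map_finCons] at hi ⊢
      rw [integral_map measurable_finCons.aemeasurable (hm _).aestronglyMeasurable, integral_prod]
      · simp only [countBelow_cons]
      · exact (integrable_map_measure (hm _).aestronglyMeasurable
          measurable_finCons.aemeasurable).1 hi
    have h2 : ∀ u, ∫ b, g (countBelow t b + if u < t then 1 else 0) ∂cubeMeasure n =
        (Iio t).indicator (fun _ => (∫ b, g (countBelow t b + 1) ∂cubeMeasure n) -
          ∫ b, g (countBelow t b) ∂cubeMeasure n) u + ∫ b, g (countBelow t b) ∂cubeMeasure n := by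
      intro u
      by_cases hu : u < t
      · simp [hu]
      · simp [hu]
    have h3 : ∫ u in Icc (0 : ℝ) 1, (Iio t).indicator (fun _ =>
        (∫ b, g (countBelow t b + 1) ∂cubeMeasure n) -
          ∫ b, g (countBelow t b) ∂cubeMeasure n) u =
        t * ((∫ b, g (countBelow t b + 1) ∂cubeMeasure n) -
          ∫ b, g (countBelow t b) ∂cubeMeasure n) := by
      have e : Icc (0 : ℝ) 1 ∩ Iio t = Ico 0 t := by
        ext u
        simp only [mem_inter_iff, mem_Icc, mem_Iio, mem_Ico]
        exact ⟨fun h => ⟨h.1.1, h.2⟩, fun h => ⟨⟨h.1, h.2.le.trans ht.2⟩, h.2⟩⟩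
      rw [setIntegral_indicator measurableSet_Iio, e, setIntegral_const]
      simp [Measure.real, ht.1]
    rw [h1]
    simp only [h2]
    rw [integral_add, h3, ih g, ih fun k => g (k + 1)]
    · simp only [integral_const, probReal_univ, one_smul]
      have e0 : ∑ m ∈ Finset.range (n + 1), (n.choose m : ℝ) *
          (t ^ m * (1 - t) ^ (n + 1 - m) * g m) = (1 - t) * ∑ m ∈ Finset.range (n + 1),
            (n.choose m : ℝ) * (t ^ m * (1 - t) ^ (n - m) * g m) := by
        rw [Finset.mul_sum]
        refine Finset.sum_congr rfl fun m hm => ?_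
        rw [Nat.succ_sub (Nat.lt_succ_iff.1 (Finset.mem_range.1 hm)), pow_succ]
        ring
      have e1 : ∑ m ∈ Finset.range (n + 1), (n.choose m : ℝ) *
          (t ^ (m + 1) * (1 - t) ^ (n - m) * g (m + 1)) = t * ∑ m ∈ Finset.range (n + 1),
            (n.choose m : ℝ) * (t ^ m * (1 - t) ^ (n - m) * g (m + 1)) := by
        rw [Finset.mul_sum]
        exact Finset.sum_congr rfl fun m _ => by rw [pow_succ]; ring
      rw [Finset.sum_choose_succ_mul (fun i j => t ^ i * (1 - t) ^ j * g i) n, e0, e1]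
      ring
    · exact (integrable_const _).indicator measurableSet_Iio
    · exact integrable_const _

/-- The heights `2i+1` of the letters `i` of a word, followed by the height `2m` of the terminal
point, which lies above the first `m` letters. -/
def heights (m : ℕ) (w : List (Fin n)) : List ℕ := (w.map fun i => 2 * i.val + 1) ++ [2 * m]

/-- The weights of the orderings of an increasing sequence in the unit interval, for the starting
point `0` and a terminal point with exactly `m` elements of the sequence below it. -/
def chainWeight (n : ℕ) (lam : ℝ) (m : ℕ) (σ : Equiv.Perm (Fin n)) : ℝ :=
  lam * listWeight lam (heights m (List.ofFn σ))

lemma lt_iff_lt_countBelow {b : Fin n → ℝ} (hb : StrictMono b) (t : ℝ) (i : Fin n) :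
    b i < t ↔ i.val < countBelow t b := by
  constructor
  · intro h
    have : Finset.Iic i ⊆ Finset.univ.filter fun i => b i < t := fun j hj => by
      simpa using (hb.monotone (Finset.mem_Iic.1 hj)).trans_lt h
    have := Finset.card_le_card this
    rw [Fin.card_Iic] at this
    exact this
  · intro h
    by_contra hi
    have : (Finset.univ.filter fun i => b i < t) ⊆ Finset.Iio i := fun j hj => by
      rw [Finset.mem_Iio]
      by_contra hij
      exact hi ((hb.monotone (not_lt.1 hij)).trans_lt (by simpa using hj))
    have := Finset.card_le_card this
    rw [Fin.card_Iio] at this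
    exact absurd h (not_lt.2 this)

lemma orbit_resolventWeight_of_strictMono (hn : 1 ≤ n) (lam : ℝ) {t : ℝ} {b : Fin n → ℝ}
    (hb : StrictMono b) (h0 : ∀ i, 0 < b i) (ht : ∀ i, b i ≠ t) :
    orbit (resolventWeight n lam 0 t) b = chainWeight n lam (countBelow t b) := by
  ext σ
  set m := countBelow t b with hm
  have hlt := lt_iff_lt_countBelow hb t
  rw [← hm] at hlt
  let f : ℕ → ℝ := fun k => if k = 2 * m then t else if h : k / 2 < n then b ⟨k / 2, h⟩ else 0
  have f1 : ∀ i : Fin n, f (2 * i.val + 1) = b i := by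
    intro i
    have e : (2 * i.val + 1) / 2 = i.val := by omega
    simp only [f]
    rw [if_neg (by omega), dif_pos (by rw [e]; exact i.2)]
    simp only [e]
  have f2 : f (2 * m) = t := if_pos rfl
  have hmap : List.ofFn (fun i => b (σ i)) ++ [t] = (heights m (List.ofFn σ)).map f := by
    rw [heights, List.map_append, List.map_map, List.map_ofFn, List.map_singleton, f2]
    simp [Function.comp_def, f1]
  have hmem : ∀ k ∈ heights m (List.ofFn σ), (∃ i : Fin n, k = 2 * i.val + 1) ∨ k = 2 * m := by
    intro k hk
    rw [heights, List.mem_append, List.mem_map, List.mem_singleton] at hk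
    rcases hk with ⟨i, -, rfl⟩ | rfl
    · exact Or.inl ⟨i, rfl⟩
    · exact Or.inr rfl
  have hhead : listWeight lam (0 :: (List.ofFn (fun i => b (σ i)) ++ [t])) =
      lam * listWeight lam (List.ofFn (fun i => b (σ i)) ++ [t]) := by
    obtain ⟨k, rfl⟩ : ∃ k, n = k + 1 := ⟨n - 1, by omega⟩
    rw [List.ofFn_succ, List.cons_append, listWeight_cons_cons, stepWeight, if_pos (h0 _)]
  rw [orbit, resolventWeight_eq, hhead, hmap, chainWeight, listWeight_map]
  rintro x hx y hy
  rcases hmem x hx with ⟨i, rfl⟩ | rfl <;> rcases hmem y hy with ⟨j, rfl⟩ | rfl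
  · rw [f1, f1, hb.lt_iff_lt, Fin.lt_def]; omega
  · rw [f1, f2, hlt]; omega
  · have h1 : t < b j ↔ ¬ b j < t := by
      rw [not_lt]; exact ⟨le_of_lt, fun h => lt_of_le_of_ne h (ht j).symm⟩
    rw [f1, f2, h1, hlt]; omega
  · simp

/-- With the starting point `0`, the average over the cube is a binomial average over the number
of coordinates below the terminal point. -/
lemma orbitAvg_eq_sum (hn : 1 ≤ n) {φ : (Equiv.Perm (Fin n) → ℝ) → ℝ}
    (hφ : ∀ (τ : Equiv.Perm (Fin n)) c, φ (fun σ => c (τ * σ)) = φ c) (lam : ℝ) {t : ℝ}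
    (ht : t ∈ Icc (0 : ℝ) 1) :
    orbitAvg φ lam 0 t = ∑ m ∈ Finset.range (n + 1), (n.choose m : ℝ) *
      (t ^ m * (1 - t) ^ (n - m) * φ (chainWeight n lam m)) := by
  rw [← integral_comp_countBelow ht n fun m => φ (chainWeight n lam m), orbitAvg]
  refine integral_congr_ae ?_
  filter_upwards [ae_generic n t t] with b hb
  obtain ⟨τ, hτ⟩ := exists_strictMono_comp hb.1
  have h1 : φ (orbit (resolventWeight n lam 0 t) fun i => b (τ i)) =
      φ (orbit (resolventWeight n lam 0 t) b) := hφ τ (orbit (resolventWeight n lam 0 t) b)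
  have h2 : countBelow t (fun i => b (τ i)) = countBelow t b := by
    simp only [countBelow, Finset.card_filter]
    exact Equiv.sum_comp τ fun i => if b i < t then 1 else 0
  rw [← h1, orbit_resolventWeight_of_strictMono hn lam hτ (fun i => (hb.2.1 _).1)
    (fun i => hb.2.2.1 _), h2]

lemma l1Norm_comp_mul_left (τ : Equiv.Perm (Fin n)) (c : Equiv.Perm (Fin n) → ℝ) :
    l1Norm (fun σ => c (τ * σ)) = l1Norm c :=
  Equiv.sum_comp (Equiv.mulLeft τ) fun σ => |c σ|

lemma nodup_heights (m : ℕ) {w : List (Fin n)} (hw : w.Nodup) : (heights m w).Nodup := by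
  rw [heights, List.nodup_append']
  refine ⟨hw.map fun i j h => Fin.ext (by simpa using h), List.nodup_singleton _, ?_⟩
  intro x hx hx'
  obtain ⟨i, -, rfl⟩ := List.mem_map.1 hx
  rw [List.mem_singleton] at hx'
  omega

/-- The weights are, up to the sign, homogeneous of degree `n + 1` in `λ` and `1 - λ`. -/
lemma chainWeight_eq (lam : ℝ) (m : ℕ) (σ : Equiv.Perm (Fin n)) :
    descents (heights m (List.ofFn σ)) ≤ n ∧ chainWeight n lam m σ =
      (-1) ^ descents (heights m (List.ofFn σ)) *
        (lam ^ (n + 1 - descents (heights m (List.ofFn σ))) *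
          (1 - lam) ^ descents (heights m (List.ofFn σ))) := by
  have h := ascents_add_descents (nodup_heights m (ofFn_perm_nodup σ))
  simp only [heights, List.length_append, List.length_map, List.length_ofFn,
    List.length_singleton, Nat.add_sub_cancel] at h
  rw [← heights] at h
  refine ⟨by omega, ?_⟩
  rw [chainWeight, listWeight, show n + 1 - descents (heights m (List.ofFn σ)) =
    ascents (heights m (List.ofFn σ)) + 1 by omega, ← neg_sub 1 lam, neg_pow, pow_succ]
  ring

end Binomial

/-! ### Certificates for the kernels -/

section Certificate

variable {n : ℕ}

/-- The polynomials `L^(n+1-i) M^i` for `i ≤ n + 1`. -/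
def monomialsL (n : ℕ) (L M : List ℤ) : List (List ℤ) :=
  (List.range (n + 2)).map fun i => mulL (powL L (n + 1 - i)) (powL M i)

/-- Twice the weight of an ordering, in terms of the monomials. -/
def weightL (P : List (List ℤ)) (m : ℕ) (w : List (Fin n)) : List ℤ :=
  smulL (2 * (-1) ^ descents (heights m w)) (P.getD (descents (heights m w)) [])

/-- Twice the sum of the absolute values of the weights. -/
def l1L (n : ℕ) (P : List (List ℤ)) (m : ℕ) : List ℤ :=
  sumL ((words n).map fun w => smulL 2 (P.getD (descents (heights m w)) []))

/-- `15 S^4 + 5 X^2 S^2 + 3 X^4` with `S = L + M` and `X = M - L`. For `x = X / S`, this is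
`15 S^4` times the partial sum `1 + x^2/3 + x^4/5` of the series of `artanh x / x`. If
`L : M = λ : 1 - λ`, then `x = 1 - 2λ` and `artanh x / x = 1 / (2 w(λ))`. -/
def artanhL (L M : List ℤ) : List ℤ :=
  let S := addL L M
  let X := addL M (smulL (-1) L)
  addL (smulL 15 (powL S 4)) (addL (smulL 5 (mulL (powL X 2) (powL S 2))) (smulL 3 (powL X 4)))

/-- A lower bound, up to a positive factor, of the difference between the norm `l1Norm` and the
norm `symNorm`, multiplied by `(a w(λ))^(n+1)` with `a = num / 1000`, of the weights for `m` points
below the terminal point, if `L : M = λ : 1 - λ`. The binomial coefficient is included. -/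
def marginL (num : ℕ) (L M : List ℤ) (π : ℕ → Presentation n) (m : ℕ) : List ℤ :=
  let P := monomialsL n L M
  smulL (n.choose m) (addL (mulL (powL (smulL 2000 (artanhL L M)) (n + 1)) (l1L n P m))
    (smulL (-1) (mulL (powL (smulL (15 * num) (powL (addL L M) 4)) (n + 1))
      (costL (weightL P m) ((π m).expand P)))))

/-- A sufficient condition for the positivity of `∑ E_m t^m (1-t)^(4-m)`. The contributions of
`E_3` and `E_4` are bounded from below by their tangents at the point with `t / (1-t) = k / 10`; up
to positive factors, `E 0`, `b` and `c` are the coefficients of the resulting quadratic form. It is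
positive if its coefficients are nonnegative or if its discriminant is negative. -/
def isPositiveQuartic (k : ℕ) (E : ℕ → List ℤ) : Bool :=
  let b := addL (smulL 1000 (E 1)) (addL (smulL (-10 * k ^ 2) (E 3)) (smulL (-2 * k ^ 3) (E 4)))
  let c := addL (smulL 100 (E 2)) (addL (smulL (20 * k) (E 3)) (smulL (3 * k ^ 2) (E 4)))
  posL (E 0) && nonnegL (E 3) && nonnegL (E 4) && ((nonnegL b && nonnegL c) ||
    posL (addL (smulL 40000 (mulL (E 0) c)) (smulL (-1) (mulL b b))))

/-- The condition to be checked on the interval of parameters `l₀ < 1000 λ ≤ l₁`, which is mapped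
to the half-line `y ≥ 0` by `λ : 1 - λ = L(y) : M(y)`, in order to prove the lower bound `num / 1000`.
The presentation `π m` is used for `m` points below the terminal point. -/
def isCertificate (num : ℕ) (l₀ l₁ : ℤ) (k : ℕ) (π : ℕ → Presentation n) : Bool :=
  let L := [l₁, l₀]
  let M := [1000 - l₁, 1000 - l₀]
  (List.range (n + 1)).all (fun m => (π m).isValid) && posL (marginL num L M π n) &&
    isPositiveQuartic k (marginL num L M π)

/-- The positivity of a binary quartic form with coefficients `e`, by tangents at `t = u v`. -/
lemma quartic_pos {e : ℕ → ℝ} {u t v : ℝ} (hu : 0 ≤ u) (ht : 0 ≤ t) (hv : 0 < v) (h0 : 0 < e 0)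
    (h3 : 0 ≤ e 3) (h4 : 0 ≤ e 4)
    (h : (0 ≤ e 1 - u ^ 2 * e 3 - 2 * u ^ 3 * e 4 ∧ 0 ≤ e 2 + 2 * u * e 3 + 3 * u ^ 2 * e 4) ∨
      (e 1 - u ^ 2 * e 3 - 2 * u ^ 3 * e 4) ^ 2 <
        4 * e 0 * (e 2 + 2 * u * e 3 + 3 * u ^ 2 * e 4)) :
    0 < ∑ m ∈ Finset.range 5, e m * (t ^ m * v ^ (4 - m)) := by
  set b := e 1 - u ^ 2 * e 3 - 2 * u ^ 3 * e 4 with hb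
  set c := e 2 + 2 * u * e 3 + 3 * u ^ 2 * e 4 with hc
  have hq : 0 < e 0 * v ^ 2 + b * t * v + c * t ^ 2 := by
    rcases h with ⟨h1, h2⟩ | h
    · have := mul_nonneg (mul_nonneg h1 ht) hv.le
      have := mul_nonneg h2 (sq_nonneg t)
      have := mul_pos h0 (pow_pos hv 2)
      linarith
    · have hid : 4 * e 0 * (e 0 * v ^ 2 + b * t * v + c * t ^ 2) =
          (2 * e 0 * v + b * t) ^ 2 + (4 * e 0 * c - b ^ 2) * t ^ 2 := by ring
      have : 0 < (2 * e 0 * v + b * t) ^ 2 + (4 * e 0 * c - b ^ 2) * t ^ 2 := by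
        rcases ht.eq_or_lt with rfl | ht
        · rw [mul_zero, add_zero]
          have := mul_pos h0 hv
          positivity
        · have : 0 < 4 * e 0 * c - b ^ 2 := by linarith
          positivity
      rw [← hid] at this
      exact pos_of_mul_pos_right this (by linarith)
  -- The tangent inequalities for the cubic and the quartic monomial at the point `t = u v`.
  have hid : ∑ m ∈ Finset.range 5, e m * (t ^ m * v ^ (4 - m)) =
      v ^ 2 * (e 0 * v ^ 2 + b * t * v + c * t ^ 2) + e 3 * (t * v * (t - u * v) ^ 2) +
        e 4 * (t * (t + 2 * u * v) * (t - u * v) ^ 2) := by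
    simp only [Finset.sum_range_succ, Finset.sum_range_zero, hb, hc]
    ring
  rw [hid]
  have e1 : 0 ≤ e 3 * (t * v * (t - u * v) ^ 2) := by positivity
  have e2 : 0 ≤ e 4 * (t * (t + 2 * u * v) * (t - u * v) ^ 2) := by positivity
  have e3 := mul_pos (pow_pos hv 2) hq
  linarith

lemma quartic_pos_of_isPositiveQuartic {k : ℕ} {E : ℕ → List ℤ}
    (h : isPositiveQuartic k E = true) {y t v : ℝ} (hy : 0 ≤ y) (ht : 0 ≤ t) (hv : 0 < v) :
    0 < ∑ m ∈ Finset.range 5, evalL (E m) y * (t ^ m * v ^ (4 - m)) := by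
  simp only [isPositiveQuartic, Bool.and_eq_true, Bool.or_eq_true] at h
  obtain ⟨⟨⟨h0, h3⟩, h4⟩, h⟩ := h
  refine quartic_pos (e := fun m => evalL (E m) y) (u := k / 10) (by positivity) ht hv
    (evalL_pos h0 hy) (evalL_nonneg h3 hy) (evalL_nonneg h4 hy) ?_
  rcases h with ⟨h1, h2⟩ | h
  · left
    have h1 := evalL_nonneg h1 hy
    have h2 := evalL_nonneg h2 hy
    simp only [evalL_addL, evalL_smulL] at h1 h2
    push_cast at h1 h2
    constructor
    · linarith
    · linarith
  · right
    have h := evalL_pos h hy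
    simp only [evalL_addL, evalL_smulL, evalL_mulL] at h
    push_cast at h
    linarith

lemma getD_monomialsL (L M : List ℤ) {d : ℕ} (hd : d ≤ n + 1) (y : ℝ) :
    evalL ((monomialsL n L M).getD d []) y = evalL L y ^ (n + 1 - d) * evalL M y ^ d := by
  rw [monomialsL, List.getD_eq_getElem?_getD, List.getElem?_map,
    List.getElem?_range (Nat.lt_succ_of_le hd)]
  simp

lemma evalL_weightL {L M : List ℤ} {y μ lam : ℝ} (hL : evalL L y = μ * lam)
    (hM : evalL M y = μ * (1 - lam)) (m : ℕ) (σ : Equiv.Perm (Fin n)) :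
    evalL (weightL (monomialsL n L M) m (List.ofFn σ)) y =
      2 * μ ^ (n + 1) * chainWeight n lam m σ := by
  obtain ⟨h1, h2⟩ := chainWeight_eq lam m σ
  rw [weightL, evalL_smulL, getD_monomialsL L M (by omega), hL, hM, h2, mul_pow, mul_pow]
  conv_rhs => rw [← Nat.sub_add_cancel (show descents (heights m (List.ofFn σ)) ≤ n + 1 by omega),
    pow_add]
  push_cast
  rw [Nat.add_sub_cancel]
  ring

lemma evalL_l1L {L M : List ℤ} {y μ lam : ℝ} (hL : evalL L y = μ * lam)
    (hM : evalL M y = μ * (1 - lam)) (hμ : 0 < μ) (hlam : lam ∈ Ioo (0 : ℝ) 1) (m : ℕ) :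
    evalL (l1L n (monomialsL n L M) m) y =
      2 * μ ^ (n + 1) * l1Norm (chainWeight n lam m) := by
  rw [l1L, evalL_sumL, List.map_map, ← sum_perm_eq_sum_words, l1Norm, Finset.mul_sum]
  refine Finset.sum_congr rfl fun σ _ => ?_
  have h := evalL_weightL hL hM m σ
  have h1 := hlam.1
  have h2 : 0 < 1 - lam := sub_pos.2 hlam.2
  have h3 : 0 ≤ 2 * evalL ((monomialsL n L M).getD (descents (heights m (List.ofFn σ))) []) y := by
    rw [getD_monomialsL L M (by have := (chainWeight_eq lam m σ).1; omega), hL, hM]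
    positivity
  rw [weightL, evalL_smulL] at h
  have h4 := congrArg abs h
  rw [abs_mul, abs_mul, abs_of_pos (show 0 < 2 * μ ^ (n + 1) by positivity)] at h4
  rw [← h4, Function.comp_apply, evalL_smulL, abs_of_nonneg (by linarith : (0:ℝ) ≤ evalL ((monomialsL n L M).getD _ []) y)]
  push_cast
  simp [abs_mul]

lemma weight_mul_le {lam : ℝ} (hlam : lam ∈ Ioo (0 : ℝ) 1) (h : lam ≤ 1 / 2) :
    weight lam * (2 * (1 + (1 - 2 * lam) ^ 2 / 3 + (1 - 2 * lam) ^ 4 / 5)) ≤ 1 := by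
  have hw := weight_pos hlam
  have h1 := sum_le_dslope_logRatio (x := 1 - 2 * lam) (by linarith) (by linarith [hlam.1]) 2
  have h2 := weight_eq_inv_dslope hlam
  have h3 : (weight lam)⁻¹ = dslope logRatio 0 (1 - 2 * lam) := by rw [h2, inv_inv]
  rw [← h3] at h1
  rw [← le_inv_mul_iff₀ hw, mul_one]
  refine le_trans (le_of_eq ?_) h1
  simp only [Finset.sum_range_succ, Finset.sum_range_zero]
  norm_num
  ring

/-- A certificate bounds the ratio of the kernels on an interval of parameters. -/
lemma orbitAvg_lt_of_isCertificate (hn : 1 ≤ n) (hn4 : n ≤ 4) {num : ℕ} {l₀ l₁ : ℤ} {k : ℕ}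
    {π : ℕ → Presentation n} (h : isCertificate num l₀ l₁ k π = true) {lam : ℝ}
    (hlam : lam ∈ Ioo (0 : ℝ) 1) (hhalf : lam ≤ 1 / 2) (h₀ : l₀ < 1000 * lam)
    (h₁ : 1000 * lam ≤ l₁) {t : ℝ} (ht : t ∈ Icc (0 : ℝ) 1) :
    orbitAvg (n := n) symNorm lam 0 t * (num / 1000 * weight lam) ^ (n + 1) <
      orbitAvg (n := n) l1Norm lam 0 t := by
  simp only [isCertificate, Bool.and_eq_true, List.all_eq_true, List.mem_range] at h
  obtain ⟨⟨hval, hlast⟩, hquart⟩ := h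
  have hd : 0 < 1000 * lam - l₀ := by linarith
  -- The parameter of the interval, and the scale of the homogeneous coordinates.
  obtain ⟨y, hy, hyd⟩ : ∃ y : ℝ, 0 ≤ y ∧ y * (1000 * lam - l₀) = l₁ - 1000 * lam :=
    ⟨(l₁ - 1000 * lam) / (1000 * lam - l₀), div_nonneg (by linarith) hd.le,
      div_mul_cancel₀ _ hd.ne'⟩
  obtain ⟨μ, hμ, hμ'⟩ : ∃ μ : ℝ, 0 < μ ∧ μ = 1000 * (1 + y) := ⟨_, by positivity, rfl⟩
  generalize hL' : [l₁, l₀] = L at *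
  generalize hM' : [1000 - l₁, 1000 - l₀] = M at *
  have hL : evalL L y = μ * lam := by
    rw [← hL', hμ']; simp only [evalL_cons, evalL_nil]; linarith
  have hM : evalL M y = μ * (1 - lam) := by
    rw [← hM', hμ']; simp only [evalL_cons, evalL_nil]; push_cast; linarith
  have hT : evalL (artanhL L M) y =
      15 * μ ^ 4 * (1 + (1 - 2 * lam) ^ 2 / 3 + (1 - 2 * lam) ^ 4 / 5) := by
    simp only [artanhL, evalL_addL, evalL_smulL, evalL_mulL, evalL_powL, hL, hM]
    push_cast; ring
  have hS : evalL (addL L M) y = μ := by rw [evalL_addL, hL, hM]; ring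
  obtain ⟨W, hW⟩ : ∃ W : ℝ, W = num / 1000 * weight lam := ⟨_, rfl⟩
  obtain ⟨T, hTdef⟩ : ∃ T : ℝ, T = 2000 * evalL (artanhL L M) y := ⟨_, rfl⟩
  have hTpos : 0 < T := by rw [hTdef, hT]; positivity
  have hWpos : 0 ≤ W := by rw [hW]; exact mul_nonneg (by positivity) (weight_pos hlam).le
  have hWT : W * T ≤ 15 * num * μ ^ 4 := by
    refine le_trans (le_of_eq ?_) (mul_le_of_le_one_right
      (show (0 : ℝ) ≤ 15 * num * μ ^ 4 by positivity) (weight_mul_le hlam hhalf))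
    rw [hTdef, hT, hW]
    ring
  -- The contributions bound the differences of the norms, up to a positive factor.
  obtain ⟨κ, hκ'⟩ : ∃ κ : ℝ, κ = T ^ (n + 1) * (2 * μ ^ (n + 1)) := ⟨_, rfl⟩
  have hκ : 0 < κ := by rw [hκ']; positivity
  have hE : ∀ m ≤ n, evalL (marginL num L M π m) y ≤ n.choose m *
      (κ * (l1Norm (chainWeight n lam m) - W ^ (n + 1) * symNorm (chainWeight n lam m))) := by
    intro m hm
    have hc := symNorm_le_costL (hval m (by omega)) (monomialsL n L M)
      (weightL (monomialsL n L M) m) hy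
    have hfun : (fun σ : Equiv.Perm (Fin n) =>
        evalL (weightL (monomialsL n L M) m (List.ofFn σ)) y) =
        (2 * μ ^ (n + 1)) • chainWeight n lam m := by
      ext σ; rw [evalL_weightL hL hM]; rfl
    rw [hfun, symNorm_smul, abs_of_pos (by positivity)] at hc
    have hN := symNorm_nonneg (chainWeight n lam m)
    simp only [marginL, evalL_smulL, evalL_addL, evalL_mulL, evalL_powL, evalL_l1L hL hM hμ hlam, hS]
    push_cast
    refine mul_le_mul_of_nonneg_left ?_ (by positivity)
    rw [← hTdef]
    have h1 : (W * T) ^ (n + 1) * (2 * μ ^ (n + 1) * symNorm (chainWeight n lam m)) ≤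
        (15 * num * μ ^ 4) ^ (n + 1) *
          evalL (costL (weightL (monomialsL n L M) m) ((π m).expand (monomialsL n L M))) y :=
      mul_le_mul (pow_le_pow_left₀ (by positivity) hWT _) hc (by positivity) (by positivity)
    rw [mul_pow] at h1
    rw [hκ']
    linarith
  have hE0 : ∀ m, n < m → evalL (marginL num L M π m) y = 0 := by
    intro m hm
    simp [marginL, Nat.choose_eq_zero_of_lt hm]
  have hpos : 0 < ∑ m ∈ Finset.range (n + 1),
      evalL (marginL num L M π m) y * (t ^ m * (1 - t) ^ (n - m)) := by
    rcases ht.2.eq_or_lt with rfl | ht1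
    · rw [Finset.sum_range_succ, Finset.sum_eq_zero]
      · simpa using evalL_pos hlast hy
      · intro m hm
        rw [Finset.mem_range] at hm
        simp [Nat.sub_eq_zero_iff_le, hm]
    · have hv : 0 < 1 - t := by linarith
      have h1 := quartic_pos_of_isPositiveQuartic hquart hy ht.1 hv
      have h2 : ∑ m ∈ Finset.range 5, evalL (marginL num L M π m) y *
          (t ^ m * (1 - t) ^ (4 - m)) = (1 - t) ^ (4 - n) * ∑ m ∈ Finset.range (n + 1),
            evalL (marginL num L M π m) y * (t ^ m * (1 - t) ^ (n - m)) := by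
        rw [Finset.mul_sum]
        symm
        refine Finset.sum_subset_zero_on_sdiff (Finset.range_subset_range.2 (by omega))
          (fun m hm => ?_) fun m hm => ?_
        · rw [Finset.mem_sdiff, Finset.mem_range, Finset.mem_range] at hm
          rw [hE0 m (by omega), zero_mul]
        · rw [Finset.mem_range] at hm
          rw [show 4 - m = (4 - n) + (n - m) by omega, pow_add]
          ring
      rw [h2] at h1
      exact pos_of_mul_pos_right h1 (by positivity)
  rw [orbitAvg_eq_sum hn symNorm_comp_mul_left lam ht,
    orbitAvg_eq_sum hn l1Norm_comp_mul_left lam ht, ← hW, ← sub_pos, Finset.sum_mul,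
    ← Finset.sum_sub_distrib]
  refine pos_of_mul_pos_right (lt_of_lt_of_le hpos ?_) hκ.le
  rw [Finset.mul_sum]
  refine Finset.sum_le_sum fun m hm => ?_
  have := mul_le_mul_of_nonneg_right (hE m (Nat.lt_succ_iff.1 (Finset.mem_range.1 hm)))
    (show 0 ≤ t ^ m * (1 - t) ^ (n - m) from
      mul_nonneg (pow_nonneg ht.1 _) (pow_nonneg (by linarith [ht.2]) _))
  refine this.trans (le_of_eq ?_)
  ring

end Certificate

/-! ### The bounds in low degrees -/

section LowDegree

variable {n : ℕ}

/-- By reflection and periodicity, it suffices to consider parameters `λ ≤ 1/2`, the starting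
point `0`, and terminal points in the unit interval. -/
lemma lt_one_div_resolventRate_of_orbitAvg_lt (hn : 1 ≤ n) {a : ℝ} (ha : 0 < a)
    (h : ∀ lam ∈ Ioo (0 : ℝ) 1, lam ≤ 1 / 2 → ∀ t ∈ Icc (0 : ℝ) 1,
      orbitAvg (n := n) symNorm lam 0 t * (a * weight lam) ^ (n + 1) <
        orbitAvg (n := n) l1Norm lam 0 t) {lam : ℝ} (hlam : lam ∈ Ioo (0 : ℝ) 1) :
    a < 1 / resolventRate n lam := by
  have hfac : 0 < 1 / (n.factorial : ℝ) := by positivity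
  -- All terminal and starting points whose difference lies in `[-1, 1]`.
  have hhalf : ∀ lam ∈ Ioo (0 : ℝ) 1, lam ≤ 1 / 2 → ∀ t ∈ Icc (-1 : ℝ) 1,
      orbitAvg (n := n) symNorm lam (max 0 (-t)) (max 0 t) * (a * weight lam) ^ (n + 1) <
        orbitAvg (n := n) l1Norm lam (max 0 (-t)) (max 0 t) := by
    intro lam hlam hle t ht
    rcases le_or_gt 0 t with h0 | h0
    · rw [max_eq_left (by linarith), max_eq_right h0]
      exact h lam hlam hle t ⟨h0, ht.2⟩
    · have hs : 1 + t ∈ Ico (0 : ℝ) 1 := ⟨by linarith [ht.1], by linarith⟩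
      have h1 := orbitAvg_periodic (n := n) continuous_symNorm symNorm_smul hn lam hs
      have h2 := orbitAvg_periodic (n := n) continuous_l1Norm l1Norm_smul hn lam hs
      rw [abs_of_pos hlam.1, abs_of_neg (by linarith [hlam.2]),
        show 1 - (1 + t) = -t by ring] at h1 h2
      rw [max_eq_right (by linarith), max_eq_left h0.le]
      have h3 := mul_lt_mul_of_pos_left (h lam hlam hle (1 + t) ⟨hs.1, hs.2.le⟩)
        (show 0 < -(lam - 1) by linarith [hlam.2])
      rw [← h2, ← mul_assoc, ← h1, mul_assoc] at h3
      exact lt_of_mul_lt_mul_left h3 hlam.1.le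
  refine lt_one_div_resolventRate hn hlam ha fun t ht => ?_
  rw [kernelLie, kernel, kernelLie₂_eq, kernel₂_eq, mul_assoc]
  refine mul_lt_mul_of_pos_left ?_ hfac
  rcases le_total lam (1 / 2) with hle | hle
  · exact hhalf lam hlam hle t ht
  · have hlam' : 1 - lam ∈ Ioo (0 : ℝ) 1 := ⟨by linarith [hlam.2], by linarith [hlam.1]⟩
    have h1 := hhalf (1 - lam) hlam' (by linarith) (-t) ⟨by linarith [ht.2], by linarith [ht.1]⟩
    have hp : 1 - max 0 (-t) ∈ Icc (0 : ℝ) 1 := ⟨by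
      linarith [max_le (zero_le_one (α := ℝ)) (by linarith [ht.1] : -t ≤ 1)], by
      linarith [le_max_left 0 (-t)]⟩
    have hq : 1 - max 0 t ∈ Icc (0 : ℝ) 1 := ⟨by
      linarith [max_le (zero_le_one (α := ℝ)) ht.2], by linarith [le_max_left 0 t]⟩
    have hd : 1 - max 0 t - (1 - max 0 (-t)) = -t := by
      rcases le_total 0 t with h0 | h0
      · rw [max_eq_right h0, max_eq_left (by linarith)]; ring
      · rw [max_eq_left h0, max_eq_right (by linarith)]; ring
    have h2 := orbitAvg_sub (n := n) continuous_symNorm symNorm_smul hn (1 - lam) hp hq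
    have h3 := orbitAvg_sub (n := n) continuous_l1Norm l1Norm_smul hn (1 - lam) hp hq
    rw [orbitAvg_reflect continuous_symNorm symNorm_smul hn, hd] at h2
    rw [orbitAvg_reflect continuous_l1Norm l1Norm_smul hn, hd] at h3
    rw [weight_one_sub, ← h2, ← h3] at h1
    exact h1

end LowDegree

namespace BracketTree

/-- A numeral denotes the tree which consists of this letter. -/
instance (n k : ℕ) [NeZero n] : OfNat (BracketTree n) k := ⟨leaf (Fin.ofNat n k)⟩

end BracketTree

/-- If the terminal point is moved from above all letters to below all letters, then the last step
becomes a descent, and the weights are multiplied by `(λ-1)/λ`. -/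
def Presentation.shift {n : ℕ} (π : Presentation n) : Presentation n :=
  π.map fun p => (p.1, 0 :: p.2.map fun a => -a)

/-! In the following presentations, the list after a product contains the coefficients, with
respect to the monomials `λ^(n+1-i)(1-λ)^i`, of twice the coefficient of the product. The words
which complete the presentations are left out. The presentations are optimal, or nearly so, on
some interval of parameters. -/

open BracketTree (br)

namespace DegreeTwo

/-- Both letters below the terminal point. -/
def twoBelow : Presentation 2 :=
  [([br 0 1], [2])]

/-- The presentations, according to the number of letters below the terminal point. -/
def presentations : ℕ → Presentation 2
  | 0 => twoBelow.shift
  | 1 => []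
  | _ => twoBelow

end DegreeTwo

namespace DegreeThree

/-- One letter below the terminal point. -/
def oneBelow : Presentation 3 :=
  [([0, br 1 2], [0, -2]), ([1, br 0 2], [0, 2])]

/-- Two letters below the terminal point, for `λ` near `0.3`. -/
def twoBelow₁ : Presentation 3 :=
  [([br 0 1, 2], [0, -4]), ([br 0 (br 1 2)], [0, 2]), ([2, br 0 1], [0, -2])]

/-- Two letters below the terminal point, for `λ` near `0.45`. -/
def twoBelow₂ : Presentation 3 :=
  [([br 0 1, 2], [0, 4, -4]), ([1, br 0 2], [0, 4, -2]), ([2, br 0 1], [0, -2]),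
    ([br 1 2, 0], [0, 2, -2])]

/-- All letters below the terminal point. -/
def threeBelow : Presentation 3 :=
  [([br 0 (br 1 2)], [0, 2]), ([2, br 0 1], [0, 2, -2])]

/-- The presentations, according to the number of letters below the terminal point. -/
def presentations (π : Presentation 3) : ℕ → Presentation 3
  | 0 => threeBelow.shift
  | 1 => oneBelow
  | 2 => π
  | _ => threeBelow

end DegreeThree

namespace DegreeFour

/-- One letter below the terminal point, for `λ ≤ 0.4`. -/
def oneBelow₁ : Presentation 4 :=
  [([br (br (br 0 1) 2) 3], [0, 0, 2, -2]), ([0, br 2 3, 1], [0, 0, 2]),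
    ([0, 3, br 1 2], [0, 0, 2]), ([br 0 1, 3, 2], [0, 0, -6, 4]),
    ([br (br (br 0 3) 2) 1], [0, 0, 2]), ([3, 0, br 1 2], [0, 0, 4, -2]),
    ([2, 1, br 0 3], [0, 0, -2]), ([2, 0, br 1 3], [0, 0, 4, -2]), ([br 2 3, 1, 0], [0, 0, 2]),
    ([1, 0, br 2 3], [0, 0, 4, -2]), ([3, 1, br 0 2], [0, 0, -2])]

/-- One letter below the terminal point, for `λ ≥ 0.4`. -/
def oneBelow₂ : Presentation 4 :=
  [([br (br (br 0 1) 2) 3], [0, 0, -4, 2]), ([0, br 2 3, 1], [0, -2, 6, -2]),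
    ([0, 3, br 1 2], [0, 0, 2]), ([0, br 1 (br 2 3)], [0, -2, 4, -2]),
    ([br (br (br 0 3) 2) 1], [0, 0, 2]), ([3, 0, br 1 2], [0, 0, -2, 2]),
    ([2, 1, br 0 3], [0, 0, 4, -4]), ([2, 0, br 1 3], [0, 0, -2, 2]),
    ([br 2 3, 1, 0], [0, 0, 2]), ([1, 0, br 2 3], [0, 0, -2, 2]),
    ([3, 1, br 0 2], [0, 0, 4, -4]), ([3, br 1 2, 0], [0, 0, 6, -4])]

/-- Two letters below the terminal point, for `λ ≤ 0.345`. -/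
def twoBelow₁ : Presentation 4 :=
  [([br 0 1, br 2 3], [0, 0, -2]), ([br 0 (br 1 (br 2 3))], [0, 0, 2]),
    ([2, br (br 0 3) 1], [0, 2]), ([2, 1, br 0 3], [0, 2, -2]), ([1, br 0 3, 2], [0, 0, -6, 2]),
    ([br 0 (br 1 2), 3], [0, 0, -2]), ([3, br 0 1, 2], [0, 0, -2, 2]),
    ([br 1 3, 0, 2], [0, 0, -4, 2]), ([3, 1, br 0 2], [0, 0, -6, 2]),
    ([3, 2, br 0 1], [0, 0, 2]), ([3, br 0 (br 1 2)], [0, 0, 4, -2])]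

/-- Two letters below the terminal point, for `0.345 ≤ λ ≤ 0.416`. -/
def twoBelow₂ : Presentation 4 :=
  [([3, 2, br 0 1], [0, 0, -2, 2]), ([1, br 0 3, 2], [0, 0, -2]),
    ([br 0 (br 1 2), 3], [0, 0, -2]), ([br 0 1, br 2 3], [0, 0, 2, -2]),
    ([br 0 (br 1 (br 2 3))], [0, -2, 0, 2]), ([br 2 3, br 0 1], [0, -2, -2, 2]),
    ([br (br (br 0 2) 1) 3], [0, 0, -4, 2]), ([2, br (br 0 3) 1], [0, 0, -2, 2]),
    ([3, br 0 1, 2], [0, 0, -2, 2]), ([3, 1, br 0 2], [0, 0, 2, -2])]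

/-- Two letters below the terminal point, for `0.416 ≤ λ ≤ 0.444`. -/
def twoBelow₃ : Presentation 4 :=
  [([3, 1, br 0 2], [0, 0, 1, -1]), ([br 0 (br 1 2), 3], [0, 4, -2, -2]),
    ([br (br (br 0 2) 1) 3], [0, 8, -4, -2]), ([3, 2, br 0 1], [0, -2, -1, 2]),
    ([br 2 3, br 0 1], [0, 2, -2]), ([br 0 (br 1 (br 2 3))], [0, 2]),
    ([br (br 1 2) 3, 0], [0, -2, 1]), ([1, br 0 3, 2], [0, 8, -2, -4]),
    ([br 0 1, br 2 3], [0, -8, 2, 2]), ([3, br 0 1, 2], [0, 6, -3]),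
    ([2, br (br 0 3) 1], [0, 4, -2]), ([br 1 3, 0, 2], [0, 2, 0, -1])]

/-- Two letters below the terminal point, for `λ ≥ 0.444`. -/
def twoBelow₄ : Presentation 4 :=
  [([br (br 1 2) 3, 0], [0, 0, 2, -2]), ([br 0 1, br 2 3], [0, 0, -2]),
    ([br 2 3, br 0 1], [0, -2, 0, 1]), ([2, br (br 0 3) 1], [0, 0, 0, 1]),
    ([br 1 3, 0, 2], [0, 0, -4, 4]), ([1, br 0 3, 2], [0, 0, 2, -2]),
    ([br 0 (br 1 2), 3], [0, 0, 0, -1]), ([3, 1, br 0 2], [0, 0, -4, 2]),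
    ([br 0 (br 1 (br 2 3))], [0, -2, 2, 1]), ([0, 2, br 1 3], [0, 4, -2, -1])]

/-- Three letters below the terminal point, for `λ ≤ 0.345`. -/
def threeBelow₁ : Presentation 4 :=
  [([br 0 (br 1 2), 3], [0, 0, -2]), ([br 0 (br 1 (br 2 3))], [0, 0, 2]),
    ([br (br (br 0 3) 1) 2], [0, 2, -2]), ([br (br 0 1) 2, 3], [0, -2, 4, -2]),
    ([3, br 0 (br 1 2)], [0, 0, -2])]

/-- Three letters below the terminal point, for `0.345 ≤ λ ≤ 0.38`. -/
def threeBelow₂ : Presentation 4 :=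
  [([br 0 (br 1 2), 3], [0, 0, -2]), ([br 0 (br 1 (br 2 3))], [0, 2]),
    ([3, br (br 0 1) 2], [0, 2, 2, -2]), ([3, br 0 (br 1 2)], [0, 0, -2]),
    ([br (br (br 0 3) 1) 2], [0, -2]), ([br (br 0 1) 2, 3], [0, 2, 2, -2])]

/-- Three letters below the terminal point, for `λ ≥ 0.38`. -/
def threeBelow₃ : Presentation 4 :=
  [([br 0 1, 2, 3], [0, -4, 2]), ([br 0 (br 1 (br 2 3))], [0, 2]),
    ([0, br 1 2, 3], [0, -2, -2, 2]), ([3, br 0 1, 2], [0, -4, 2]),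
    ([br 0 (br 1 2), 3], [0, 2, 0, -2]), ([3, br 0 (br 1 2)], [0, 2, 0, -2]),
    ([3, 0, br 1 2], [0, -2, -2, 2]), ([br (br (br 0 3) 1) 2], [0, -2])]

/-- All letters below the terminal point. -/
def fourBelow : Presentation 4 :=
  [([br 0 (br 1 (br 2 3))], [0, 2]), ([br (br 0 (br 1 3)) 2], [0, 2]),
    ([br (br 0 1) (br 2 3)], [0, 2]), ([br (br 0 (br 1 2)) 3], [0, 2])]

/-- The presentations, according to the number of letters below the terminal point. -/
def presentations (π₁ π₂ π₃ : Presentation 4) : ℕ → Presentation 4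
  | 0 => fourBelow.shift
  | 1 => π₁
  | 2 => π₂
  | 3 => π₃
  | _ => fourBelow

end DegreeFour

namespace DegreeTwo

lemma isCertificate_0_250 :
    isCertificate 2183 0 250 0 (fun _ => [] : ℕ → Presentation 2) = true := by
  decide +kernel

lemma isCertificate_250_430 :
    isCertificate 2183 250 430 0 presentations = true := by
  decide +kernel

lemma isCertificate_430_500 :
    isCertificate 2183 430 500 0 presentations = true := by
  decide +kernel

end DegreeTwo

theorem lt_one_div_resolventRate_two {lam : ℝ} (hlam : lam ∈ Ioo (0 : ℝ) 1) :
    2.183 < 1 / resolventRate 2 lam := by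
  refine lt_one_div_resolventRate_of_orbitAvg_lt (by norm_num) (by norm_num)
    (fun lam hlam hle t ht => ?_) hlam
  rw [show (2.183 : ℝ) = (2183 : ℕ) / 1000 by norm_num]
  rcases le_or_gt lam 0.25 with h0 | h0
  · exact orbitAvg_lt_of_isCertificate (by norm_num) (by norm_num) DegreeTwo.isCertificate_0_250
      hlam hle (by push_cast; linarith [hlam.1]) (by push_cast; linarith) ht
  rcases le_or_gt lam 0.43 with h1 | h1
  · exact orbitAvg_lt_of_isCertificate (by norm_num) (by norm_num) DegreeTwo.isCertificate_250_430
      hlam hle (by push_cast; linarith) (by push_cast; linarith) ht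
  exact orbitAvg_lt_of_isCertificate (by norm_num) (by norm_num) DegreeTwo.isCertificate_430_500
    hlam hle (by push_cast; linarith) (by push_cast; linarith) ht

namespace DegreeThree

lemma isCertificate_0_200 :
    isCertificate 2247 0 200 0 (fun _ => [] : ℕ → Presentation 3) = true := by
  decide +kernel

lemma isCertificate_200_370 :
    isCertificate 2247 200 370 0 (presentations twoBelow₁) = true := by
  decide +kernel

lemma isCertificate_370_500 :
    isCertificate 2247 370 500 8 (presentations twoBelow₂) = true := by
  decide +kernel

end DegreeThree

theorem lt_one_div_resolventRate_three {lam : ℝ} (hlam : lam ∈ Ioo (0 : ℝ) 1) :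
    2.247 < 1 / resolventRate 3 lam := by
  refine lt_one_div_resolventRate_of_orbitAvg_lt (by norm_num) (by norm_num)
    (fun lam hlam hle t ht => ?_) hlam
  rw [show (2.247 : ℝ) = (2247 : ℕ) / 1000 by norm_num]
  rcases le_or_gt lam 0.2 with h0 | h0
  · exact orbitAvg_lt_of_isCertificate (by norm_num) (by norm_num) DegreeThree.isCertificate_0_200
      hlam hle (by push_cast; linarith [hlam.1]) (by push_cast; linarith) ht
  rcases le_or_gt lam 0.37 with h1 | h1
  · exact orbitAvg_lt_of_isCertificate (by norm_num) (by norm_num) DegreeThree.isCertificate_200_370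
      hlam hle (by push_cast; linarith) (by push_cast; linarith) ht
  exact orbitAvg_lt_of_isCertificate (by norm_num) (by norm_num) DegreeThree.isCertificate_370_500
    hlam hle (by push_cast; linarith) (by push_cast; linarith) ht

namespace DegreeFour

lemma isCertificate_0_182 :
    isCertificate 2333 0 182 0 (fun _ => [] : ℕ → Presentation 4) = true := by
  decide +kernel

lemma isCertificate_182_270 :
    isCertificate 2333 182 270 5 (presentations oneBelow₁ twoBelow₁ threeBelow₁) = true := by
  decide +kernel

lemma isCertificate_270_345 :
    isCertificate 2333 270 345 4 (presentations oneBelow₁ twoBelow₁ threeBelow₁) = true := by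
  decide +kernel

lemma isCertificate_345_380 :
    isCertificate 2333 345 380 8 (presentations oneBelow₁ twoBelow₂ threeBelow₂) = true := by
  decide +kernel

lemma isCertificate_380_400 :
    isCertificate 2333 380 400 7 (presentations oneBelow₁ twoBelow₂ threeBelow₃) = true := by
  decide +kernel

lemma isCertificate_400_416 :
    isCertificate 2333 400 416 8 (presentations oneBelow₂ twoBelow₂ threeBelow₃) = true := by
  decide +kernel

lemma isCertificate_416_444 :
    isCertificate 2333 416 444 9 (presentations oneBelow₂ twoBelow₃ threeBelow₃) = true := by
  decide +kernel

lemma isCertificate_444_500 :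
    isCertificate 2333 444 500 10 (presentations oneBelow₂ twoBelow₄ threeBelow₃) = true := by
  decide +kernel

end DegreeFour

theorem lt_one_div_resolventRate_four {lam : ℝ} (hlam : lam ∈ Ioo (0 : ℝ) 1) :
    2.333 < 1 / resolventRate 4 lam := by
  refine lt_one_div_resolventRate_of_orbitAvg_lt (by norm_num) (by norm_num)
    (fun lam hlam hle t ht => ?_) hlam
  rw [show (2.333 : ℝ) = (2333 : ℕ) / 1000 by norm_num]
  rcases le_or_gt lam 0.182 with h0 | h0
  · exact orbitAvg_lt_of_isCertificate (by norm_num) (by norm_num) DegreeFour.isCertificate_0_182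
      hlam hle (by push_cast; linarith [hlam.1]) (by push_cast; linarith) ht
  rcases le_or_gt lam 0.27 with h1 | h1
  · exact orbitAvg_lt_of_isCertificate (by norm_num) (by norm_num) DegreeFour.isCertificate_182_270
      hlam hle (by push_cast; linarith) (by push_cast; linarith) ht
  rcases le_or_gt lam 0.345 with h2 | h2
  · exact orbitAvg_lt_of_isCertificate (by norm_num) (by norm_num) DegreeFour.isCertificate_270_345
      hlam hle (by push_cast; linarith) (by push_cast; linarith) ht
  rcases le_or_gt lam 0.38 with h3 | h3
  · exact orbitAvg_lt_of_isCertificate (by norm_num) (by norm_num) DegreeFour.isCertificate_345_380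
      hlam hle (by push_cast; linarith) (by push_cast; linarith) ht
  rcases le_or_gt lam 0.4 with h4 | h4
  · exact orbitAvg_lt_of_isCertificate (by norm_num) (by norm_num) DegreeFour.isCertificate_380_400
      hlam hle (by push_cast; linarith) (by push_cast; linarith) ht
  rcases le_or_gt lam 0.416 with h5 | h5
  · exact orbitAvg_lt_of_isCertificate (by norm_num) (by norm_num) DegreeFour.isCertificate_400_416
      hlam hle (by push_cast; linarith) (by push_cast; linarith) ht
  rcases le_or_gt lam 0.444 with h6 | h6
  · exact orbitAvg_lt_of_isCertificate (by norm_num) (by norm_num) DegreeFour.isCertificate_416_444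
      hlam hle (by push_cast; linarith) (by push_cast; linarith) ht
  exact orbitAvg_lt_of_isCertificate (by norm_num) (by norm_num) DegreeFour.isCertificate_444_500
    hlam hle (by push_cast; linarith) (by push_cast; linarith) ht

end

end MagnusLie

theorem mainTheorem6 (n : ℕ) (hn : 1 ≤ n) :
    -- the kernels depend only on the difference of their arguments
    (∀ lam ∈ Set.Icc (0 : ℝ) 1, ∀ t₀ ∈ Set.Icc (0 : ℝ) 1, ∀ t' ∈ Set.Icc (0 : ℝ) 1,
      MagnusLie.kernelLie₂ n lam t₀ t' = MagnusLie.kernelLie n lam (t' - t₀) ∧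
      MagnusLie.kernel₂ n lam t₀ t' = MagnusLie.kernel n lam (t' - t₀)) ∧
    -- the ratio is well defined, its maximum is attained, and it is less than 1
    (∀ lam ∈ Set.Ioo (0 : ℝ) 1,
      (∀ t ∈ Set.Icc (-1 : ℝ) 1, 0 < MagnusLie.kernel n lam t) ∧
      IsGreatest ((fun t => MagnusLie.kernelLie n lam t / MagnusLie.kernel n lam t) ''
        Set.Icc (-1) 1) (MagnusLie.ratioS n lam) ∧
      (2 ≤ n → MagnusLie.ratioS n lam < 1)) ∧
    -- the estimates of the convergence radius
    ∃ m : ℝ, IsGreatest (MagnusLie.resolventRate n '' Set.Icc (0 : ℝ) 1) m ∧ 0 < m ∧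
      ENNReal.ofReal (1 / m) ≤ MagnusLie.convRadiusLie ∧
      (2 ≤ n → 2 < 1 / m) ∧
      (n = 2 → 2.183 < 1 / m) ∧
      (n = 3 → 2.247 < 1 / m) ∧
      (n = 4 → 2.333 < 1 / m) := by
  refine ⟨fun lam _ t₀ h₀ t' h' => ⟨MagnusLie.kernelLie₂_eq_kernelLie hn lam h₀ h',
    MagnusLie.kernel₂_eq_kernel hn lam h₀ h'⟩, fun lam hlam => ⟨fun t _ =>
      MagnusLie.kernel_pos hlam t, MagnusLie.isGreatest_ratioS hn hlam, fun h2 => ?_⟩, ?_⟩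
  · obtain ⟨t, -, ht⟩ := (MagnusLie.isGreatest_ratioS hn hlam).1
    rw [← ht]
    exact MagnusLie.kernelRatio_lt_one h2 hlam t
  · obtain ⟨lam, hlam, hmax⟩ := MagnusLie.exists_isGreatest_resolventRate hn
    have hpos := MagnusLie.resolventRate_pos hn hlam
    refine ⟨_, hmax, hpos, ?_, fun h2 => ?_, ?_, ?_, ?_⟩
    · refine MagnusLie.le_convRadiusLie hn hpos ?_ fun x hx =>
        hmax.2 ⟨x, Set.Ioo_subset_Icc_self hx, rfl⟩
      exact (MagnusLie.resolventRate_le_weight hn hlam).trans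
        ((MagnusLie.weight_le lam).trans (by norm_num))
    · exact (lt_one_div two_pos hpos).2 (MagnusLie.resolventRate_lt_half h2 hlam)
    · rintro rfl
      exact MagnusLie.lt_one_div_resolventRate_two hlam
    · rintro rfl
      exact MagnusLie.lt_one_div_resolventRate_three hlam
    · rintro rfl
      exact MagnusLie.lt_one_div_resolventRate_four hlam
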